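/- Setting. Let $W$ be a commutative ring of functions of $n$, stable under the shift $\Lambda^{\pm1}$, $(\Lambda a)(n)=a(n+1)$ (equivalently, a commutative ring with an automorphism $\Lambda$), large enough to contain all functions of $n$ below. Let $\mathcal A=\mathbb Z[v_i,w_i : i\in\mathbb Z]$ with the shift $\Lambda v_i=v_{i+1}$, $\Lambda w_i=w_{i+1}$, let $L=\Lambda+v_0+w_0\Lambda^{-1}$, $A_k=(L^{k+1})_+$ (the part with non-negative powers of $\Lambda$), and let $D_k$ ($k\ge0$) be the derivation of $\mathcal A$ commuting with $\Lambda$ such that $D_k(v_0)=\mathrm{Coef}([A_k,L],0)$, $D_k(w_0)=\mathrm{Coef}([A_k,L],-1)$. The canonical tau-structure is the family $\Omega_{p,q},S_p\in\mathcal A$ ($p,q\ge 0$) with $\Omega_{p,q}=\Omega_{q,p}$, $D_r\Omega_{p,q}=D_q\Omega_{p,r}$, $(\Lambda-1)\Omega_{p,q}=D_q S_p$, $w_0(1-\Lambda^{-1})S_p=D_p w_0$, all of whose members vanish when all $v_i=w_i=0$. Let $f(n),g(n)\in W$, and let $v(n,\mathbf t),w(n,\mathbf t)\in W[[\mathbf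 t]]$, $\mathbf t=(t_0,t_1,\dots)$, be the solution of the Toda lattice hierarchy $\partial v/\partial t_k=D_k(v_0)$, $\partial w/\partial t_k=D_k(w_0)$ (with $v_i,w_i$ replaced by $v(n+i,\mathbf t),w(n+i,\mathbf t)$) with $v(n,\mathbf 0)=f(n)$, $w(n,\mathbf 0)=g(n)$. Let $\tau(n,\mathbf t)\in W[[\mathbf t]]$ be a Dubrovin–Zhang type tau-function of $(v,w)$: an invertible element such that, with the same substitution in $\Omega_{p,q},S_p$, $$\Omega_{p,q}(n,\mathbf t)=\frac{\partial^2\log\tau(n,\mathbf t)}{\partial t_p\partial t_q},\qquad S_p(n,\mathbf t)=\frac{\partial}{\partial t_p}\log\frac{\tau(n+1,\mathbf t)}{\tau(n,\mathbf t)},\qquad w(n,\mathbf t)=\frac{\tau(n+1,\mathbf t)\,\tau(n-1,\mathbf t)}{\tau(n,\mathbf t)^2}.$$ Fix $s(n)$ with $s(n)-s(n-1)=-\log g(n)$; precisely, fix an invertible function $e^{s(n)}$ in $W$ with $e^{s(n-1)}/e^{s(n)}=g(n)$. With $\lambda^{n}$ a formal symbol such that $\Lambda^{m}\lambda^{n}=\lambda^{m}\lambda^{n}$,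 let $$\psi_A(\lambda,n)\in(1+\lambda^{-1}W[[\lambda^{-1}]])\,\lambda^n,\qquad \psi_B(\lambda,n)\in(1+\lambda^{-1}W[[\lambda^{-1}]])\,e^{-s(n)}\lambda^{-n}$$ both satisfy $\psi(\lambda,n+1)+f(n)\psi(\lambda,n)+g(n)\psi(\lambda,n-1)=\lambda\,\psi(\lambda,n)$, and suppose that they form a pair: $$e^{s(n-1)}\bigl(\psi_A(\lambda,n)\psi_B(\lambda,n-1)-\psi_B(\lambda,n)\psi_A(\lambda,n-1)\bigr)=\lambda .$$ Put $$D(\lambda,\mu,n)=\frac{\psi_A(\lambda,n)\,\psi_B(\mu,n-1)-\psi_A(\lambda,n-1)\,\psi_B(\mu,n)}{\lambda-\mu}.$$ Theorem. For every integer $k\ge2$, $$\sum_{i_1,\dots,i_k\ge0}\frac{\partial^k\log\tau}{\partial t_{i_1}\cdots\partial t_{i_k}}(n,\mathbf 0)\,\frac{1}{\lambda_1^{i_1+2}\cdots\lambda_k^{i_k+2}} =(-1)^{k-1}\frac{e^{k\,s(n-1)}}{\prod_{j=1}^k\lambda_j}\sum_{\pi\in S_k/C_k}\ \prod_{j=1}^kD(\lambda_{\pi(j)},\lambda_{\pi(j+1)},n)\;-\;\frac{\delta_{k,2}}{(\lambda_1-\lambda_2)^2},$$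 where $S_k$ is the symmetric group, $C_k$ is its cyclic subgroup generated by $j\mapsto j+1$, and $\pi(k+1)=\pi(1)$. The identity holds in the ring $W[[\lambda_1^{-1},\dots,\lambda_k^{-1}]]$ with all $\lambda_i$, all $(\lambda_i-\lambda_j)^{-1}$ ($i\neq j$) and the symbols $\lambda_j^{\pm n}$ adjoined; hence also after expansion of the right-hand side with respect to $|\lambda_{j_1}|>\dots>|\lambda_{j_k}|$ for any ordering $(j_1,\dots,j_k)$ of $(1,\dots,k)$. -/

import Mathlib

open MvPowerSeries (pderiv)
open scoped LaurentPolynomial LaurentSeries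

noncomputable section

namespace Toda

/-! ### The abstract Toda lattice hierarchy -/

/-- The polynomial ring `ℤ[v_i, w_i : i ∈ ℤ]`; `Sum.inl i` indexes `v_i`, `Sum.inr i` indexes `w_i`. -/
abbrev DiffPoly : Type := MvPolynomial (ℤ ⊕ ℤ) ℤ

/-- The generator `v_i`. -/
def vGen (i : ℤ) : DiffPoly := MvPolynomial.X (Sum.inl i)

/-- The generator `w_i`. -/
def wGen (i : ℤ) : DiffPoly := MvPolynomial.X (Sum.inr i)

/-- The power `Λ^m` of the shift operator: `v_i ↦ v_{i+m}`, `w_i ↦ w_{i+m}`. -/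
def shiftPoly (m : ℤ) : DiffPoly →ₐ[ℤ] DiffPoly :=
  MvPolynomial.rename (Sum.map (fun i => i + m) (fun i => i + m))

/-- Difference operators `∑ P_m Λ^m` with finitely many terms; `P m` is the coefficient of `Λ^m`. -/
abbrev DiffOp : Type := ℤ →₀ DiffPoly

/-- Composition of difference operators: `(a Λ^i) (b Λ^j) = a Λ^i(b) Λ^{i+j}`. -/
def DiffOp.comp (P Q : DiffOp) : DiffOp :=
  P.sum fun i a => Q.sum fun j b => Finsupp.single (i + j) (a * shiftPoly i b)

/-- Powers of a difference operator. -/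
def DiffOp.pow (P : DiffOp) : ℕ → DiffOp
  | 0 => Finsupp.single 0 1
  | k + 1 => DiffOp.comp P (DiffOp.pow P k)

/-- The part `P_+` with non-negative powers of `Λ`. -/
def DiffOp.plus (P : DiffOp) : DiffOp :=
  P.filter fun m => 0 ≤ m

/-- The commutator of two difference operators. -/
def DiffOp.commutator (P Q : DiffOp) : DiffOp :=
  DiffOp.comp P Q - DiffOp.comp Q P

/-- The Lax operator `L = Λ + v_0 + w_0 Λ⁻¹`. -/
def lax : DiffOp :=
  Finsupp.single 1 1 + Finsupp.single 0 (vGen 0) + Finsupp.single (-1) (wGen 0)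

/-- `A_k = (L^{k+1})_+`. -/
def laxPlus (k : ℕ) : DiffOp :=
  DiffOp.plus (DiffOp.pow lax (k + 1))

/-- The Toda lattice derivation `D_k`: the derivation commuting with the shift for which
`D_k(v_0) = Coef([A_k, L], 0)` and `D_k(w_0) = Coef([A_k, L], -1)`. -/
def todaD (k : ℕ) : Derivation ℤ DiffPoly DiffPoly :=
  MvPolynomial.mkDerivation ℤ
    (Sum.elim
      (fun i => shiftPoly i (DiffOp.commutator (laxPlus k) lax 0))
      (fun i => shiftPoly i (DiffOp.commutator (laxPlus k) lax (-1))))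

/-- The canonical tau-structure: a tau-structure `(Ω_{p,q}, S_p)` whose members all vanish
when every `v_i` and every `w_i` is set to zero. -/
structure IsCanonicalTauStructure (Ω : ℕ → ℕ → DiffPoly) (S : ℕ → DiffPoly) : Prop where
  symm : ∀ p q, Ω p q = Ω q p
  closed : ∀ p q r, todaD r (Ω p q) = todaD q (Ω p r)
  shift_sub : ∀ p q, shiftPoly 1 (Ω p q) - Ω p q = todaD q (S p)
  w_mul_sub : ∀ p, wGen 0 * (S p - shiftPoly (-1) (S p)) = todaD p (wGen 0)
  Ω_zero : ∀ p q, MvPolynomial.constantCoeff (Ω p q) = 0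
  S_zero : ∀ p, MvPolynomial.constantCoeff (S p) = 0

/-! ### Solutions and tau-functions

`W` is a commutative ring of functions of `n`, with the automorphism `Λ`, `(Λ a)(n) = a(n+1)`.
A function of `(n, t)`, `t = (t_0, t_1, …)`, is a power series in `t` with coefficients in `W`. -/

section Solutions

variable {W : Type*} [CommRing W]

/-- `a(n, t) ↦ a(n + m, t)`. -/
def shiftTime (Λ : RingAut W) (m : ℤ) : MvPowerSeries ℕ W →+* MvPowerSeries ℕ W :=
  MvPowerSeries.map ((Λ ^ m : RingAut W) : W →+* W)

/-- The substitution `v_i ↦ v(n+i, t)`, `w_i ↦ w(n+i, t)`. -/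
def substSol (Λ : RingAut W) (v w : MvPowerSeries ℕ W) : DiffPoly →ₐ[ℤ] MvPowerSeries ℕ W :=
  MvPolynomial.aeval (Sum.elim (fun i => shiftTime Λ i v) (fun i => shiftTime Λ i w))

/-- `(v, w)` solves the Toda lattice hierarchy. -/
def IsTodaSolution (Λ : RingAut W) (v w : MvPowerSeries ℕ W) : Prop :=
  ∀ k : ℕ, pderiv W k v = substSol Λ v w (todaD k (vGen 0)) ∧
    pderiv W k w = substSol Λ v w (todaD k (wGen 0))

/-- The logarithmic derivative `∂^m log τ / ∂t_{p_1} ⋯ ∂t_{p_m}` of an invertible `τ`, for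
`m ≥ 1` and the list `[p_1, …, p_m]`, where `∂ log τ / ∂t_p` is `τ⁻¹ ∂τ/∂t_p`.
(The value at the empty list is never used.) -/
def logDeriv (τ : (MvPowerSeries ℕ W)ˣ) : List ℕ → MvPowerSeries ℕ W
  | [] => 0
  | [p] => (τ⁻¹ : (MvPowerSeries ℕ W)ˣ) * pderiv W p (τ : MvPowerSeries ℕ W)
  | p :: q :: l => pderiv W p (logDeriv τ (q :: l))

/-- `τ(n, t) ↦ τ(n + m, t)`. -/
def shiftTau (Λ : RingAut W) (m : ℤ) (τ : (MvPowerSeries ℕ W)ˣ) : (MvPowerSeries ℕ W)ˣ :=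
  Units.map (shiftTime Λ m : MvPowerSeries ℕ W →* MvPowerSeries ℕ W) τ

/-- `τ` is a Dubrovin–Zhang type tau-function of the solution `(v, w)`. -/
def IsTauFunction (Λ : RingAut W) (v w : MvPowerSeries ℕ W) (τ : (MvPowerSeries ℕ W)ˣ) : Prop :=
  ∃ (Ω : ℕ → ℕ → DiffPoly) (S : ℕ → DiffPoly), IsCanonicalTauStructure Ω S ∧
    (∀ p q, substSol Λ v w (Ω p q) = logDeriv τ [p, q]) ∧
    (∀ p, substSol Λ v w (S p) = logDeriv (shiftTau Λ 1 τ / τ) [p]) ∧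
    w = ((shiftTau Λ 1 τ * shiftTau Λ (-1) τ / τ ^ 2 : (MvPowerSeries ℕ W)ˣ) : MvPowerSeries ℕ W)

/-! ### Wave functions

The variable of `W⸨X⸩` is `X = λ⁻¹`, and `T` in `W⸨X⸩[T;T⁻¹]` is the symbol `λ^n`. -/

/-- The monomial `λ^m` in `W⸨X⸩`, for an integer `m`. -/
def lamPow (m : ℤ) : W⸨X⸩ := HahnSeries.single (-m) 1

/-- A ring automorphism acting on the coefficients of Laurent series. -/
def mapLaurent (Λ : RingAut W) : W⸨X⸩ →+* W⸨X⸩ where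
  toFun φ := HahnSeries.map φ (Λ : W →+* W)
  map_zero' := by ext; simp
  map_one' := by
    ext a
    by_cases h : a = 0 <;> simp [HahnSeries.coeff_one, h]
  map_add' φ χ := by ext; simp
  map_mul' φ χ := by
    ext a
    have h : ∀ φ : W⸨X⸩, (HahnSeries.map φ (Λ : W →+* W)).support = φ.support := by
      intro φ; ext b; simp
    simp [HahnSeries.coeff_mul, h]

/-- The unit `λ^{n+m} = λ^m T` of the ring `W⸨X⸩[T;T⁻¹]`. -/
def lamUnit (m : ℤ) : (W⸨X⸩[T;T⁻¹])ˣ where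
  val := LaurentPolynomial.C (lamPow m) * LaurentPolynomial.T 1
  inv := LaurentPolynomial.C (lamPow (-m)) * LaurentPolynomial.T (-1)
  val_inv := by
    rw [mul_mul_mul_comm, ← map_mul, ← LaurentPolynomial.T_add]
    simp [lamPow]
  inv_val := by
    rw [mul_mul_mul_comm, ← map_mul, ← LaurentPolynomial.T_add]
    simp [lamPow]

/-- The shift `n ↦ n + m` on `W⸨X⸩[T;T⁻¹]`: it shifts coefficients and sends `λ^n` to `λ^{n+m}`. -/
def shiftWave (Λ : RingAut W) (m : ℤ) : W⸨X⸩[T;T⁻¹] →+* W⸨X⸩[T;T⁻¹] :=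
  LaurentPolynomial.eval₂ (LaurentPolynomial.C.comp (mapLaurent (Λ ^ m))) (lamUnit m)

/-- A function of `n`, viewed in `W⸨X⸩[T;T⁻¹]`. -/
def constWave : W →+* W⸨X⸩[T;T⁻¹] :=
  LaurentPolynomial.C.comp HahnSeries.C

/-- `λ` in `W⸨X⸩[T;T⁻¹]`. -/
def lamWave : W⸨X⸩[T;T⁻¹] := LaurentPolynomial.C (lamPow 1)

/-- The action of `L = Λ + f(n) + g(n) Λ⁻¹`. -/
def laxApply (Λ : RingAut W) (f g : W) (ψ : W⸨X⸩[T;T⁻¹]) : W⸨X⸩[T;T⁻¹] :=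
  shiftWave Λ 1 ψ + constWave f * ψ + constWave g * shiftWave Λ (-1) ψ

/-- `E(n) = e^{s(n)}`, where `s(n) - s(n-1) = -log g(n)`: an invertible function with
`e^{s(n-1)} / e^{s(n)} = g(n)`. -/
def IsExpS (Λ : RingAut W) (g : W) (E : Wˣ) : Prop :=
  (Λ⁻¹ : RingAut W) (E : W) * ((E⁻¹ : Wˣ) : W) = g

/-- Wave functions of type A: `ψ = (1 + O(λ⁻¹)) λ^n` with `L ψ = λ ψ`. -/
def IsWaveA (Λ : RingAut W) (f g : W) (ψ : W⸨X⸩[T;T⁻¹]) : Prop :=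
  (∃ φ : PowerSeries W, PowerSeries.constantCoeff φ = 1 ∧
    ψ = LaurentPolynomial.C (φ : W⸨X⸩) * LaurentPolynomial.T 1) ∧
  laxApply Λ f g ψ = lamWave * ψ

/-- Wave functions of type B: `ψ = (1 + O(λ⁻¹)) e^{-s(n)} λ^{-n}` with `L ψ = λ ψ`. -/
def IsWaveB (Λ : RingAut W) (f g : W) (E : Wˣ) (ψ : W⸨X⸩[T;T⁻¹]) : Prop :=
  (∃ φ : PowerSeries W, PowerSeries.constantCoeff φ = 1 ∧
    ψ = LaurentPolynomial.C (φ : W⸨X⸩) * constWave ((E⁻¹ : Wˣ) : W) * LaurentPolynomial.T (-1)) ∧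
  laxApply Λ f g ψ = lamWave * ψ

/-- The normalization `e^{s(n-1)} d(λ,n) = λ`, where
`d(λ,n) = ψ_A(λ,n) ψ_B(λ,n-1) - ψ_B(λ,n) ψ_A(λ,n-1)`. -/
def IsPair (Λ : RingAut W) (E : Wˣ) (ψA ψB : W⸨X⸩[T;T⁻¹]) : Prop :=
  constWave ((Λ⁻¹ : RingAut W) (E : W)) *
    (ψA * shiftWave Λ (-1) ψB - ψB * shiftWave Λ (-1) ψA) = lamWave

end Solutions

/-! ### Several spectral parameters -/

section Spectral

variable (W : Type*) [CommRing W] (k : ℕ)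

/-- The multiplicative set generated by `x_i` and by `x_i - x_j`, `i ≠ j`, in
`W[[x_1, …, x_k]]`, `x_j = λ_j⁻¹`. -/
def specDenoms : Submonoid (MvPowerSeries (Fin k) W) :=
  Submonoid.closure
    ({a | ∃ i, a = MvPowerSeries.X i} ∪
      {a | ∃ i j, i ≠ j ∧ a = MvPowerSeries.X i - MvPowerSeries.X j})

/-- Formal power series in `λ_1⁻¹, …, λ_k⁻¹` with all `λ_i` and all `(λ_i - λ_j)⁻¹`, `i ≠ j`,
adjoined. For each ordering of the `|λ_i|`, expansion is a homomorphism out of this ring. -/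
abbrev SpecRing : Type _ := Localization (specDenoms W k)

variable {W k}

theorem isUnit_specX (i : Fin k) :
    IsUnit (algebraMap (MvPowerSeries (Fin k) W) (SpecRing W k) (MvPowerSeries.X i)) :=
  IsLocalization.map_units (SpecRing W k)
    (⟨_, Submonoid.subset_closure (Or.inl ⟨i, rfl⟩)⟩ : specDenoms W k)

/-- `λ_i` in `SpecRing W k`: the inverse of the `i`-th variable. -/
def specLam (i : Fin k) : SpecRing W k := ((isUnit_specX i).unit⁻¹ : (SpecRing W k)ˣ)

/-- Every element of `specDenoms` is a non-zero-divisor. -/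
theorem specDenoms_le : specDenoms W k ≤ nonZeroDivisors (MvPowerSeries (Fin k) W) := by
  classical
  rw [specDenoms, Submonoid.closure_le]
  rintro a (⟨i, rfl⟩ | ⟨i, j, hij, rfl⟩)
  · exact MvPowerSeries.X_mem_nonzeroDivisors
  · rw [SetLike.mem_coe, mem_nonZeroDivisors_iff_right]
    intro F hF
    rw [mul_sub, sub_eq_zero] at hF
    have key : ∀ (N : ℕ) (m : Fin k →₀ ℕ), m j = N → MvPowerSeries.coeff m F = 0 := by
      intro N
      induction N with
      | zero =>
        intro m hm
        have h := congrArg (MvPowerSeries.coeff (m + Finsupp.single i 1)) hF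
        rw [MvPowerSeries.X, MvPowerSeries.coeff_add_mul_monomial, mul_one, MvPowerSeries.X,
          MvPowerSeries.coeff_mul_monomial, if_neg] at h
        · exact h
        · intro hle
          have := hle j
          simp [hm, hij] at this
      | succ N ih =>
        intro m hm
        have hle : Finsupp.single j 1 ≤ m + Finsupp.single i 1 := by
          intro l
          by_cases hl : j = l
          · subst hl
            rw [Finsupp.single_eq_same, Finsupp.add_apply, hm]
            omega
          · simp [hl]
        have h := congrArg (MvPowerSeries.coeff (m + Finsupp.single i 1)) hF
        rw [MvPowerSeries.X, MvPowerSeries.coeff_add_mul_monomial, mul_one, MvPowerSeries.X,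
          MvPowerSeries.coeff_mul_monomial, if_pos hle, mul_one] at h
        rw [h]
        apply ih
        simp [hm, hij]
    ext m
    exact key _ m rfl

theorem isUnit_specLam_sub {i j : Fin k} (hij : i ≠ j) :
    IsUnit (specLam i - specLam j : SpecRing W k) := by
  have hx : IsUnit (algebraMap (MvPowerSeries (Fin k) W) (SpecRing W k)
      (MvPowerSeries.X j - MvPowerSeries.X i)) :=
    IsLocalization.map_units (SpecRing W k)
      (⟨_, Submonoid.subset_closure (Or.inr ⟨j, i, hij.symm, rfl⟩)⟩ : specDenoms W k)
  have h : ∀ l : Fin k, algebraMap (MvPowerSeries (Fin k) W) (SpecRing W k)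
      (MvPowerSeries.X l) * specLam l = 1 := fun l => (isUnit_specX l).mul_val_inv
  have hu : ∀ l : Fin k, IsUnit (specLam l : SpecRing W k) := fun l => Units.isUnit _
  have e : (specLam i - specLam j : SpecRing W k) =
      algebraMap (MvPowerSeries (Fin k) W) (SpecRing W k)
        (MvPowerSeries.X j - MvPowerSeries.X i) * (specLam i * specLam j) := by
    rw [map_sub]
    linear_combination (-specLam i) * h j + specLam j * h i
  rw [e]
  exact hx.mul ((hu i).mul (hu j))

/-- `1 / (λ_i - λ_j)` (for `i ≠ j`). -/
def specDiffInv (i j : Fin k) : SpecRing W k := Ring.inverse (specLam i - specLam j)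

/-- The substitution `λ ↦ λ_i` on Laurent series in `λ⁻¹`. -/
def evalLaurent (i : Fin k) : W⸨X⸩ →+* SpecRing W k :=
  IsLocalization.lift (M := Submonoid.powers (PowerSeries.X : PowerSeries W))
    (g := (algebraMap (MvPowerSeries (Fin k) W) (SpecRing W k)).comp
      (MvPowerSeries.rename (R := W) (fun _ : Unit => i) :
        PowerSeries W →ₐ[W] MvPowerSeries (Fin k) W).toRingHom) (by
    rintro ⟨_, m, rfl⟩
    have h : MvPowerSeries.rename (R := W) (fun _ : Unit => i) PowerSeries.X =
        MvPowerSeries.X i := MvPowerSeries.rename_X _ _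
    simpa [h] using (isUnit_specX i).pow m)

variable (W k) in
/-- The ring `SpecRing W k` with the symbols `λ_j^{±n}` adjoined: the basis element with exponent
`a : Fin k → ℤ` is `∏_j λ_j^{a_j n}`. -/
abbrev SpecWave : Type _ := AddMonoidAlgebra (SpecRing W k) (Fin k → ℤ)

/-- The symbol `λ_i^n`, a unit. -/
def specSymbol (i : Fin k) : (SpecWave W k)ˣ where
  val := AddMonoidAlgebra.single (Pi.single i 1) 1
  inv := AddMonoidAlgebra.single (Pi.single i (-1)) 1
  val_inv := by
    rw [AddMonoidAlgebra.single_mul_single, ← Pi.single_add]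
    simp [AddMonoidAlgebra.one_def]
  inv_val := by
    rw [AddMonoidAlgebra.single_mul_single, ← Pi.single_add]
    simp [AddMonoidAlgebra.one_def]

/-- The substitution `λ ↦ λ_i`, `λ^n ↦ λ_i^n` on wave functions. -/
def evalWave (i : Fin k) : W⸨X⸩[T;T⁻¹] →+* SpecWave W k :=
  LaurentPolynomial.eval₂ (S := SpecWave W k)
    ((algebraMap (SpecRing W k) (SpecWave W k)).comp (evalLaurent i)) (specSymbol i)

/-- A formal power series in `λ_1⁻¹, …, λ_k⁻¹`, viewed in `SpecWave W k`. -/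
def seriesWave : MvPowerSeries (Fin k) W →+* SpecWave W k :=
  (algebraMap (SpecRing W k) (SpecWave W k)).comp
    (algebraMap (MvPowerSeries (Fin k) W) (SpecRing W k))

/-- `D(λ_i, λ_j, n) = (ψ_A(λ_i,n) ψ_B(λ_j,n-1) - ψ_A(λ_i,n-1) ψ_B(λ_j,n)) / (λ_i - λ_j)`. -/
def kernelD (Λ : RingAut W) (ψA ψB : W⸨X⸩[T;T⁻¹]) (i j : Fin k) : SpecWave W k :=
  algebraMap (SpecRing W k) (SpecWave W k) (specDiffInv i j) *
    (evalWave i ψA * evalWave j (shiftWave Λ (-1) ψB) -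
      evalWave i (shiftWave Λ (-1) ψA) * evalWave j ψB)

/-- The generating series `∑ ∂^k log τ / ∂t_{i_1} ⋯ ∂t_{i_k} (n, 0) λ_1^{-i_1-2} ⋯ λ_k^{-i_k-2}`. -/
def genSeries (k : ℕ) (τ : (MvPowerSeries ℕ W)ˣ) : MvPowerSeries (Fin k) W :=
  let a : MvPowerSeries (Fin k) W := fun i =>
    MvPowerSeries.constantCoeff (logDeriv τ (List.ofFn fun j => i j))
  (∏ j, MvPowerSeries.X j ^ 2) * a

/-- The cyclic group `C_k` inside the symmetric group `S_k`. -/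
abbrev cyclicGroup (k : ℕ) : Subgroup (Equiv.Perm (Fin k)) := Subgroup.zpowers (finRotate k)

/-- The cyclic product `∏_j F(π(j), π(j+1))`, with `π(k+1) = π(1)`, as a function on `S_k / C_k`. -/
def cyclicProd {R : Type*} [CommRing R] (F : Fin k → Fin k → R) :
    Equiv.Perm (Fin k) ⧸ cyclicGroup k → R :=
  Quotient.lift (fun π => ∏ j, F (π j) (π (finRotate k j))) (by
    intro π ρ h
    obtain ⟨m, hm⟩ := QuotientGroup.leftRel_apply.mp h
    have hρ : ρ = π * finRotate k ^ m := by rw [show finRotate k ^ m = π⁻¹ * ρ from hm]; group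
    have hc : ∀ j, ρ (finRotate k j) = π (finRotate k ((finRotate k ^ m) j)) := by
      intro j
      rw [hρ, ← Equiv.Perm.mul_apply, ← Equiv.Perm.mul_apply (finRotate k),
        ← Equiv.Perm.mul_apply, mul_assoc, ← zpow_add_one, ← zpow_one_add, add_comm]
    simp only [hc]
    rw [← Equiv.prod_comp (finRotate k ^ m)]
    simp [hρ])

open Classical in
/-- The sum of the cyclic products over `S_k / C_k`. -/
def cyclicSum {R : Type*} [CommRing R] (F : Fin k → Fin k → R) : R :=
  ∑ c : Equiv.Perm (Fin k) ⧸ cyclicGroup k, cyclicProd F c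

end Spectral

end Toda

end

/-! The wave functions enter only through the ratios y = ψ_A(n-1)/ψ_A(n) and x = ψ_B(n)/ψ_B(n-1),
which are power series in X = λ⁻¹. Dividing the Lax equation by ψ gives Riccati-type difference
equations for y and x. Each has exactly one power series solution, so y and x are universal
expressions in the coefficients of L. With N = 1/(1 - x y), pulling ψ_A(λ_i,n) and ψ_B(λ_j,n-1) out
of D gives D(λ_i,λ_j) = p_i q_j K_ij, where K_ij = N_i (1 - y_i x_j)/(λ_i - λ_j). In a cyclic
product the factors p_i q_i only contribute ∏ p_j q_j, and the pair condition says e^{s(n-1)} p_i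
q_i = λ_i. The prefactor of the theorem therefore cancels exactly, and it remains to prove the
formula with K in place of D (`kernelD_eq`, `IsPair.eval`, `mul_cyclicSum_kernelD`).

That formula is proved universally, over the ring of difference polynomials. The resolvent (λ - L)⁻¹
is built from x, y and N (`green_eq`, `coeff_green`), so D_k v_0, D_k w_0 and S_p are coefficients
of explicit expressions in them. Put ∇(λ_m) = ∑_k λ_m^{-k-2} D_k. Differentiating the Riccati
equations yields linear equations with a unique solution, hence closed formulas for ∇(λ_m) y(λ_i)
and ∇(λ_m) x(λ_i) (`genDer_diffA`, `genDer_diffB`). Two consequences follow.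

For k = 2: the series of Ω_{p,q} and the expression -K_ab K_ba - (λ_a - λ_b)⁻² have the same image
under Λ - 1 and both vanish at v = w = 0. Shift-invariant difference polynomials are constants, so
the two agree (`tauSeries_eq`, `toLoc_tauSeries`).

For larger k: ∇(λ_m) K_ij = -K_im K_mj + (K_mj - K_mi) K_ij (`derivation_diffKernel`). Around a
closed path the second terms telescope to zero and the first insert m into every edge, so ∇(λ_m)
sends the cyclic sum over k indices to minus the cyclic sum over k + 1 indices
(`derivation_cycleSum`, `toLoc_corrSeries`).

Specialising v_i, w_i to f(n+i), g(n+i) turns iterated D_k of Ω into the derivatives of log τ at t =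
0 (`genSeries_eq_map`). -/

noncomputable section

namespace Toda

/-! ### Fixed points of contractions on power series -/

section Contraction

variable {A : Type*} [CommRing A]

/-- `T` increases the order of differences. -/
def IsContraction (T : PowerSeries A → PowerSeries A) : Prop :=
  ∀ (n : ℕ) (a b : PowerSeries A), PowerSeries.X ^ n ∣ a - b → PowerSeries.X ^ (n + 1) ∣ T a - T b

theorem eq_of_forall_X_pow_dvd_sub {a b : PowerSeries A}
    (h : ∀ n, PowerSeries.X ^ n ∣ a - b) : a = b := by
  rw [← sub_eq_zero]
  ext n
  rw [map_zero]
  exact PowerSeries.X_pow_dvd_iff.mp (h (n + 1)) n n.lt_succ_self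

theorem IsContraction.unique {T : PowerSeries A → PowerSeries A} (hT : IsContraction T)
    {a b : PowerSeries A} (ha : T a = a) (hb : T b = b) : a = b := by
  apply eq_of_forall_X_pow_dvd_sub
  intro n
  induction n with
  | zero => simp
  | succ n ih => rw [← ha, ← hb]; exact hT n a b ih

/-- The fixed point of a contraction. -/
def contractionFix (T : PowerSeries A → PowerSeries A) : PowerSeries A :=
  -- Consecutive iterates `T^[m + 1] 0` and `T^[m] 0` differ by a multiple of `X ^ m`, so the
  -- coefficient of `X ^ n` is final from the iterate n + 1 on.
  PowerSeries.mk fun n => PowerSeries.coeff n (T^[n + 1] 0)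

theorem IsContraction.X_pow_dvd_iterate {T : PowerSeries A → PowerSeries A}
    (hT : IsContraction T) (n : ℕ) : PowerSeries.X ^ n ∣ T^[n + 1] 0 - T^[n] 0 := by
  induction n with
  | zero => simp
  | succ n ih =>
    rw [Function.iterate_succ_apply' T (n + 1), Function.iterate_succ_apply' T n]
    rw [Function.iterate_succ_apply' T n] at ih
    exact hT n _ _ ih

theorem IsContraction.X_pow_dvd_fix {T : PowerSeries A → PowerSeries A}
    (hT : IsContraction T) (n : ℕ) : PowerSeries.X ^ n ∣ contractionFix T - T^[n] 0 := by
  have key : ∀ m d : ℕ, PowerSeries.X ^ m ∣ T^[m + d] 0 - T^[m] 0 := by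
    intro m d
    induction d with
    | zero => simp
    | succ d ih =>
      have h := (pow_dvd_pow (PowerSeries.X : PowerSeries A) (Nat.le_add_right m d)).trans
        (hT.X_pow_dvd_iterate (m + d))
      have := dvd_add h ih
      rwa [sub_add_sub_cancel] at this
  rw [PowerSeries.X_pow_dvd_iff]
  intro m hm
  obtain ⟨d, rfl⟩ := Nat.exists_eq_add_of_lt hm
  have := PowerSeries.X_pow_dvd_iff.mp (key (m + 1) d) m m.lt_succ_self
  rw [map_sub, contractionFix, PowerSeries.coeff_mk]
  rw [map_sub, sub_eq_zero] at this
  rw [← this, show m + 1 + d = m + d + 1 by ring, sub_self]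

theorem IsContraction.fix_eq {T : PowerSeries A → PowerSeries A} (hT : IsContraction T) :
    T (contractionFix T) = contractionFix T := by
  apply eq_of_forall_X_pow_dvd_sub
  intro n
  have h := hT n _ _ (hT.X_pow_dvd_fix n)
  rw [← Function.iterate_succ_apply' T n] at h
  have := dvd_sub h (hT.X_pow_dvd_fix (n + 1))
  rw [sub_sub_sub_cancel_right] at this
  exact (pow_dvd_pow _ n.le_succ).trans this

theorem X_pow_dvd_map {B : Type*} [CommRing B] (φ : A →+* B) {n : ℕ} {a : PowerSeries A}
    (h : PowerSeries.X ^ n ∣ a) : PowerSeries.X ^ n ∣ PowerSeries.map φ a := by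
  obtain ⟨c, rfl⟩ := h
  simp

theorem X_pow_succ_dvd_X_mul {n : ℕ} {a : PowerSeries A} (h : PowerSeries.X ^ n ∣ a) :
    PowerSeries.X ^ (n + 1) ∣ PowerSeries.X * a := by
  rw [pow_succ']
  exact mul_dvd_mul_left _ h

end Contraction

/-! ### The ratios of consecutive values of the wave functions -/

section Riccati

variable {A : Type*} [CommRing A] (Λ : RingAut A) (v w : A)

/-- The shift acting on the coefficients of a power series. -/
def shiftSeries (m : ℤ) : PowerSeries A →+* PowerSeries A :=
  PowerSeries.map ((Λ ^ m : RingAut A) : A →+* A)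

theorem shiftSeries_shiftSeries (m n : ℤ) (a : PowerSeries A) :
    shiftSeries Λ m (shiftSeries Λ n a) = shiftSeries Λ (m + n) a := by
  ext k
  simp [shiftSeries, zpow_add]

@[simp] theorem shiftSeries_zero (a : PowerSeries A) : shiftSeries Λ 0 a = a := by
  ext k
  simp [shiftSeries]

@[simp] theorem shiftSeries_X (m : ℤ) :
    shiftSeries Λ m (PowerSeries.X : PowerSeries A) = PowerSeries.X := by
  simp [shiftSeries]

@[simp] theorem shiftSeries_C (m : ℤ) (a : A) :
    shiftSeries Λ m (PowerSeries.C a) = PowerSeries.C ((Λ ^ m) a) := by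
  simp [shiftSeries]

theorem coeff_shiftSeries (m : ℤ) (n : ℕ) (a : PowerSeries A) :
    PowerSeries.coeff n (shiftSeries Λ m a) = (Λ ^ m) (PowerSeries.coeff n a) := by
  simp [shiftSeries]

/-- The recursion for `Λ y`, where `y = ψ_A(n-1) / ψ_A(n)`. -/
def ratioAStep (a : PowerSeries A) : PowerSeries A :=
  shiftSeries Λ (-1) (PowerSeries.X *
    (1 + (PowerSeries.C v + PowerSeries.C w * a) * shiftSeries Λ 1 a))

/-- The recursion for `x = ψ_B(n) / ψ_B(n-1)`. -/
def ratioBStep (a : PowerSeries A) : PowerSeries A :=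
  PowerSeries.X * (PowerSeries.C w + (PowerSeries.C v + shiftSeries Λ 1 a) * a)

/-- The step is X times a polynomial in the series and its shift; the factor X gains one order, and
shifting coefficients preserves divisibility by powers of X. -/
theorem isContraction_ratioAStep : IsContraction (ratioAStep Λ v w) := by
  intro n a b h
  rw [ratioAStep, ratioAStep, ← map_sub, ← mul_sub]
  refine X_pow_dvd_map _ (X_pow_succ_dvd_X_mul ?_)
  have h1 : PowerSeries.X ^ n ∣ shiftSeries Λ 1 a - shiftSeries Λ 1 b := by
    rw [← map_sub]; exact X_pow_dvd_map _ h
  have e : (1 + (PowerSeries.C v + PowerSeries.C w * a) * shiftSeries Λ 1 a) -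
      (1 + (PowerSeries.C v + PowerSeries.C w * b) * shiftSeries Λ 1 b) =
      (a - b) * (PowerSeries.C w * shiftSeries Λ 1 a) +
      (shiftSeries Λ 1 a - shiftSeries Λ 1 b) * (PowerSeries.C v + PowerSeries.C w * b) := by
    ring
  rw [e]
  exact dvd_add (h.mul_right _) (h1.mul_right _)

theorem isContraction_ratioBStep : IsContraction (ratioBStep Λ v w) := by
  intro n a b h
  rw [ratioBStep, ratioBStep, ← mul_sub]
  refine X_pow_succ_dvd_X_mul ?_
  have h1 : PowerSeries.X ^ n ∣ shiftSeries Λ 1 a - shiftSeries Λ 1 b := by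
    rw [← map_sub]; exact X_pow_dvd_map _ h
  have e : (PowerSeries.C w + (PowerSeries.C v + shiftSeries Λ 1 a) * a) -
      (PowerSeries.C w + (PowerSeries.C v + shiftSeries Λ 1 b) * b) =
      (a - b) * (PowerSeries.C v + shiftSeries Λ 1 a) +
      (shiftSeries Λ 1 a - shiftSeries Λ 1 b) * b := by
    ring
  rw [e]
  exact dvd_add (h.mul_right _) (h1.mul_right _)

/-- The ratio `y = ψ_A(n-1) / ψ_A(n)`, a power series in `λ⁻¹`. -/
def ratioA : PowerSeries A := contractionFix (ratioAStep Λ v w)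

/-- The ratio `x = ψ_B(n) / ψ_B(n-1)`, a power series in `λ⁻¹`. -/
def ratioB : PowerSeries A := contractionFix (ratioBStep Λ v w)

theorem ratioA_eq : shiftSeries Λ 1 (ratioA Λ v w) = PowerSeries.X *
    (1 + (PowerSeries.C v + PowerSeries.C w * ratioA Λ v w) * shiftSeries Λ 1 (ratioA Λ v w)) := by
  have h := congrArg (shiftSeries Λ 1) (isContraction_ratioAStep Λ v w).fix_eq
  rw [ratioAStep, shiftSeries_shiftSeries, add_neg_cancel, shiftSeries_zero] at h
  exact h.symm

theorem ratioB_eq : ratioB Λ v w = PowerSeries.X *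
    (PowerSeries.C w + (PowerSeries.C v + shiftSeries Λ 1 (ratioB Λ v w)) * ratioB Λ v w) :=
  (isContraction_ratioBStep Λ v w).fix_eq.symm

variable {Λ v w} in
theorem ratioA_unique {a : PowerSeries A}
    (h : shiftSeries Λ 1 a = PowerSeries.X *
      (1 + (PowerSeries.C v + PowerSeries.C w * a) * shiftSeries Λ 1 a)) : a = ratioA Λ v w := by
  refine (isContraction_ratioAStep Λ v w).unique ?_ (isContraction_ratioAStep Λ v w).fix_eq
  rw [ratioAStep, ← h, shiftSeries_shiftSeries, neg_add_cancel, shiftSeries_zero]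

variable {Λ v w} in
theorem ratioB_unique {a : PowerSeries A}
    (h : a = PowerSeries.X * (PowerSeries.C w + (PowerSeries.C v + shiftSeries Λ 1 a) * a)) :
    a = ratioB Λ v w :=
  (isContraction_ratioBStep Λ v w).unique h.symm (isContraction_ratioBStep Λ v w).fix_eq

theorem X_dvd_ratioA : PowerSeries.X ∣ ratioA Λ v w := by
  have h : PowerSeries.X ^ 1 ∣ shiftSeries Λ 1 (ratioA Λ v w) := by
    rw [ratioA_eq, pow_one]; exact dvd_mul_right _ _
  have := X_pow_dvd_map ((Λ ^ (-1 : ℤ) : RingAut A) : A →+* A) h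
  rw [← shiftSeries, shiftSeries_shiftSeries, neg_add_cancel, shiftSeries_zero, pow_one] at this
  exact this

theorem X_dvd_ratioB : PowerSeries.X ∣ ratioB Λ v w := by
  rw [ratioB_eq]; exact dvd_mul_right _ _

/-- The normalization `1 / (1 - x y)` of the product `ψ_A(n) ψ_B(n-1)`. -/
def ratioN : PowerSeries A := PowerSeries.invOfUnit (1 - ratioB Λ v w * ratioA Λ v w) 1

theorem ratioN_mul : ratioN Λ v w * (1 - ratioB Λ v w * ratioA Λ v w) = 1 := by
  rw [mul_comm, ratioN]
  apply PowerSeries.mul_invOfUnit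
  rw [map_sub, map_mul, PowerSeries.X_dvd_iff.mp (X_dvd_ratioA Λ v w)]
  simp

/-! ### The Green function of the Lax operator in terms of x, y and N -/

/-- The generating series `∑ Coef(L^k, 0) λ^{-k-1}`. -/
def greenDiag : PowerSeries A := shiftSeries Λ 1 (ratioA Λ v w * ratioN Λ v w)

/-- Both Riccati equations express λ: 1/Λy + v + w y = Λx + v + w/x. Clearing denominators gives w
Λy (1 - x y) = x (1 - Λx Λy), the Casoratian relation of the two solutions. -/
theorem C_mul_greenDiag :
    PowerSeries.C w * greenDiag Λ v w = ratioB Λ v w * ratioN Λ v w := by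
  have hA := ratioA_eq Λ v w
  have hB := ratioB_eq Λ v w
  have hN := ratioN_mul Λ v w
  have hN' := congrArg (shiftSeries Λ 1) hN
  rw [greenDiag]
  simp only [map_mul, map_sub, map_one] at hN' ⊢
  set y := ratioA Λ v w
  set x := ratioB Λ v w
  set N := ratioN Λ v w
  set y' := shiftSeries Λ 1 y
  set x' := shiftSeries Λ 1 x
  set N' := shiftSeries Λ 1 N
  have key : PowerSeries.C w * y' * (1 - x * y) = x * (1 - x' * y') := by
    apply PowerSeries.X_mul_cancel
    linear_combination x * hA - y' * hB
  linear_combination (-PowerSeries.C w * y' * N') * hN + x * N * hN' + N * N' * key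

theorem greenDiag_eq : greenDiag Λ v w = PowerSeries.X * (1 + (shiftSeries Λ 1 (ratioB Λ v w) +
    PowerSeries.C v + PowerSeries.C w * ratioA Λ v w) * greenDiag Λ v w) := by
  have hA := ratioA_eq Λ v w
  have hN' := congrArg (shiftSeries Λ 1) (ratioN_mul Λ v w)
  rw [greenDiag]
  simp only [map_mul, map_sub, map_one] at hN' ⊢
  set y := ratioA Λ v w
  set x := ratioB Λ v w
  set N := ratioN Λ v w
  set y' := shiftSeries Λ 1 y
  set x' := shiftSeries Λ 1 x
  set N' := shiftSeries Λ 1 N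
  linear_combination N' * hA + PowerSeries.X * hN'

/-- The series `∑ Coef(L^k, m) λ^{-k-1}` for `m ≥ 0`. -/
def greenUpper : ℕ → PowerSeries A
  | 0 => greenDiag Λ v w
  | m + 1 => shiftSeries Λ 1 (ratioA Λ v w) * shiftSeries Λ 1 (greenUpper m)

/-- The series `∑ Coef(L^k, -m) λ^{-k-1}` for `m ≥ 0`. -/
def greenLower : ℕ → PowerSeries A
  | 0 => greenDiag Λ v w
  | m + 1 => ratioB Λ v w * shiftSeries Λ (-1) (greenLower m)

/-- The series `∑ Coef(L^k, m) λ^{-k-1}`. -/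
def green : ℤ → PowerSeries A
  | .ofNat m => greenUpper Λ v w m
  | .negSucc m => greenLower Λ v w (m + 1)

theorem shiftSeries_neg_one_greenUpper (m : ℕ) :
    shiftSeries Λ (-1) (greenUpper Λ v w (m + 1)) = ratioA Λ v w * greenUpper Λ v w m := by
  rw [greenUpper, map_mul, shiftSeries_shiftSeries, shiftSeries_shiftSeries, neg_add_cancel,
    shiftSeries_zero, shiftSeries_zero]

theorem shiftSeries_one_greenLower (m : ℕ) :
    shiftSeries Λ 1 (greenLower Λ v w (m + 1)) =
      shiftSeries Λ 1 (ratioB Λ v w) * greenLower Λ v w m := by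
  rw [greenLower, map_mul, shiftSeries_shiftSeries, add_neg_cancel, shiftSeries_zero]

/-- The resolvent equation `λ G = 1 + L G`. -/
theorem green_eq (m : ℤ) : green Λ v w m = PowerSeries.X * ((if m = 0 then 1 else 0) +
    shiftSeries Λ 1 (green Λ v w (m - 1)) + PowerSeries.C v * green Λ v w m +
    PowerSeries.C w * shiftSeries Λ (-1) (green Λ v w (m + 1))) := by
  obtain (m | m) | m := m
  -- As a function of n the kernel is proportional to ψ_A on one side of the diagonal and to ψ_B on
  -- the other, so off the diagonal the equation is the Riccati equation of y or of x. Only the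
  -- diagonal sees the inhomogeneous term.
  · have h1 : (Int.ofNat 0 - 1 : ℤ) = Int.negSucc 0 := rfl
    have h2 : (Int.ofNat 0 + 1 : ℤ) = Int.ofNat 1 := rfl
    rw [h1, h2]
    simp only [green]
    rw [shiftSeries_neg_one_greenUpper, shiftSeries_one_greenLower, greenUpper, greenLower,
      if_pos (show Int.ofNat 0 = 0 from rfl)]
    linear_combination greenDiag_eq Λ v w
  · have h1 : (Int.ofNat (m + 1) - 1 : ℤ) = Int.ofNat m := by simp
    have h2 : (Int.ofNat (m + 1) + 1 : ℤ) = Int.ofNat (m + 1 + 1) := rfl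
    rw [h1, h2]
    simp only [green]
    rw [shiftSeries_neg_one_greenUpper, if_neg (show Int.ofNat (m + 1) ≠ 0 by simp; omega), greenUpper]
    linear_combination shiftSeries Λ 1 (greenUpper Λ v w m) * ratioA_eq Λ v w
  · have h1 : (Int.negSucc m - 1 : ℤ) = Int.negSucc (m + 1) := rfl
    have h2 : green Λ v w (Int.negSucc m + 1 : ℤ) = greenLower Λ v w m := by
      cases m <;> rfl
    rw [h1, h2, if_neg (by simp)]
    simp only [green]
    rw [shiftSeries_one_greenLower, greenLower]
    linear_combination shiftSeries Λ (-1) (greenLower Λ v w m) * ratioB_eq Λ v w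

/-- Here Λ⁻¹G_1 = y G_0 and w G_0 = x N, while x y N = N - 1. This makes N - 1 the generating series
from which D_k v_0 is read. -/
theorem C_mul_shiftSeries_green_one :
    PowerSeries.C w * shiftSeries Λ (-1) (green Λ v w 1) = ratioN Λ v w - 1 := by
  have h : shiftSeries Λ (-1) (green Λ v w 1) = ratioA Λ v w * greenDiag Λ v w :=
    shiftSeries_neg_one_greenUpper Λ v w 0
  rw [h]
  linear_combination ratioA Λ v w * C_mul_greenDiag Λ v w - ratioN_mul Λ v w

theorem constantCoeff_greenDiag : PowerSeries.constantCoeff (greenDiag Λ v w) = 0 := by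
  rw [greenDiag_eq]; simp

theorem coeff_one_greenDiag : PowerSeries.coeff 1 (greenDiag Λ v w) = 1 := by
  rw [greenDiag_eq, show (1 : ℕ) = 0 + 1 from rfl, PowerSeries.coeff_succ_X_mul]
  simp [constantCoeff_greenDiag]

/-! Naturality in the ring. -/

variable {B : Type*} [CommRing B] {Λ} {M : RingAut B} (φ : A →+* B)

theorem map_zpow_ringAut (hφ : ∀ a, φ (Λ a) = M (φ a)) (m : ℤ) (a : A) : φ ((Λ ^ m) a) = (M ^ m) (φ a) := by
  have hinv : ∀ a, φ (Λ⁻¹ a) = M⁻¹ (φ a) := by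
    intro a
    apply M.injective
    rw [← hφ, ← RingAut.mul_apply, ← RingAut.mul_apply, mul_inv_cancel, mul_inv_cancel]
    rfl
  induction m with
  | zero => simp
  | succ m ih =>
    rw [add_comm, zpow_add, zpow_add, zpow_one, zpow_one, RingAut.mul_apply, RingAut.mul_apply,
      hφ, ih]
  | pred m ih =>
    rw [sub_eq_add_neg, add_comm, zpow_add, zpow_add, zpow_neg_one, zpow_neg_one,
      RingAut.mul_apply, RingAut.mul_apply, hinv, ih]

theorem map_shiftSeries (hφ : ∀ a, φ (Λ a) = M (φ a)) (m : ℤ) (a : PowerSeries A) :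
    PowerSeries.map φ (shiftSeries Λ m a) = shiftSeries M m (PowerSeries.map φ a) := by
  ext k
  simp only [PowerSeries.coeff_map, coeff_shiftSeries]
  exact map_zpow_ringAut φ hφ m _

/-- By uniqueness of the Riccati solution, y commutes with every ring homomorphism that intertwines
the shifts. This serves both for setting v = w = 0 and for inserting the initial data. -/
theorem map_ratioA (hφ : ∀ a, φ (Λ a) = M (φ a)) : PowerSeries.map φ (ratioA Λ v w) = ratioA M (φ v) (φ w) := by
  apply ratioA_unique
  rw [← map_shiftSeries φ hφ]
  have := congrArg (PowerSeries.map φ) (ratioA_eq Λ v w)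
  simpa using this

theorem map_ratioB (hφ : ∀ a, φ (Λ a) = M (φ a)) : PowerSeries.map φ (ratioB Λ v w) = ratioB M (φ v) (φ w) := by
  apply ratioB_unique
  rw [← map_shiftSeries φ hφ]
  have := congrArg (PowerSeries.map φ) (ratioB_eq Λ v w)
  simpa using this

theorem map_ratioN (hφ : ∀ a, φ (Λ a) = M (φ a)) : PowerSeries.map φ (ratioN Λ v w) = ratioN M (φ v) (φ w) := by
  have h1 := congrArg (PowerSeries.map φ) (ratioN_mul Λ v w)
  rw [map_mul, map_sub, map_mul, map_one, map_ratioA v w φ hφ, map_ratioB v w φ hφ] at h1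
  have h2 := ratioN_mul M (φ v) (φ w)
  set c := 1 - ratioB M (φ v) (φ w) * ratioA M (φ v) (φ w)
  linear_combination ratioN M (φ v) (φ w) * h1 - PowerSeries.map φ (ratioN Λ v w) * h2

end Riccati

/-! ### Shifts of difference polynomials -/

theorem shiftPoly_shiftPoly (m n : ℤ) (a : DiffPoly) :
    shiftPoly m (shiftPoly n a) = shiftPoly (m + n) a := by
  rw [shiftPoly, shiftPoly, shiftPoly, MvPolynomial.rename_rename]
  congr 2
  funext i
  rcases i with i | i <;> simp [add_left_comm, add_comm]

@[simp] theorem shiftPoly_zero (a : DiffPoly) : shiftPoly 0 a = a := by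
  have : (Sum.map (fun i : ℤ => i + 0) (fun i : ℤ => i + 0)) = id := by
    funext i; rcases i with i | i <;> simp
  rw [shiftPoly, this, MvPolynomial.rename_id_apply]

@[simp] theorem shiftPoly_vGen (m i : ℤ) : shiftPoly m (vGen i) = vGen (i + m) := by
  simp [shiftPoly, vGen]

@[simp] theorem shiftPoly_wGen (m i : ℤ) : shiftPoly m (wGen i) = wGen (i + m) := by
  simp [shiftPoly, wGen]

/-- The shift of difference polynomials as an automorphism. -/
def shiftAut : RingAut DiffPoly where
  toFun := shiftPoly 1
  invFun := shiftPoly (-1)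
  left_inv a := by rw [shiftPoly_shiftPoly]; simp
  right_inv a := by rw [shiftPoly_shiftPoly]; simp
  map_mul' := map_mul _
  map_add' := map_add _

theorem shiftAut_apply (a : DiffPoly) : shiftAut a = shiftPoly 1 a := rfl

theorem shiftAut_inv_apply (a : DiffPoly) : shiftAut⁻¹ a = shiftPoly (-1) a := rfl

theorem shiftAut_zpow (m : ℤ) (a : DiffPoly) : (shiftAut ^ m) a = shiftPoly m a := by
  induction m with
  | zero => simp
  | succ m ih =>
    rw [add_comm, zpow_add, zpow_one, RingAut.mul_apply, ih, shiftAut_apply, shiftPoly_shiftPoly]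
  | pred m ih =>
    rw [sub_eq_add_neg, add_comm, zpow_add, zpow_neg_one, RingAut.mul_apply, ih,
      shiftAut_inv_apply, shiftPoly_shiftPoly]

theorem constantCoeff_shiftPoly (m : ℤ) (a : DiffPoly) :
    MvPolynomial.constantCoeff (shiftPoly m a) = MvPolynomial.constantCoeff a := by
  rw [shiftPoly, MvPolynomial.constantCoeff_rename]

/-- A shift-invariant difference polynomial is constant. -/
theorem eq_C_of_shiftPoly_eq {a : DiffPoly} (h : shiftPoly 1 a = a) :
    a = MvPolynomial.C (MvPolynomial.constantCoeff a) := by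
  classical
  have hn : ∀ n : ℕ, shiftPoly n a = a := by
    intro n
    induction n with
    | zero => simp
    | succ n ih => rw [Nat.cast_succ, ← shiftPoly_shiftPoly, h, ih]
  have hvars : a.vars = ∅ := by
    by_contra hne
    obtain ⟨s, hs⟩ := Finset.nonempty_iff_ne_empty.mpr hne
    let ι : ℤ ⊕ ℤ → ℤ := Sum.elim id id
    obtain ⟨t, ht, hmin⟩ := a.vars.exists_min_image ι ⟨s, hs⟩
    obtain ⟨u, hu, hmax⟩ := a.vars.exists_max_image ι ⟨s, hs⟩
    have htu := hmin u hu
    set n := (ι u - ι t + 1).toNat with hndef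
    have hsub := MvPolynomial.vars_rename
      (Sum.map (fun i : ℤ => i + (n : ℤ)) (fun i : ℤ => i + (n : ℤ))) a
    have hrw : MvPolynomial.rename
      (Sum.map (fun i : ℤ => i + (n : ℤ)) (fun i : ℤ => i + (n : ℤ))) a = a := hn n
    rw [hrw] at hsub
    -- Invariance under the shift by n writes the least index occurring in `a` as n plus another
    -- occurring index, which is impossible for n ≥ 1.
    obtain ⟨z, hz, hzt⟩ := Finset.mem_image.mp (hsub ht)
    have h1 := hmin z hz
    have h2 : ι t = ι z + n := by
      rw [← hzt]
      rcases z with z | z <;> rfl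
    have hnn : (n : ℤ) = ι u - ι t + 1 := by
      rw [hndef]; exact Int.toNat_of_nonneg (by omega)
    omega
  obtain ⟨c, rfl⟩ : ∃ c, a = MvPolynomial.C c := by
    exact ⟨_, MvPolynomial.vars_eq_empty_iff_eq_C.mp hvars⟩
  simp

/-! ### Coefficients of difference operators -/

theorem DiffOp.comp_apply (P Q : DiffOp) (m : ℤ) :
    DiffOp.comp P Q m = P.sum fun i a => a * shiftPoly i (Q (m - i)) := by
  classical
  rw [DiffOp.comp, Finsupp.sum_apply]
  refine Finsupp.sum_congr fun i _ => ?_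
  rw [Finsupp.sum_apply, Finsupp.sum, Finset.sum_eq_single (m - i)]
  · simp
  · intro j _ hj
    rw [Finsupp.single_apply, if_neg]
    omega
  · intro h
    rw [Finsupp.notMem_support_iff.mp h]
    simp

theorem DiffOp.lax_comp_apply (P : DiffOp) (m : ℤ) :
    DiffOp.comp lax P m = shiftPoly 1 (P (m - 1)) + vGen 0 * P m +
      wGen 0 * shiftPoly (-1) (P (m + 1)) := by
  rw [DiffOp.comp_apply, lax, Finsupp.sum_add_index', Finsupp.sum_add_index',
    Finsupp.sum_single_index, Finsupp.sum_single_index, Finsupp.sum_single_index]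
  all_goals simp [add_mul]

theorem DiffOp.comp_lax_apply (P : DiffOp) (m : ℤ) :
    DiffOp.comp P lax m = P (m - 1) + P m * vGen m + P (m + 1) * wGen (m + 1) := by
  classical
  have key : ∀ (j : ℤ) (b : DiffPoly),
      (P.sum fun i a => a * shiftPoly i (Finsupp.single j b (m - i))) =
        P (m - j) * shiftPoly (m - j) b := by
    intro j b
    rw [Finsupp.sum, Finset.sum_eq_single (m - j)]
    · simp
    · intro i _ hi
      rw [Finsupp.single_apply, if_neg, map_zero, mul_zero]
      omega
    · intro h
      rw [Finsupp.notMem_support_iff.mp h, zero_mul]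
  rw [DiffOp.comp_apply]
  simp only [lax, Finsupp.add_apply, map_add, mul_add, Finsupp.sum_add]
  rw [key, key, key]
  simp

/-- The coefficients of `(λ - L)⁻¹` are those of the powers of `L`. -/
theorem coeff_green (k : ℕ) (m : ℤ) :
    PowerSeries.coeff (k + 1) (green shiftAut (vGen 0) (wGen 0) m) = DiffOp.pow lax k m := by
  induction k generalizing m with
  | zero =>
    have h0 : ∀ m, PowerSeries.coeff 0 (green shiftAut (vGen 0) (wGen 0) m) = 0 := by
      intro m; rw [green_eq]; simp
    rw [green_eq, PowerSeries.coeff_succ_X_mul]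
    simp only [map_add, coeff_shiftSeries, PowerSeries.coeff_C_mul, h0]
    simp only [DiffOp.pow, Finsupp.single_apply, map_zero, mul_zero, add_zero]
    by_cases hm : m = 0
    · simp [hm]
    · simp [hm, Ne.symm hm]
  | succ k ih =>
    rw [green_eq, PowerSeries.coeff_succ_X_mul]
    simp only [map_add, coeff_shiftSeries, PowerSeries.coeff_C_mul, ih]
    rw [DiffOp.pow, DiffOp.lax_comp_apply, shiftAut_zpow, shiftAut_zpow]
    have : PowerSeries.coeff (k + 1) (if m = 0 then (1 : PowerSeries DiffPoly) else 0) = 0 := by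
      split_ifs
      · rw [PowerSeries.coeff_one, if_neg (by omega)]
      · simp
    rw [this, zero_add]

theorem laxPlus_of_nonneg (k : ℕ) {m : ℤ} (hm : 0 ≤ m) :
    laxPlus k m = DiffOp.pow lax (k + 1) m := by
  rw [laxPlus, DiffOp.plus, Finsupp.filter_apply_pos _ _ hm]

theorem laxPlus_of_neg (k : ℕ) {m : ℤ} (hm : m < 0) : laxPlus k m = 0 := by
  rw [laxPlus, DiffOp.plus, Finsupp.filter_apply_neg _ _ (by omega)]

/-! ### The derivations -/

theorem todaD_shiftPoly (k : ℕ) (m : ℤ) (a : DiffPoly) :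
    todaD k (shiftPoly m a) = shiftPoly m (todaD k a) := by
  induction a using MvPolynomial.induction_on with
  | C c => simp [shiftPoly]
  | add a b ha hb => simp [ha, hb]
  | mul_X a i ha =>
    have hX : todaD k (shiftPoly m (MvPolynomial.X i)) =
        shiftPoly m (todaD k (MvPolynomial.X i)) := by
      rcases i with i | i
      · rw [show shiftPoly m (MvPolynomial.X (Sum.inl i)) = MvPolynomial.X (Sum.inl (i + m)) by
          simp [shiftPoly]]
        simp [todaD, MvPolynomial.mkDerivation_X, shiftPoly_shiftPoly, add_comm]
      · rw [show shiftPoly m (MvPolynomial.X (Sum.inr i)) = MvPolynomial.X (Sum.inr (i + m)) by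
          simp [shiftPoly]]
        simp [todaD, MvPolynomial.mkDerivation_X, shiftPoly_shiftPoly, add_comm]
    rw [map_mul, Derivation.leibniz, Derivation.leibniz, ha, hX]
    simp

/-- In the coefficient 0 of [A_k, L] the terms with negative powers of A_k are absent and those with
A_k(0) cancel, leaving (Λ - 1)(w_0 Λ⁻¹ Coef(L^{k+1}, 1)). The exponent k + 2 arises because
Coef(L^j, m) sits at λ^{-j-1}. -/
theorem todaD_vGen (k : ℕ) : todaD k (vGen 0) =
    PowerSeries.coeff (k + 2) (shiftSeries shiftAut 1 (ratioN shiftAut (vGen 0) (wGen 0)) -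
      ratioN shiftAut (vGen 0) (wGen 0)) := by
  have hN : PowerSeries.coeff (k + 2) (ratioN shiftAut (vGen 0) (wGen 0)) =
      wGen 0 * shiftPoly (-1) (DiffOp.pow lax (k + 1) 1) := by
    have h := congrArg (PowerSeries.coeff (k + 2))
      (C_mul_shiftSeries_green_one shiftAut (vGen 0) (wGen 0))
    rw [PowerSeries.coeff_C_mul, coeff_shiftSeries, coeff_green, shiftAut_zpow, map_sub,
      PowerSeries.coeff_one, if_neg (by omega), sub_zero] at h
    exact h.symm
  rw [map_sub, coeff_shiftSeries, hN, shiftAut_zpow, map_mul, shiftPoly_shiftPoly]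
  simp only [todaD, vGen, MvPolynomial.mkDerivation_X, Sum.elim_inl]
  rw [shiftPoly_zero, DiffOp.commutator, Finsupp.sub_apply, DiffOp.comp_lax_apply,
    DiffOp.lax_comp_apply]
  simp [laxPlus_of_nonneg, laxPlus_of_neg]
  ring

theorem coeff_greenDiag (k : ℕ) :
    PowerSeries.coeff (k + 1) (greenDiag shiftAut (vGen 0) (wGen 0)) = DiffOp.pow lax k 0 :=
  coeff_green k 0

theorem todaD_wGen (k : ℕ) : todaD k (wGen 0) =
    wGen 0 * (DiffOp.pow lax (k + 1) 0 - shiftPoly (-1) (DiffOp.pow lax (k + 1) 0)) := by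
  simp only [todaD, wGen, MvPolynomial.mkDerivation_X, Sum.elim_inr]
  rw [shiftPoly_zero, DiffOp.commutator, Finsupp.sub_apply, DiffOp.comp_lax_apply,
    DiffOp.lax_comp_apply]
  simp [laxPlus_of_nonneg, laxPlus_of_neg]
  simp only [wGen]
  ring

/-- Since w G = x N and Λ⁻¹G = y N, the series N (x - w y) equals w (1 - Λ⁻¹) G. -/
theorem todaD_wGen_eq_coeff (k : ℕ) : todaD k (wGen 0) =
    PowerSeries.coeff (k + 2) (ratioN shiftAut (vGen 0) (wGen 0) *
      (ratioB shiftAut (vGen 0) (wGen 0) -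
        PowerSeries.C (wGen 0) * ratioA shiftAut (vGen 0) (wGen 0))) := by
  have h1 := C_mul_greenDiag shiftAut (vGen 0) (wGen 0)
  have h2 : shiftSeries shiftAut (-1) (greenDiag shiftAut (vGen 0) (wGen 0)) =
      ratioA shiftAut (vGen 0) (wGen 0) * ratioN shiftAut (vGen 0) (wGen 0) := by
    rw [greenDiag, shiftSeries_shiftSeries, neg_add_cancel, shiftSeries_zero]
  have h3 : ratioN shiftAut (vGen 0) (wGen 0) * (ratioB shiftAut (vGen 0) (wGen 0) -
      PowerSeries.C (wGen 0) * ratioA shiftAut (vGen 0) (wGen 0)) =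
      PowerSeries.C (wGen 0) * (greenDiag shiftAut (vGen 0) (wGen 0) -
        shiftSeries shiftAut (-1) (greenDiag shiftAut (vGen 0) (wGen 0))) := by
    rw [h2]
    linear_combination -h1
  rw [h3, PowerSeries.coeff_C_mul, map_sub, coeff_shiftSeries, coeff_greenDiag, shiftAut_zpow,
    todaD_wGen]

/-! ### The canonical tau-structure -/

theorem constantCoeff_ratioA :
    PowerSeries.map MvPolynomial.constantCoeff (ratioA shiftAut (vGen 0) (wGen 0)) =
      PowerSeries.X := by
  rw [map_ratioA (M := 1) _ _ _ (fun a => constantCoeff_shiftPoly 1 a)]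
  symm
  apply ratioA_unique
  simp [vGen, wGen]

/-- At v = w = 0 the shift acts trivially on constants, so the Riccati equation is taken with the
identity automorphism, where it is solved by zero. -/
theorem constantCoeff_ratioB :
    PowerSeries.map MvPolynomial.constantCoeff (ratioB shiftAut (vGen 0) (wGen 0)) = 0 := by
  rw [map_ratioB (M := 1) _ _ _ (fun a => constantCoeff_shiftPoly 1 a)]
  symm
  apply ratioB_unique
  simp [vGen, wGen]

theorem constantCoeff_ratioN :
    PowerSeries.map MvPolynomial.constantCoeff (ratioN shiftAut (vGen 0) (wGen 0)) = 1 := by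
  have h := congrArg (PowerSeries.map MvPolynomial.constantCoeff)
    (ratioN_mul shiftAut (vGen 0) (wGen 0))
  rw [map_mul, map_sub, map_mul, constantCoeff_ratioB] at h
  simpa using h

theorem constantCoeff_pow_lax (k : ℕ) :
    MvPolynomial.constantCoeff (DiffOp.pow lax (k + 1) 0) = 0 := by
  rw [← coeff_greenDiag, ← PowerSeries.coeff_map, greenDiag,
    map_shiftSeries (M := 1) _ (fun a => constantCoeff_shiftPoly 1 a), map_mul,
    constantCoeff_ratioA, constantCoeff_ratioN, mul_one, shiftSeries_X, PowerSeries.coeff_X,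
    if_neg (by omega)]

theorem wGen_ne_zero (i : ℤ) : wGen i ≠ 0 := MvPolynomial.X_ne_zero _

/-- Cancelling w_0 in the equation for D_p w_0 determines S_p up to a shift-invariant element, that
is a constant, and the vanishing at v = w = 0 fixes it. -/
theorem IsCanonicalTauStructure.S_eq {Ω : ℕ → ℕ → DiffPoly} {S : ℕ → DiffPoly}
    (h : IsCanonicalTauStructure Ω S) (p : ℕ) : S p = DiffOp.pow lax (p + 1) 0 := by
  have h1 := h.w_mul_sub p
  rw [todaD_wGen] at h1
  have h2 := mul_left_cancel₀ (wGen_ne_zero 0) h1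
  have h3 : shiftPoly 1 (S p - DiffOp.pow lax (p + 1) 0) = S p - DiffOp.pow lax (p + 1) 0 := by
    have := congrArg (shiftPoly 1) h2
    simp only [map_sub, shiftPoly_shiftPoly] at this ⊢
    simp only [add_neg_cancel, shiftPoly_zero] at this
    linear_combination this
  have h4 := eq_C_of_shiftPoly_eq h3
  rw [map_sub, h.S_zero, constantCoeff_pow_lax, sub_zero, MvPolynomial.C_0] at h4
  exact sub_eq_zero.mp h4

/-! ### Rational identities behind the evolution of the ratios -/

section FieldIdentities

variable {K : Type*} [Field K]

/-- These relations eliminate λ and the shifted quantities Λx and ΛN, leaving free variables in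
which the evolution identities can be checked by clearing denominators. -/
theorem ratio_shift_relations {X v w x y x1 y1 N N1 : K} (hX : X ≠ 0) (hx : x ≠ 0)
    (hw : w ≠ 0)
    (hy1 : y1 ≠ 0)
    (hA : y1 = X * (1 + (v + w * y) * y1)) (hB : x = X * (w + (v + x1) * x))
    (hN : N * (1 - x * y) = 1) (hN1 : N1 * (1 - x1 * y1) = 1) :
    X⁻¹ = 1 / y1 + v + w * y ∧ x1 = 1 / y1 + w * y - w / x ∧ N1 = x * N / (w * y1) := by
  have h1 : X⁻¹ = 1 / y1 + v + w * y := by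
    field_simp
    linear_combination hA
  have h2 : x1 = 1 / y1 + w * y - w / x := by
    have : X⁻¹ = w / x + v + x1 := by
      field_simp
      linear_combination hB
    linear_combination h1 - this
  refine ⟨h1, h2, ?_⟩
  have h3 : 1 - x1 * y1 = w * y1 / x * (1 - x * y) := by
    rw [h2]; field_simp; ring
  rw [h3] at hN1
  rw [eq_div_iff (by positivity)]
  have : N1 * (w * y1) * (1 - x * y) = x := by
    field_simp at hN1
    linear_combination hN1
  linear_combination N * this - N1 * w * y1 * hN

/-- This says that the proposed value of (X - Z) ∇y solves the equation obtained by differentiating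
the Riccati equation of y; N1 - N and N (x - w Y) stand for ∇v and ∇w. Lower-case y belongs to X,
while Y, x and N belong to Z. Writing X - Z as X Z (1/Y1 - 1/y1 + w (Y - y)) removes the last
dependence between the variables. -/
theorem ratioA_evolution_identity {X Z v w y y1 Y Y1 x x1 N N1 : K} (hX : X ≠ 0) (hZ : Z ≠ 0) (hx : x ≠ 0)
    (hw : w ≠ 0)
    (hy1 : y1 ≠ 0) (hY1 : Y1 ≠ 0)
    (hA : y1 = X * (1 + (v + w * y) * y1)) (hA' : Y1 = Z * (1 + (v + w * Y) * Y1))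
    (hB : x = Z * (w + (v + x1) * x))
    (hN : N * (1 - x * Y) = 1) (hN1 : N1 * (1 - x1 * Y1) = 1) :
    N1 * (X * Z * (Y1 - y1) * (1 - x1 * y1) + (X - Z) * (Y1 * y1)) = 
      X * (((X - Z) * (N1 - N) + (X - Z) * (N * (x - w * Y)) * y + w * 
       (N * (X * Z * (Y - y) * (1 - x * y) + (X - Z) * (Y * y)))) * y1 + (v + w * y) * 
       (N1 * (X * Z * (Y1 - y1) * (1 - x1 * y1) + (X - Z) * (Y1 * y1)))) := by
  obtain ⟨h1, h2, h3⟩ := ratio_shift_relations hZ hx hw hY1 hA' hB hN hN1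
  have h4 : X⁻¹ = 1 / y1 + v + w * y := by
    field_simp
    linear_combination hA
  have hXZ : X - Z = X * Z * (1 / Y1 - 1 / y1 + w * (Y - y)) := by
    have : X - Z = X * Z * (Z⁻¹ - X⁻¹) := by field_simp
    rw [this, h1, h4]; ring
  have hv : v = X⁻¹ - 1 / y1 - w * y := by linear_combination -h4
  have hq : 1 - x * Y ≠ 0 := right_ne_zero_of_mul_eq_one hN
  have hN' : N = 1 / (1 - x * Y) := by field_simp; exact hN
  rw [hXZ, hv, h2, h3, hN']
  field_simp
  ring

theorem ratioB_evolution_identity {X Z v w xi xi1 Y Y1 x x1 N N1 : K} (hX : X ≠ 0) (hZ : Z ≠ 0) (hx : x ≠ 0)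
    (hw : w ≠ 0)
    (hxi : xi ≠ 0) (hY1 : Y1 ≠ 0)
    (hB' : xi = X * (w + (v + xi1) * xi)) (hA' : Y1 = Z * (1 + (v + w * Y) * Y1))
    (hB : x = Z * (w + (v + x1) * x))
    (hN : N * (1 - x * Y) = 1) (hN1 : N1 * (1 - x1 * Y1) = 1) :
    N * (X * Z * (xi - x) * (1 - xi * Y) - (X - Z) * (Y * xi)) = 
      X * ((X - Z) * (N * (x - w * Y)) + ((X - Z) * (N1 - N) + 
        N1 * (X * Z * (xi1 - x1) * (1 - xi1 * Y1) - (X - Z) * (Y1 * xi1))) * xi + (v + xi1) * 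
       (N * (X * Z * (xi - x) * (1 - xi * Y) - (X - Z) * (Y * xi)))) := by
  obtain ⟨h1, h2, h3⟩ := ratio_shift_relations hZ hx hw hY1 hA' hB hN hN1
  have h4 : X⁻¹ = w / xi + v + xi1 := by
    field_simp
    linear_combination hB'
  have hXZ : X - Z = X * Z * (1 / Y1 + w * Y - w / xi - xi1) := by
    have : X - Z = X * Z * (Z⁻¹ - X⁻¹) := by field_simp
    rw [this, h1, h4]; ring
  have hv : v = X⁻¹ - w / xi - xi1 := by linear_combination -h4
  have hq : 1 - x * Y ≠ 0 := right_ne_zero_of_mul_eq_one hN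
  have hN' : N = 1 / (1 - x * Y) := by field_simp; exact hN
  rw [hXZ, hv, h2, h3, hN']
  field_simp
  ring

/-- The derivative of w G = ξ M is solved for ∇G, and the formulas for ∇ξ and ∇y are inserted. The
result has the form (Λ - 1) of a product symmetric in the two spectral parameters, which is what
integrates to Ω. -/
theorem greenDiag_evolution_identity {X Z v w y y1 xi xi1 M M1 Y Y1 x x1 N N1 : K} (hX : X ≠ 0) (hZ : Z ≠ 0) (hx : x ≠ 0)
    (hw : w ≠ 0)
    (hxi : xi ≠ 0) (hY1 : Y1 ≠ 0) (hy1 : y1 ≠ 0)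
    (hA : y1 = X * (1 + (v + w * y) * y1)) (hB' : xi = X * (w + (v + xi1) * xi))
    (hM : M * (1 - xi * y) = 1) (hM1 : M1 * (1 - xi1 * y1) = 1)
    (hA' : Y1 = Z * (1 + (v + w * Y) * Y1))
    (hB : x = Z * (w + (v + x1) * x))
    (hN : N * (1 - x * Y) = 1) (hN1 : N1 * (1 - x1 * Y1) = 1) {G Gd Md xid yd : K}
    (hG : w * G = xi * M) (hGd : N * (x - w * Y) * G + w * Gd = xid * M + xi * Md)
    (hMd : Md = M ^ 2 * (xid * y + xi * yd)) 
    (hyd : (X - Z) * yd = N * (X * Z * (Y - y) * (1 - x * y) + (X - Z) * (Y * y)))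
    (hxid : (X - Z) * xid = N * (X * Z * (xi - x) * (1 - xi * Y) - (X - Z) * (Y * xi))) :
    (X - Z) ^ 2 * Gd = (X * Z) ^ 2 * (M1 * N1 * (1 - y1 * x1) * (1 - Y1 * xi1) - 
      M * N * (1 - y * x) * (1 - Y * xi)) := by
  obtain ⟨h1, h2, h3⟩ := ratio_shift_relations hZ hx hw hY1 hA' hB hN hN1
  obtain ⟨k1, k2, k3⟩ := ratio_shift_relations hX hxi hw hy1 hA hB' hM hM1
  have hXZ : X - Z = X * Z * (1 / Y1 - 1 / y1 + w * (Y - y)) := by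
    have : X - Z = X * Z * (Z⁻¹ - X⁻¹) := by field_simp
    rw [this, h1, k1]; ring
  have e : (X - Z) ^ 2 * Gd = (X - Z) * (M * (N * (X * Z * (xi - x) * (1 - xi * Y) - (X - Z) * (Y * xi)))
     + xi * M ^ 2 * (N * (X * Z * (xi - x) * (1 - xi * Y) - (X - Z) * (Y * xi)) * y + 
     xi * (N * (X * Z * (Y - y) * (1 - x * y) + (X - Z) * (Y * y)))) - (X - Z) * N * (x - w * Y) *
       (xi * M / w)) / w := by
    have hG' : G = xi * M / w := by field_simp; linear_combination hG
    rw [← hyd, ← hxid, ← hG']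
    field_simp
    linear_combination (X - Z) ^ 2 * hGd + (X - Z) ^ 2 * xi * hMd
  have hM0 : M ≠ 0 := left_ne_zero_of_mul_eq_one hM
  have hN0 : N ≠ 0 := left_ne_zero_of_mul_eq_one hN
  have hy : y = (M - 1) / (M * xi) := by field_simp; linear_combination -hM
  have hY : Y = (N - 1) / (N * x) := by field_simp; linear_combination -hN
  rw [e, hXZ, h2, h3, k2, k3, hy, hY]
  field_simp
  ring
end FieldIdentities

/-! ### The generating derivation -/

section GenDer

variable {σ : Type*} {A : Type*} [CommRing A]

/-- A derivation acting on the coefficients of power series. -/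
def coeffDer (d : Derivation ℤ A A) : MvPowerSeries σ A →+ MvPowerSeries σ A where
  toFun F := fun e => d (MvPowerSeries.coeff e F)
  map_zero' := by
    ext e
    change d (MvPowerSeries.coeff e 0) = 0
    simp
  map_add' F G := by
    ext e
    change d (MvPowerSeries.coeff e (F + G)) = d (MvPowerSeries.coeff e F) +
      d (MvPowerSeries.coeff e G)
    simp

@[simp] theorem coeff_coeffDer (d : Derivation ℤ A A) (F : MvPowerSeries σ A) (e : σ →₀ ℕ) :
    MvPowerSeries.coeff e (coeffDer d F) = d (MvPowerSeries.coeff e F) := rfl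

theorem coeffDer_mul (d : Derivation ℤ A A) (F G : MvPowerSeries σ A) :
    coeffDer d (F * G) = F * coeffDer d G + G * coeffDer d F := by
  classical
  rw [mul_comm G]
  ext e
  simp only [coeff_coeffDer, map_add, MvPowerSeries.coeff_mul, map_sum, Derivation.leibniz,
    ← Finset.sum_add_distrib, smul_eq_mul]
  refine Finset.sum_congr rfl fun p _ => ?_
  ring

variable (D : ℕ → Derivation ℤ A A)

/-- The truncation `∑_{k < K} X_m^{k+2} D_k`. -/
def truncDer (m : σ) (K : ℕ) : MvPowerSeries σ A →+ MvPowerSeries σ A :=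
  ∑ k ∈ Finset.range K, (AddMonoidHom.mulLeft (MvPowerSeries.X m ^ (k + 2))).comp (coeffDer (D k))

theorem truncDer_apply (m : σ) (K : ℕ) (F : MvPowerSeries σ A) :
    truncDer D m K F =
      ∑ k ∈ Finset.range K, MvPowerSeries.X m ^ (k + 2) * coeffDer (D k) F := by
  simp [truncDer, AddMonoidHom.finsetSum_apply]

theorem coeff_X_pow_mul_eq_ite [DecidableEq σ] (m : σ) (n : ℕ) (F : MvPowerSeries σ A)
    (e : σ →₀ ℕ) : MvPowerSeries.coeff e (MvPowerSeries.X m ^ n * F) =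
      if n ≤ e m then MvPowerSeries.coeff (e - Finsupp.single m n) F else 0 := by
  classical
  rw [MvPowerSeries.X_pow_eq, MvPowerSeries.coeff_monomial_mul]
  simp [Finsupp.single_le_iff]

theorem coeff_truncDer_eq (m : σ) {K L : ℕ} (F : MvPowerSeries σ A) {e : σ →₀ ℕ}
    (hK : e m ≤ K) (hKL : K ≤ L) :
    MvPowerSeries.coeff e (truncDer D m L F) = MvPowerSeries.coeff e (truncDer D m K F) := by
  classical
  simp only [truncDer_apply, map_sum]
  symm
  refine Finset.sum_subset (Finset.range_mono hKL) fun k _ hk => ?_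
  rw [coeff_X_pow_mul_eq_ite, if_neg]
  rw [Finset.mem_range] at hk
  omega

/-- The derivation `∇(λ_m) = ∑_k λ_m^{-k-2} D_k`. -/
def genDer (m : σ) : Derivation ℤ (MvPowerSeries σ A) (MvPowerSeries σ A) :=
  Derivation.mk'
    (AddMonoidHom.toIntLinearMap
      -- The infinite sum makes sense coefficientwise: `X_m ^ (k + 2)` reaches the exponent e only
      -- if k + 2 ≤ e m, so the truncation at `e m` already contains every contributing term.
      { toFun := fun F e => MvPowerSeries.coeff e (truncDer D m (e m) F)
        map_zero' := by
          ext e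
          change MvPowerSeries.coeff e (truncDer D m (e m) 0) = 0
          simp
        map_add' := fun F G => by
          ext e
          change MvPowerSeries.coeff e (truncDer D m (e m) (F + G)) =
            MvPowerSeries.coeff e (truncDer D m (e m) F) +
            MvPowerSeries.coeff e (truncDer D m (e m) G)
          simp })
    (by
      classical
      intro F G
      ext e
      change MvPowerSeries.coeff e (truncDer D m (e m) (F * G)) = _
      -- Each fixed truncation satisfies the Leibniz rule; in the product formula the exponents of
      -- the factors are at most e m, so their own shorter truncations give the same coefficients.
      have h : truncDer D m (e m) (F * G) =
          F * truncDer D m (e m) G + G * truncDer D m (e m) F := by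
        simp only [truncDer_apply, Finset.mul_sum, ← Finset.sum_add_distrib, coeffDer_mul]
        refine Finset.sum_congr rfl fun k _ => ?_
        ring
      rw [h]
      simp only [map_add, smul_eq_mul, MvPowerSeries.coeff_mul]
      congr 1 <;>
      · refine Finset.sum_congr rfl fun p hp => ?_
        have hle : p.2 m ≤ e m := by
          rw [← Finset.HasAntidiagonal.mem_antidiagonal.mp hp, Finsupp.add_apply]
          omega
        rw [coeff_truncDer_eq D m _ le_rfl hle]
        rfl)

theorem coeff_genDer (m : σ) (F : MvPowerSeries σ A) (e : σ →₀ ℕ) :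
    MvPowerSeries.coeff e (genDer D m F) = MvPowerSeries.coeff e (truncDer D m (e m) F) := rfl

theorem genDer_eq_zero {m : σ} {F : MvPowerSeries σ A}
    (h : ∀ k e, D k (MvPowerSeries.coeff e F) = 0) : genDer D m F = 0 := by
  ext e
  have : ∀ k, coeffDer (D k) F = 0 := by
    intro k; ext e; simp [h]
  rw [coeff_genDer, truncDer_apply]
  simp [this]

@[simp] theorem genDer_X (m i : σ) : genDer D m (MvPowerSeries.X i) = 0 := by
  classical
  apply genDer_eq_zero
  intro k e
  rw [MvPowerSeries.coeff_X]
  split_ifs <;> simp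

/-- The series does not involve the variable `X_m`. -/
def IsFreeOf (m : σ) (F : MvPowerSeries σ A) : Prop :=
  ∀ e : σ →₀ ℕ, e m ≠ 0 → MvPowerSeries.coeff e F = 0

/-- If X_m does not occur in F, its exponent in the result comes entirely from λ_m^{-k-2} and thus
picks out the single flow k = e m - 2. -/
theorem coeff_genDer_of_isFreeOf {m : σ} {F : MvPowerSeries σ A} (hF : IsFreeOf m F)
    (e : σ →₀ ℕ) : MvPowerSeries.coeff e (genDer D m F) =
      if 2 ≤ e m then D (e m - 2) (MvPowerSeries.coeff (e.erase m) F) else 0 := by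
  classical
  rw [coeff_genDer, truncDer_apply, map_sum]
  have hterm : ∀ k, MvPowerSeries.coeff e (MvPowerSeries.X m ^ (k + 2) * coeffDer (D k) F) =
      if k + 2 = e m then D k (MvPowerSeries.coeff (e.erase m) F) else 0 := by
    intro k
    rw [coeff_X_pow_mul_eq_ite]
    split_ifs with h1 h2 h2
    · rw [coeff_coeffDer]
      congr 2
      suffices e - Finsupp.single m (k + 2) = e.erase m by rw [this]
      ext i
      by_cases hi : i = m
      · subst hi; simp [h2]
      · simp [Finsupp.erase_ne hi, Finsupp.single_eq_of_ne hi]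
    · rw [coeff_coeffDer, hF, map_zero]
      simp only [Finsupp.coe_tsub, Pi.sub_apply, Finsupp.single_eq_same]
      omega
    · omega
    · rfl
  simp only [hterm]
  split_ifs with h
  · rw [Finset.sum_eq_single (e m - 2)]
    · rw [if_pos (by omega)]
    · intro k _ hk
      rw [if_neg (by omega)]
    · intro hk
      rw [Finset.mem_range] at hk
      omega
  · refine Finset.sum_eq_zero fun k _ => ?_
    rw [if_neg (by omega)]

theorem map_genDer {B : Type*} [CommRing B] {D' : ℕ → Derivation ℤ B B} (φ : A →+* B)
    (hφ : ∀ k a, φ (D k a) = D' k (φ a)) (m : σ) (F : MvPowerSeries σ A) :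
    MvPowerSeries.map φ (genDer D m F) = genDer D' m (MvPowerSeries.map φ F) := by
  classical
  ext e
  simp only [MvPowerSeries.coeff_map, coeff_genDer, truncDer_apply, map_sum]
  refine Finset.sum_congr rfl fun k _ => ?_
  simp only [coeff_X_pow_mul_eq_ite]
  split_ifs
  · simp [hφ]
  · simp

/-- The substitution `λ ↦ λ_i` in a power series in `λ⁻¹`. -/
def substVar (i : σ) : PowerSeries A →+* MvPowerSeries σ A :=
  (MvPowerSeries.rename (R := A) (fun _ : Unit => i)).toRingHom

@[simp] theorem substVar_X (i : σ) :
    substVar i (PowerSeries.X : PowerSeries A) = MvPowerSeries.X i :=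
  MvPowerSeries.rename_X _ _

@[simp] theorem substVar_C (i : σ) (a : A) :
    substVar i (PowerSeries.C a) = MvPowerSeries.C a :=
  MvPowerSeries.rename_C _ _

theorem map_substVar {B : Type*} [CommRing B] (φ : A →+* B) (i : σ) (a : PowerSeries A) :
    MvPowerSeries.map φ (substVar i a) = substVar i (PowerSeries.map φ a) :=
  (MvPowerSeries.rename_map _ φ a).symm

theorem coeff_single_substVar (i : σ) (n : ℕ) (a : PowerSeries A) :
    MvPowerSeries.coeff (Finsupp.single i n) (substVar i a) = PowerSeries.coeff n a := by
  have h := MvPowerSeries.coeff_embDomain_rename (R := A)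
    (⟨fun _ : Unit => i, fun _ _ _ => rfl⟩ : Unit ↪ σ) a (Finsupp.single () n)
  rw [Finsupp.embDomain_single] at h
  exact h

theorem coeff_substVar_eq_zero (i : σ) {e : σ →₀ ℕ} {j : σ} (hj : j ≠ i) (he : e j ≠ 0)
    (a : PowerSeries A) : MvPowerSeries.coeff e (substVar i a) = 0 := by
  apply MvPowerSeries.coeff_rename_eq_zero
  rintro ⟨x, hx⟩
  apply he
  rw [← hx]
  apply Finsupp.mapDomain_of_notMem_range
  rintro ⟨u, hu⟩
  exact hj hu.symm

theorem isFreeOf_substVar {i m : σ} (h : m ≠ i) (a : PowerSeries A) :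
    IsFreeOf m (substVar i a) := fun _ he => coeff_substVar_eq_zero i h he a

/-- If `D_k a` are the coefficients of a series, that series is `∇ a`. -/
theorem genDer_C {a : A} {F : PowerSeries A} (h0 : PowerSeries.coeff 0 F = 0)
    (h1 : PowerSeries.coeff 1 F = 0) (h : ∀ k, D k a = PowerSeries.coeff (k + 2) F) (m : σ) :
    genDer D m (MvPowerSeries.C a) = substVar m F := by
  classical
  have hfree : IsFreeOf m (MvPowerSeries.C a : MvPowerSeries σ A) := by
    intro e he
    rw [MvPowerSeries.coeff_C, if_neg]
    rintro rfl
    simp at he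
  ext e
  rw [coeff_genDer_of_isFreeOf D hfree, MvPowerSeries.coeff_C]
  by_cases he : e = Finsupp.single m (e m)
  · have herase : e.erase m = 0 := by rw [he]; simp
    rw [if_pos herase]
    conv_rhs => rw [he]
    rw [coeff_single_substVar]
    split_ifs with h2
    · rw [h, Nat.sub_add_cancel h2]
    · have : e m = 0 ∨ e m = 1 := by omega
      rcases this with h3 | h3 <;> rw [h3] <;> simp [h0, h1]
  · obtain ⟨j, hj, hje⟩ : ∃ j, j ≠ m ∧ e j ≠ 0 := by
      by_contra! hcon
      apply he
      ext j
      by_cases hj : j = m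
      · subst hj; simp
      · rw [hcon j hj, Finsupp.single_eq_of_ne hj]
    have herase : e.erase m ≠ 0 := by
      intro h0
      apply hje
      rw [← Finsupp.erase_ne hj, h0, Finsupp.zero_apply]
    rw [if_neg herase, map_zero, ite_self, coeff_substVar_eq_zero m hj hje]

theorem eq_zero_of_X_pow_dvd_imp {i : σ} {Z : MvPowerSeries σ A}
    (h : ∀ n, MvPowerSeries.X i ^ n ∣ Z → MvPowerSeries.X i ^ (n + 1) ∣ Z) : Z = 0 := by
  have hn : ∀ n, MvPowerSeries.X i ^ n ∣ Z := by
    intro n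
    induction n with
    | zero => simp
    | succ n ih => exact h n ih
  ext e
  rw [map_zero]
  exact MvPowerSeries.X_pow_dvd_iff.mp (hn (e i + 1)) e (Nat.lt_succ_self _)

end GenDer

/-! ### Evolution of the ratios along the hierarchy -/

section DomainIdentities

variable {B : Type*} [CommRing B] [IsDomain B]

/-- The identity is checked in the fraction field. The denominators are nonzero because the Riccati
equations would otherwise force X, Z or w to vanish. Such an argument needs a domain, hence the
universal ring in place of W. -/
theorem ratioA_evolution_identity_of_isDomain {X Z v w y y1 Y Y1 x x1 N N1 : B}
    (hX : X ≠ 0) (hZ : Z ≠ 0) (hw : w ≠ 0)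
    (hA : y1 = X * (1 + (v + w * y) * y1)) (hA' : Y1 = Z * (1 + (v + w * Y) * Y1))
    (hB : x = Z * (w + (v + x1) * x))
    (hN : N * (1 - x * Y) = 1) (hN1 : N1 * (1 - x1 * Y1) = 1) :
    N1 * (X * Z * (Y1 - y1) * (1 - x1 * y1) + (X - Z) * (Y1 * y1)) =
      X * (((X - Z) * (N1 - N) + (X - Z) * (N * (x - w * Y)) * y + w *
       (N * (X * Z * (Y - y) * (1 - x * y) + (X - Z) * (Y * y)))) * y1 + (v + w * y) *
       (N1 * (X * Z * (Y1 - y1) * (1 - x1 * y1) + (X - Z) * (Y1 * y1)))) := by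
  have hx : x ≠ 0 := fun h => mul_ne_zero hZ hw (by
    linear_combination h * (1 - Z * (v + x1)) - hB)
  have hy1 : y1 ≠ 0 := fun h => hX (by
    linear_combination h * (1 - X * (v + w * y)) - hA)
  have hY1 : Y1 ≠ 0 := fun h => hZ (by
    linear_combination h * (1 - Z * (v + w * Y)) - hA')
  have hinj := IsFractionRing.injective B (FractionRing B)
  have h0 : ∀ {b : B}, b ≠ 0 → algebraMap B (FractionRing B) b ≠ 0 := fun hb =>
    (map_ne_zero_iff _ hinj).mpr hb
  apply hinj
  have key := ratioA_evolution_identity (h0 hX) (h0 hZ) (h0 hx) (h0 hw) (h0 hy1) (h0 hY1)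
    (by simpa using congrArg (algebraMap B (FractionRing B)) hA)
    (by simpa using congrArg (algebraMap B (FractionRing B)) hA')
    (by simpa using congrArg (algebraMap B (FractionRing B)) hB)
    (by simpa using congrArg (algebraMap B (FractionRing B)) hN)
    (by simpa using congrArg (algebraMap B (FractionRing B)) hN1)
  simpa only [map_mul, map_add, map_sub, map_one] using key

theorem ratioB_evolution_identity_of_isDomain {X Z v w xi xi1 Y Y1 x x1 N N1 : B}
    (hX : X ≠ 0) (hZ : Z ≠ 0) (hw : w ≠ 0)
    (hB' : xi = X * (w + (v + xi1) * xi)) (hA' : Y1 = Z * (1 + (v + w * Y) * Y1))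
    (hB : x = Z * (w + (v + x1) * x))
    (hN : N * (1 - x * Y) = 1) (hN1 : N1 * (1 - x1 * Y1) = 1) :
    N * (X * Z * (xi - x) * (1 - xi * Y) - (X - Z) * (Y * xi)) =
      X * ((X - Z) * (N * (x - w * Y)) + ((X - Z) * (N1 - N) +
        N1 * (X * Z * (xi1 - x1) * (1 - xi1 * Y1) - (X - Z) * (Y1 * xi1))) * xi + (v + xi1) *
       (N * (X * Z * (xi - x) * (1 - xi * Y) - (X - Z) * (Y * xi)))) := by
  have hx : x ≠ 0 := fun h => mul_ne_zero hZ hw (by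
    linear_combination h * (1 - Z * (v + x1)) - hB)
  have hxi : xi ≠ 0 := fun h => mul_ne_zero hX hw (by
    linear_combination h * (1 - X * (v + xi1)) - hB')
  have hY1 : Y1 ≠ 0 := fun h => hZ (by
    linear_combination h * (1 - Z * (v + w * Y)) - hA')
  have hinj := IsFractionRing.injective B (FractionRing B)
  have h0 : ∀ {b : B}, b ≠ 0 → algebraMap B (FractionRing B) b ≠ 0 := fun hb =>
    (map_ne_zero_iff _ hinj).mpr hb
  apply hinj
  have key := ratioB_evolution_identity (h0 hX) (h0 hZ) (h0 hx) (h0 hw) (h0 hxi) (h0 hY1)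
    (by simpa using congrArg (algebraMap B (FractionRing B)) hB')
    (by simpa using congrArg (algebraMap B (FractionRing B)) hA')
    (by simpa using congrArg (algebraMap B (FractionRing B)) hB)
    (by simpa using congrArg (algebraMap B (FractionRing B)) hN)
    (by simpa using congrArg (algebraMap B (FractionRing B)) hN1)
  simpa only [map_mul, map_add, map_sub, map_one] using key

theorem greenDiag_evolution_identity_of_isDomain
    {X Z v w y y1 xi xi1 M M1 Y Y1 x x1 N N1 : B} (hX : X ≠ 0) (hZ : Z ≠ 0) (hw : w ≠ 0)
    (hA : y1 = X * (1 + (v + w * y) * y1)) (hB' : xi = X * (w + (v + xi1) * xi))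
    (hM : M * (1 - xi * y) = 1) (hM1 : M1 * (1 - xi1 * y1) = 1)
    (hA' : Y1 = Z * (1 + (v + w * Y) * Y1))
    (hB : x = Z * (w + (v + x1) * x))
    (hN : N * (1 - x * Y) = 1) (hN1 : N1 * (1 - x1 * Y1) = 1) {G Gd Md xid yd : B}
    (hG : w * G = xi * M) (hGd : N * (x - w * Y) * G + w * Gd = xid * M + xi * Md)
    (hMd : Md = M ^ 2 * (xid * y + xi * yd))
    (hyd : (X - Z) * yd = N * (X * Z * (Y - y) * (1 - x * y) + (X - Z) * (Y * y)))
    (hxid : (X - Z) * xid = N * (X * Z * (xi - x) * (1 - xi * Y) - (X - Z) * (Y * xi))) :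
    (X - Z) ^ 2 * Gd = (X * Z) ^ 2 * (M1 * N1 * (1 - y1 * x1) * (1 - Y1 * xi1) -
      M * N * (1 - y * x) * (1 - Y * xi)) := by
  have hx : x ≠ 0 := fun h => mul_ne_zero hZ hw (by
    linear_combination h * (1 - Z * (v + x1)) - hB)
  have hxi : xi ≠ 0 := fun h => mul_ne_zero hX hw (by
    linear_combination h * (1 - X * (v + xi1)) - hB')
  have hY1 : Y1 ≠ 0 := fun h => hZ (by
    linear_combination h * (1 - Z * (v + w * Y)) - hA')
  have hy1 : y1 ≠ 0 := fun h => hX (by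
    linear_combination h * (1 - X * (v + w * y)) - hA)
  have hinj := IsFractionRing.injective B (FractionRing B)
  have h0 : ∀ {b : B}, b ≠ 0 → algebraMap B (FractionRing B) b ≠ 0 := fun hb =>
    (map_ne_zero_iff _ hinj).mpr hb
  have hm : ∀ {a b : B}, a = b → algebraMap B (FractionRing B) a = algebraMap B _ b :=
    fun h => congrArg _ h
  apply hinj
  have key := greenDiag_evolution_identity (h0 hX) (h0 hZ) (h0 hx) (h0 hw) (h0 hxi) (h0 hY1)
    (h0 hy1)
    (by simpa only [map_mul, map_add, map_sub, map_one] using hm hA)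
    (by simpa only [map_mul, map_add, map_sub, map_one] using hm hB')
    (by simpa only [map_mul, map_add, map_sub, map_one] using hm hM)
    (by simpa only [map_mul, map_add, map_sub, map_one] using hm hM1)
    (by simpa only [map_mul, map_add, map_sub, map_one] using hm hA')
    (by simpa only [map_mul, map_add, map_sub, map_one] using hm hB)
    (by simpa only [map_mul, map_add, map_sub, map_one] using hm hN)
    (by simpa only [map_mul, map_add, map_sub, map_one] using hm hN1)
    (by simpa only [map_mul, map_add, map_sub, map_one] using hm hG)
    (by simpa only [map_mul, map_add, map_sub, map_one] using hm hGd)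
    (by simpa only [map_mul, map_add, map_sub, map_one, map_pow] using hm hMd)
    (by simpa only [map_mul, map_add, map_sub, map_one] using hm hyd)
    (by simpa only [map_mul, map_add, map_sub, map_one] using hm hxid)
  simpa only [map_mul, map_add, map_sub, map_one, map_pow] using key

end DomainIdentities

section Evolution

variable {σ : Type*}

instance isDomain_diffSeries : IsDomain (MvPowerSeries σ DiffPoly) :=
  NoZeroDivisors.to_isDomain _

/-- The shift of the coefficients. -/
def shiftDiff : MvPowerSeries σ DiffPoly →+* MvPowerSeries σ DiffPoly :=
  MvPowerSeries.map (shiftAut : DiffPoly →+* DiffPoly)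

/-- The universal `y(λ_i)`. -/
def diffA (i : σ) : MvPowerSeries σ DiffPoly := substVar i (ratioA shiftAut (vGen 0) (wGen 0))

/-- The universal `x(λ_i)`. -/
def diffB (i : σ) : MvPowerSeries σ DiffPoly := substVar i (ratioB shiftAut (vGen 0) (wGen 0))

/-- The universal `1 / (1 - x(λ_i) y(λ_i))`. -/
def diffN (i : σ) : MvPowerSeries σ DiffPoly := substVar i (ratioN shiftAut (vGen 0) (wGen 0))

/-- The universal `∑ Coef(L^k, 0) λ_i^{-k-1}`. -/
def diffG (i : σ) : MvPowerSeries σ DiffPoly :=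
  substVar i (greenDiag shiftAut (vGen 0) (wGen 0))

/-- `v_0` as a constant series. -/
def diffV : MvPowerSeries σ DiffPoly := MvPowerSeries.C (vGen 0)

/-- `w_0` as a constant series. -/
def diffW : MvPowerSeries σ DiffPoly := MvPowerSeries.C (wGen 0)

theorem shiftDiff_substVar (i : σ) (a : PowerSeries DiffPoly) :
    shiftDiff (substVar i a) = substVar i (shiftSeries shiftAut 1 a) := by
  rw [shiftDiff, map_substVar, shiftSeries, zpow_one]

@[simp] theorem shiftDiff_X (i : σ) :
    shiftDiff (MvPowerSeries.X i) = MvPowerSeries.X i := by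
  simp [shiftDiff]

theorem diffW_ne_zero : (diffW : MvPowerSeries σ DiffPoly) ≠ 0 := by
  intro h
  have := congrArg MvPowerSeries.constantCoeff h
  rw [diffW, MvPowerSeries.constantCoeff_C, map_zero] at this
  exact wGen_ne_zero 0 this

theorem X_ne_zero' (i : σ) : (MvPowerSeries.X i : MvPowerSeries σ DiffPoly) ≠ 0 :=
  nonZeroDivisors.ne_zero MvPowerSeries.X_mem_nonzeroDivisors

theorem diffA_eq (i : σ) : shiftDiff (diffA i) = MvPowerSeries.X i *
    (1 + (diffV + diffW * diffA i) * shiftDiff (diffA i)) := by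
  have h := congrArg (substVar i) (ratioA_eq shiftAut (vGen 0) (wGen 0))
  simp only [map_mul, map_add, map_one, substVar_X, substVar_C] at h
  rw [diffA, shiftDiff_substVar]
  exact h

theorem diffB_eq (i : σ) : diffB i = MvPowerSeries.X i *
    (diffW + (diffV + shiftDiff (diffB i)) * diffB i) := by
  have h := congrArg (substVar i) (ratioB_eq shiftAut (vGen 0) (wGen 0))
  simp only [map_mul, map_add, substVar_X, substVar_C] at h
  rw [diffB, shiftDiff_substVar]
  exact h

theorem diffN_mul (i : σ) : diffN i * (1 - diffB i * diffA i) = 1 := by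
  have h := congrArg (substVar i) (ratioN_mul shiftAut (vGen 0) (wGen 0))
  rw [map_mul, map_sub, map_mul, map_one] at h
  exact h

theorem shiftDiff_diffN_mul (i : σ) :
    shiftDiff (diffN i) * (1 - shiftDiff (diffB i) * shiftDiff (diffA i)) = 1 := by
  have h := congrArg shiftDiff (diffN_mul i)
  simpa only [map_mul, map_sub, map_one] using h

theorem diffW_mul_diffG (i : σ) : diffW * diffG i = diffB i * diffN i := by
  have h := congrArg (substVar i) (C_mul_greenDiag shiftAut (vGen 0) (wGen 0))
  rw [map_mul, map_mul, substVar_C] at h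
  exact h

/-! ### The action of ∇(λ_m) on v, w, y, x, N and the diagonal Green function -/

theorem genDer_shiftDiff (m : σ) (F : MvPowerSeries σ DiffPoly) :
    genDer todaD m (shiftDiff F) = shiftDiff (genDer todaD m F) :=
  (map_genDer todaD (shiftAut : DiffPoly →+* DiffPoly)
    (fun k a => (todaD_shiftPoly k 1 a).symm) m F).symm

/-- The series of ∇(λ_m) starts at λ_m⁻², so identifying it with (Λ - 1) N requires N = 1 + O(X²).
-/
theorem coeff_ratioN_low {n : ℕ} (hn : n < 2) :
    PowerSeries.coeff n (ratioN shiftAut (vGen 0) (wGen 0)) = if n = 0 then 1 else 0 := by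
  have h := C_mul_shiftSeries_green_one shiftAut (vGen 0) (wGen 0)
  have h' : ratioN shiftAut (vGen 0) (wGen 0) = PowerSeries.C (wGen 0) *
      shiftSeries shiftAut (-1) (green shiftAut (vGen 0) (wGen 0) 1) + 1 := by
    rw [h]; ring
  rw [h', map_add, PowerSeries.coeff_C_mul, coeff_shiftSeries, PowerSeries.coeff_one]
  have : PowerSeries.coeff n (green shiftAut (vGen 0) (wGen 0) 1) = 0 := by
    interval_cases n
    · rw [green_eq]; simp
    · have := coeff_green 0 1
      rw [zero_add] at this
      rw [this]
      simp [DiffOp.pow]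
  rw [this, map_zero, mul_zero, zero_add]

@[simp] theorem genDer_todaD_X (m i : σ) :
    genDer todaD m (MvPowerSeries.X i) = 0 := genDer_X todaD m i

theorem genDer_diffV (m : σ) :
    genDer todaD m diffV = shiftDiff (diffN m) - diffN m := by
  have h := genDer_C todaD (a := vGen 0) (F := shiftSeries shiftAut 1
    (ratioN shiftAut (vGen 0) (wGen 0)) - ratioN shiftAut (vGen 0) (wGen 0))
    (by rw [map_sub, coeff_shiftSeries, coeff_ratioN_low (by omega)]; simp)
    (by rw [map_sub, coeff_shiftSeries, coeff_ratioN_low (by omega)]; simp)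
    todaD_vGen m
  rw [diffV, h, diffN, shiftDiff_substVar, map_sub]

theorem genDer_diffW (m : σ) :
    genDer todaD m diffW = diffN m * (diffB m - diffW * diffA m) := by
  have hdvd : PowerSeries.X ^ 2 ∣ ratioB shiftAut (vGen 0) (wGen 0) -
      PowerSeries.C (wGen 0) * ratioA shiftAut (vGen 0) (wGen 0) := by
    have hA := X_dvd_ratioA shiftAut (vGen 0) (wGen 0)
    have hB := X_dvd_ratioB shiftAut (vGen 0) (wGen 0)
    have hB1 : PowerSeries.X ^ 2 ∣ ratioB shiftAut (vGen 0) (wGen 0) -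
        PowerSeries.X * PowerSeries.C (wGen 0) := by
      have e : ratioB shiftAut (vGen 0) (wGen 0) - PowerSeries.X * PowerSeries.C (wGen 0) =
          PowerSeries.X * ((PowerSeries.C (vGen 0) + shiftSeries shiftAut 1
            (ratioB shiftAut (vGen 0) (wGen 0))) * ratioB shiftAut (vGen 0) (wGen 0)) := by
        linear_combination ratioB_eq shiftAut (vGen 0) (wGen 0)
      rw [e, pow_two]
      exact mul_dvd_mul_left _ (hB.mul_left _)
    have hA1 : PowerSeries.X ^ 2 ∣ shiftSeries shiftAut 1 (ratioA shiftAut (vGen 0) (wGen 0)) -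
        PowerSeries.X := by
      have e : shiftSeries shiftAut 1 (ratioA shiftAut (vGen 0) (wGen 0)) - PowerSeries.X =
          PowerSeries.X * ((PowerSeries.C (vGen 0) + PowerSeries.C (wGen 0) *
            ratioA shiftAut (vGen 0) (wGen 0)) *
            shiftSeries shiftAut 1 (ratioA shiftAut (vGen 0) (wGen 0))) := by
        linear_combination ratioA_eq shiftAut (vGen 0) (wGen 0)
      rw [e, pow_two]
      refine mul_dvd_mul_left _ (Dvd.dvd.mul_left ?_ _)
      have := X_pow_dvd_map ((shiftAut ^ (1 : ℤ) : RingAut DiffPoly) : DiffPoly →+* DiffPoly)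
        ((pow_one (PowerSeries.X : PowerSeries DiffPoly)).symm ▸ hA)
      rwa [pow_one] at this
    have hA2 : PowerSeries.X ^ 2 ∣ ratioA shiftAut (vGen 0) (wGen 0) - PowerSeries.X := by
      have := X_pow_dvd_map ((shiftAut ^ (-1 : ℤ) : RingAut DiffPoly) : DiffPoly →+* DiffPoly) hA1
      rw [map_sub, PowerSeries.map_X, ← shiftSeries, shiftSeries_shiftSeries, neg_add_cancel,
        shiftSeries_zero] at this
      exact this
    have := dvd_sub hB1 (hA2.mul_left (PowerSeries.C (wGen 0)))
    convert this using 1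
    ring
  have hlow : ∀ n < 2, PowerSeries.coeff n (ratioN shiftAut (vGen 0) (wGen 0) *
      (ratioB shiftAut (vGen 0) (wGen 0) -
        PowerSeries.C (wGen 0) * ratioA shiftAut (vGen 0) (wGen 0))) = 0 :=
    PowerSeries.X_pow_dvd_iff.mp (hdvd.mul_left _)
  have h := genDer_C todaD (hlow 0 (by omega)) (hlow 1 (by omega)) todaD_wGen_eq_coeff m
  rw [diffW, h, map_mul, map_sub, map_mul, substVar_C]
  rfl

theorem X_pow_dvd_of_shiftDiff {i : σ} {n : ℕ} {F : MvPowerSeries σ DiffPoly}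
    (h : MvPowerSeries.X i ^ n ∣ shiftDiff F) : MvPowerSeries.X i ^ n ∣ F := by
  obtain ⟨c, hc⟩ := h
  have := congrArg
    (MvPowerSeries.map ((shiftAut⁻¹ : RingAut DiffPoly) : DiffPoly →+* DiffPoly)) hc
  have hinv : MvPowerSeries.map ((shiftAut⁻¹ : RingAut DiffPoly) : DiffPoly →+* DiffPoly)
      (shiftDiff F) = F := by
    ext1 e
    rw [shiftDiff, MvPowerSeries.coeff_map, MvPowerSeries.coeff_map]
    exact (shiftPoly_shiftPoly (-1) 1 _).trans (by simp)
  rw [hinv] at this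
  rw [this]
  simp

theorem X_pow_dvd_shiftDiff {i : σ} {n : ℕ} {F : MvPowerSeries σ DiffPoly}
    (h : MvPowerSeries.X i ^ n ∣ F) : MvPowerSeries.X i ^ n ∣ shiftDiff F := by
  obtain ⟨c, rfl⟩ := h
  simp

theorem genDer_diffA (m i : σ) :
    (MvPowerSeries.X i - MvPowerSeries.X m) * genDer todaD m (diffA i) =
      diffN m * (MvPowerSeries.X i * MvPowerSeries.X m * (diffA m - diffA i) *
        (1 - diffB m * diffA i) +
        (MvPowerSeries.X i - MvPowerSeries.X m) * (diffA m * diffA i)) := by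
  have hid := ratioA_evolution_identity_of_isDomain (X_ne_zero' i) (X_ne_zero' m) diffW_ne_zero
    (diffA_eq i) (diffA_eq m) (diffB_eq m) (diffN_mul m) (shiftDiff_diffN_mul m)
  have hd := congrArg (genDer todaD m) (diffA_eq i)
  simp only [Derivation.leibniz, map_add, genDer_todaD_X, Derivation.map_one_eq_zero, smul_eq_mul,
    genDer_diffV, genDer_diffW, genDer_shiftDiff] at hd
  rw [← sub_eq_zero]
  set Z := (MvPowerSeries.X i - MvPowerSeries.X m) * genDer todaD m (diffA i) -
      diffN m * (MvPowerSeries.X i * MvPowerSeries.X m * (diffA m - diffA i) *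
        (1 - diffB m * diffA i) +
        (MvPowerSeries.X i - MvPowerSeries.X m) * (diffA m * diffA i)) with hZ
  have hZ' := congrArg shiftDiff hZ
  simp only [map_mul, map_sub, map_add, map_one, shiftDiff_X] at hZ'
  -- The true and the proposed derivative satisfy the same inhomogeneous linear equation. Their
  -- difference satisfies the homogeneous one, whose factor X_i forces it to be divisible by every
  -- power of X_i.
  have hrec : shiftDiff Z = MvPowerSeries.X i * (diffW * shiftDiff (diffA i) * Z +
      (diffV + diffW * diffA i) * shiftDiff Z) := by
    rw [hZ', hZ]
    linear_combination (MvPowerSeries.X i - MvPowerSeries.X m) * hd - hid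
  refine eq_zero_of_X_pow_dvd_imp (i := i) fun n hn => ?_
  apply X_pow_dvd_of_shiftDiff
  rw [hrec, pow_succ']
  exact mul_dvd_mul_left _ (dvd_add (hn.mul_left _) ((X_pow_dvd_shiftDiff hn).mul_left _))

theorem genDer_diffB (m i : σ) :
    (MvPowerSeries.X i - MvPowerSeries.X m) * genDer todaD m (diffB i) =
      diffN m * (MvPowerSeries.X i * MvPowerSeries.X m * (diffB i - diffB m) *
        (1 - diffB i * diffA m) -
        (MvPowerSeries.X i - MvPowerSeries.X m) * (diffA m * diffB i)) := by
  have hid := ratioB_evolution_identity_of_isDomain (X_ne_zero' i) (X_ne_zero' m) diffW_ne_zero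
    (diffB_eq i) (diffA_eq m) (diffB_eq m) (diffN_mul m) (shiftDiff_diffN_mul m)
  have hd := congrArg (genDer todaD m) (diffB_eq i)
  simp only [Derivation.leibniz, map_add, genDer_todaD_X, smul_eq_mul,
    genDer_diffV, genDer_diffW, genDer_shiftDiff] at hd
  rw [← sub_eq_zero]
  set Z := (MvPowerSeries.X i - MvPowerSeries.X m) * genDer todaD m (diffB i) -
      diffN m * (MvPowerSeries.X i * MvPowerSeries.X m * (diffB i - diffB m) *
        (1 - diffB i * diffA m) -
        (MvPowerSeries.X i - MvPowerSeries.X m) * (diffA m * diffB i)) with hZ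
  have hZ' := congrArg shiftDiff hZ
  simp only [map_mul, map_sub, map_one, shiftDiff_X] at hZ'
  have hrec : Z = MvPowerSeries.X i * (diffB i * shiftDiff Z +
      (diffV + shiftDiff (diffB i)) * Z) := by
    rw [hZ', hZ]
    linear_combination (MvPowerSeries.X i - MvPowerSeries.X m) * hd - hid
  refine eq_zero_of_X_pow_dvd_imp (i := i) fun n hn => ?_
  rw [hrec, pow_succ']
  exact mul_dvd_mul_left _ (dvd_add ((X_pow_dvd_shiftDiff hn).mul_left _) (hn.mul_left _))

theorem genDer_diffN (m i : σ) : genDer todaD m (diffN i) =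
    diffN i ^ 2 * (genDer todaD m (diffB i) * diffA i + diffB i * genDer todaD m (diffA i)) := by
  have h := congrArg (genDer todaD m) (diffN_mul i)
  simp only [Derivation.leibniz, map_sub, Derivation.map_one_eq_zero, smul_eq_mul] at h
  linear_combination diffN i * h - genDer todaD m (diffN i) * diffN_mul i

theorem genDer_diffG (a b : σ) :
    (MvPowerSeries.X a - MvPowerSeries.X b) ^ 2 * genDer todaD b (diffG a) =
      (MvPowerSeries.X a * MvPowerSeries.X b) ^ 2 *
        (shiftDiff (diffN a * diffN b * (1 - diffA a * diffB b) * (1 - diffA b * diffB a)) -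
          diffN a * diffN b * (1 - diffA a * diffB b) * (1 - diffA b * diffB a)) := by
  have hG := diffW_mul_diffG a
  have hd := congrArg (genDer todaD b) hG
  simp only [Derivation.leibniz, smul_eq_mul, genDer_diffW] at hd
  have := greenDiag_evolution_identity_of_isDomain (X_ne_zero' a) (X_ne_zero' b) diffW_ne_zero
    (diffA_eq a) (diffB_eq a) (diffN_mul a) (shiftDiff_diffN_mul a) (diffA_eq b) (diffB_eq b)
    (diffN_mul b) (shiftDiff_diffN_mul b) hG (Gd := genDer todaD b (diffG a))
    (Md := genDer todaD b (diffN a)) (xid := genDer todaD b (diffB a))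
    (yd := genDer todaD b (diffA a)) (by linear_combination hd) (genDer_diffN b a)
    (genDer_diffA b a) (genDer_diffB b a)
  rw [this]
  simp only [map_mul, map_sub, map_one]

end Evolution

/-! ### Derivations of localizations -/

/-- A derivation is a ring homomorphism b ↦ b + ε d(b) into the dual numbers. An element there is a
unit as soon as its ε-free part is, so the homomorphism extends to the localization, and its ε-part
is the extended derivation. -/
theorem exists_derivation_localization {B L : Type*} [CommRing B] [CommRing L] [Algebra B L]
    (M : Submonoid B) [IsLocalization M L] (d : B →+ B)
    (hd : ∀ a b, d (a * b) = a * d b + b * d a) :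
    ∃ d' : Derivation ℤ L L, ∀ b, d' (algebraMap B L b) = algebraMap B L (d b) := by
  have hd1 : d 1 = 0 := by
    have h := hd 1 1
    rw [mul_one, one_mul] at h
    linear_combination -h
  let θ : B →+* TrivSqZeroExt L L :=
    { toFun := fun b => TrivSqZeroExt.inl (algebraMap B L b) +
        TrivSqZeroExt.inr (algebraMap B L (d b))
      map_one' := by
        ext <;> simp only [TrivSqZeroExt.fst_add, TrivSqZeroExt.fst_inl, TrivSqZeroExt.fst_inr,
          TrivSqZeroExt.snd_add, TrivSqZeroExt.snd_inl, TrivSqZeroExt.snd_inr, map_one,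
          TrivSqZeroExt.fst_one, TrivSqZeroExt.snd_one, hd1, map_zero,
          add_zero]
      map_zero' := by
        ext <;> simp only [TrivSqZeroExt.fst_add, TrivSqZeroExt.fst_inl, TrivSqZeroExt.fst_inr,
          TrivSqZeroExt.snd_add, TrivSqZeroExt.snd_inl, TrivSqZeroExt.snd_inr, map_zero,
          TrivSqZeroExt.fst_zero, TrivSqZeroExt.snd_zero, add_zero]
      map_add' := fun a b => by
        ext <;> simp only [TrivSqZeroExt.fst_add, TrivSqZeroExt.fst_inl, TrivSqZeroExt.fst_inr,
          TrivSqZeroExt.snd_add, TrivSqZeroExt.snd_inl, TrivSqZeroExt.snd_inr, map_add, add_zero,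
          zero_add]
      map_mul' := fun a b => by
        ext <;> simp only [TrivSqZeroExt.fst_add, TrivSqZeroExt.fst_inl, TrivSqZeroExt.fst_inr,
          TrivSqZeroExt.snd_add, TrivSqZeroExt.snd_inl, TrivSqZeroExt.snd_inr, map_mul, add_zero,
          zero_add, TrivSqZeroExt.fst_mul, TrivSqZeroExt.snd_mul, hd, map_add,
          smul_eq_mul, MulOpposite.smul_eq_mul_unop, MulOpposite.unop_op]
        ring }
  have hfst : ∀ b, (θ b).fst = algebraMap B L b := fun b => by
    change (TrivSqZeroExt.inl _ + TrivSqZeroExt.inr _ : TrivSqZeroExt L L).fst = _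
    simp
  have hsnd : ∀ b, (θ b).snd = algebraMap B L (d b) := fun b => by
    change (TrivSqZeroExt.inl _ + TrivSqZeroExt.inr _ : TrivSqZeroExt L L).snd = _
    rw [TrivSqZeroExt.snd_add, TrivSqZeroExt.snd_inl, TrivSqZeroExt.snd_inr, zero_add]
  have hunit : ∀ y : M, IsUnit (θ y) := fun y => by
    rw [TrivSqZeroExt.isUnit_iff_isUnit_fst, hfst]
    exact IsLocalization.map_units L y
  let ρ : L →+* TrivSqZeroExt L L := IsLocalization.lift hunit
  have hρ : ∀ b, ρ (algebraMap B L b) = θ b := fun b => IsLocalization.lift_eq hunit b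
  have hρfst : ∀ a, (ρ a).fst = a := by
    have : (TrivSqZeroExt.fstHom L L L).toRingHom.comp ρ = RingHom.id L := by
      apply IsLocalization.ringHom_ext M
      ext b
      change (ρ (algebraMap B L b)).fst = algebraMap B L b
      rw [hρ, hfst]
    intro a
    exact congrArg (fun f : L →+* L => f a) this
  refine ⟨Derivation.mk' (AddMonoidHom.toIntLinearMap
    { toFun := fun a => (ρ a).snd
      map_zero' := by simp
      map_add' := fun a b => by simp }) ?_, ?_⟩
  · intro a b
    change (ρ (a * b)).snd = a • (ρ b).snd + b • (ρ a).snd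
    rw [map_mul, TrivSqZeroExt.snd_mul, hρfst, hρfst]
    simp [mul_comm]
  · intro b
    change (ρ (algebraMap B L b)).snd = _
    rw [hρ, hsnd]

/-! ### Path products -/

section Paths

variable {σ R : Type*} [CommRing R]

/-- The product of `F` along the path `a → l → c`. -/
def pathProd (F : σ → σ → R) : σ → List σ → σ → R
  | a, [], c => F a c
  | a, b :: l, c => F a b * pathProd F b l c

/-- The sum of the products of `F` over the closed paths through `b` and all entries of `l`. -/
def cycleSum (F : σ → σ → R) (l : List σ) (b : σ) : R :=
  (l.permutations'.map fun l' => pathProd F b l' b).sum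

/-- By the Leibniz rule, each edge i → j contributes minus the path with m inserted in that edge,
plus (F m j - F m i) times the path. The latter telescope to the two endpoints. -/
theorem derivation_pathProd (F : σ → σ → R) (δ : Derivation ℤ R R) (m : σ)
    (hδ : ∀ i j, i ≠ j → m ≠ i → m ≠ j →
      δ (F i j) = -(F i m * F m j) + (F m j - F m i) * F i j)
    (c : σ) (hmc : m ≠ c) (l : List σ) (a : σ) (hl : (a :: l).Nodup) (hm : m ∉ a :: l)
    (hc : c ∉ l) (hac : a ≠ c ∨ l ≠ []) :
    δ (pathProd F a l c) = -((l.permutations'Aux m).map fun l' => pathProd F a l' c).sum +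
      (F m c - F m a) * pathProd F a l c := by
  induction l generalizing a with
  | nil =>
    have hne : a ≠ c := by simpa using hac
    simp only [List.mem_singleton] at hm
    simp [pathProd, hδ a c hne hm hmc]
  | cons b l ih =>
    rw [List.mem_cons, not_or] at hm
    rw [List.mem_cons, not_or] at hc
    rw [List.nodup_cons] at hl
    have hab : a ≠ b := fun h => hl.1 (by simp [h])
    have hmb : m ≠ b := fun h => hm.2 (by simp [h])
    rw [pathProd, Derivation.leibniz, ih b hl.2 hm.2 hc.2 (Or.inl (Ne.symm hc.1)),
      hδ a b hab hm.1 hmb, List.permutations'Aux, List.map_cons, List.sum_cons, List.map_map]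
    have hcomp : ((fun l' => pathProd F a l' c) ∘ List.cons b) =
        fun l' => F a b * pathProd F b l' c := rfl
    rw [hcomp, List.sum_map_mul_left]
    simp only [pathProd, smul_eq_mul]
    ring

/-- For a closed path the telescoped endpoint term is zero. Inserting m at every place of every
ordering of `l` is how `permutations'` enumerates the orderings of `m :: l`. The list must be
nonempty because the rule for δ does not cover a loop b → b. -/
theorem derivation_cycleSum (F : σ → σ → R) (δ : Derivation ℤ R R) (m : σ)
    (hδ : ∀ i j, i ≠ j → m ≠ i → m ≠ j →
      δ (F i j) = -(F i m * F m j) + (F m j - F m i) * F i j)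
    (b : σ) (l : List σ) (hl : (b :: l).Nodup) (hm : m ∉ b :: l) (hne : l ≠ []) :
    δ (cycleSum F l b) = -cycleSum F (m :: l) b := by
  have key : ∀ L : List (List σ), (∀ l' ∈ L, List.Perm l' l) →
      δ (L.map fun l' => pathProd F b l' b).sum =
        -((L.flatMap (List.permutations'Aux m)).map fun l' => pathProd F b l' b).sum := by
    intro L hL
    induction L with
    | nil => simp
    | cons l' L ih =>
      have hp := hL l' (by simp)
      have h1 := derivation_pathProd F δ m hδ b (fun h => hm (by simp [h])) l' b
        ((hp.cons b).nodup_iff.mpr hl) (fun h => hm ((hp.cons b).mem_iff.mp h))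
        (fun h => (List.nodup_cons.mp hl).1 (hp.mem_iff.mp h))
        (Or.inr (fun h => hne (by rw [h] at hp; exact hp.nil_eq.symm)))
      rw [List.map_cons, List.sum_cons, map_add, h1,
        ih (fun l'' h => hL l'' (List.mem_cons_of_mem _ h)), List.flatMap_cons, List.map_append,
        List.sum_append]
      ring
  rw [cycleSum, key _ (fun l' h => List.mem_permutations'.mp h)]
  rfl

end Paths

/-! ### The generating series of the tau-structure -/

section TauSeries

variable {σ A : Type*} [CommRing A]

/-- All exponents at entries of `L` are at least two, the others vanish. -/
def HasExponents (L : List σ) (e : σ →₀ ℕ) : Prop :=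
  (∀ j, j ∉ L → e j = 0) ∧ ∀ j ∈ L, 2 ≤ e j

open Classical in
/-- The series `∑ Ω_{p,q} λ_a^{-p-2} λ_b^{-q-2}`. -/
def tauSeries (Ω : ℕ → ℕ → A) (a b : σ) : MvPowerSeries σ A := fun e =>
  if HasExponents [a, b] e then Ω (e a - 2) (e b - 2) else 0

open Classical in
theorem coeff_tauSeries (Ω : ℕ → ℕ → A) (a b : σ) (e : σ →₀ ℕ) :
    MvPowerSeries.coeff e (tauSeries Ω a b) =
      if HasExponents [a, b] e then Ω (e a - 2) (e b - 2) else 0 := rfl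

/-- The series obtained from `tauSeries` by applying `∇(λ_m)` for the entries `m` of `l`. -/
def corrSeries (D : ℕ → Derivation ℤ A A) (Ω : ℕ → ℕ → A) (l : List σ) (a b : σ) : MvPowerSeries σ A :=
  l.foldr (fun m F => genDer D m F) (tauSeries Ω a b)

open Classical in
theorem coeff_corrSeries (D : ℕ → Derivation ℤ A A) (Ω : ℕ → ℕ → A) (l : List σ) (a b : σ)
    (hl : (l ++ [a, b]).Nodup) (e : σ →₀ ℕ) :
    MvPowerSeries.coeff e (corrSeries D Ω l a b) =
      if HasExponents (l ++ [a, b]) e then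
        l.foldr (fun m P => D (e m - 2) P) (Ω (e a - 2) (e b - 2)) else 0 := by
  induction l generalizing e with
  | nil => exact coeff_tauSeries Ω a b e
  | cons m l ih =>
    rw [List.cons_append, List.nodup_cons] at hl
    -- The entries are distinct, so the variable of the newly applied ∇(λ_m) has not occurred yet.
    have hfree : IsFreeOf m (corrSeries D Ω l a b) := by
      intro e he
      rw [ih hl.2, if_neg]
      exact fun h => he (h.1 m hl.1)
    change MvPowerSeries.coeff e (genDer D m (corrSeries D Ω l a b)) = _
    refine (coeff_genDer_of_isFreeOf D hfree e).trans ?_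
    have hiff : HasExponents (m :: l ++ [a, b]) e ↔
        2 ≤ e m ∧ HasExponents (l ++ [a, b]) (e.erase m) := by
      constructor
      · rintro ⟨h1, h2⟩
        refine ⟨h2 m (by simp), fun j hj => ?_, fun j hj => ?_⟩
        · by_cases hjm : j = m
          · subst hjm; simp
          · rw [Finsupp.erase_ne hjm]
            exact h1 j (by rw [List.cons_append, List.mem_cons]; tauto)
        · have hjm : j ≠ m := fun h => hl.1 (h ▸ hj)
          rw [Finsupp.erase_ne hjm]
          exact h2 j (List.mem_cons_of_mem _ hj)
      · rintro ⟨h0, h1, h2⟩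
        refine ⟨fun j hj => ?_, fun j hj => ?_⟩
        · rw [List.cons_append, List.mem_cons, not_or] at hj
          rw [← Finsupp.erase_ne hj.1]
          exact h1 j hj.2
        · rw [List.cons_append, List.mem_cons] at hj
          rcases hj with rfl | hj
          · exact h0
          · have hjm : j ≠ m := fun h => hl.1 (h ▸ hj)
            rw [← Finsupp.erase_ne hjm]
            exact h2 j hj
    have hne : ∀ j ∈ l ++ [a, b], (e.erase m) j = e j := fun j hj =>
      Finsupp.erase_ne (fun h => hl.1 (h ▸ hj))
    have hfold : ∀ (l' : List σ) (P : A), (∀ j ∈ l', (e.erase m) j = e j) →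
        l'.foldr (fun m' P => D ((e.erase m) m' - 2) P) P =
          l'.foldr (fun m' P => D (e m' - 2) P) P := by
      intro l' P hl'
      induction l' with
      | nil => rfl
      | cons x l' ihl =>
        rw [List.foldr_cons, List.foldr_cons, ihl (fun j hj => hl' j (List.mem_cons_of_mem _ hj)),
          hl' x (by simp)]
    rw [ih hl.2, hiff]
    by_cases h0 : 2 ≤ e m
    · rw [if_pos h0]
      by_cases h1 : HasExponents (l ++ [a, b]) (e.erase m)
      · rw [if_pos h1, if_pos ⟨h0, h1⟩, hfold l _ (fun j hj => hne j (by simp [hj])),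
          hne a (by simp), hne b (by simp)]
        rfl
      · rw [if_neg h1, if_neg (fun h => h1 h.2), map_zero]
    · rw [if_neg h0, if_neg (fun h => h0 h.1)]

theorem coeff_genDer_todaD {m : σ} {F : MvPowerSeries σ DiffPoly} (hF : IsFreeOf m F)
    (e : σ →₀ ℕ) : MvPowerSeries.coeff e (genDer todaD m F) =
      if 2 ≤ e m then todaD (e m - 2) (MvPowerSeries.coeff (e.erase m) F) else 0 :=
  coeff_genDer_of_isFreeOf todaD hF e

/-- This is (Λ - 1) Ω_{p,q} = D_q S_p in generating form, with S_p the coefficient of X^{p+2} in G.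
-/
theorem shiftDiff_tauSeries {Ω : ℕ → ℕ → DiffPoly} {S : ℕ → DiffPoly}
    (h : IsCanonicalTauStructure Ω S) {a b : σ} (hab : a ≠ b) :
    shiftDiff (tauSeries Ω a b) - tauSeries Ω a b = genDer todaD b (diffG a) := by
  classical
  ext1 e
  have hfree : IsFreeOf b (diffG a : MvPowerSeries σ DiffPoly) := isFreeOf_substVar hab.symm _
  refine Eq.trans ?_ (coeff_genDer_todaD hfree e).symm
  rw [map_sub, shiftDiff, MvPowerSeries.coeff_map, coeff_tauSeries]
  by_cases hsupp : ∀ j, j ∉ [a, b] → e j = 0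
  · have herase : e.erase b = Finsupp.single a (e a) := by
      ext j
      by_cases hjb : j = b
      · subst hjb; simp [hab]
      · rw [Finsupp.erase_ne hjb]
        by_cases hja : j = a
        · subst hja; simp
        · rw [Finsupp.single_eq_of_ne hja]
          exact hsupp j (by simp [hja, hjb])
    rw [herase, diffG, coeff_single_substVar]
    by_cases hb : 2 ≤ e b
    · by_cases ha : 2 ≤ e a
      · have hexp : HasExponents [a, b] e := ⟨hsupp, by simp [ha, hb]⟩
        rw [if_pos hexp, if_pos hb]
        obtain ⟨p, hp⟩ := Nat.exists_eq_add_of_le' ha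
        rw [hp, coeff_greenDiag, Nat.add_sub_cancel, ← h.S_eq, ← h.shift_sub]
        rfl
      · have hexp : ¬HasExponents [a, b] e := fun hexp => ha (hexp.2 a (by simp))
        rw [if_neg hexp, if_pos hb, map_zero, sub_zero]
        have : e a = 0 ∨ e a = 1 := by omega
        -- The terms of G below X² have no counterpart in the tau series, but they are the constants
        -- 0 and 1 and D_q kills them.
        rcases this with h0 | h0
        · rw [h0, PowerSeries.coeff_zero_eq_constantCoeff, constantCoeff_greenDiag, map_zero]
        · rw [h0, coeff_one_greenDiag, Derivation.map_one_eq_zero]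
    · have hexp : ¬HasExponents [a, b] e := fun hexp => hb (hexp.2 b (by simp))
      rw [if_neg hexp, if_neg hb, map_zero, sub_zero]
  · have hexp : ¬HasExponents [a, b] e := fun hexp => hsupp hexp.1
    rw [if_neg hexp, map_zero, sub_zero]
    push Not at hsupp
    obtain ⟨j, hj, hje⟩ := hsupp
    simp only [List.mem_cons, List.not_mem_nil, or_false, not_or] at hj
    rw [diffG, coeff_substVar_eq_zero a hj.1 (by rw [Finsupp.erase_ne hj.2]; exact hje), map_zero,
      ite_self]

theorem eq_zero_of_shiftDiff_eq {F : MvPowerSeries σ DiffPoly} (h : shiftDiff F = F)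
    (h0 : MvPowerSeries.map MvPolynomial.constantCoeff F = 0) : F = 0 := by
  ext1 e
  have h1 := congrArg (MvPowerSeries.coeff e) h
  rw [shiftDiff, MvPowerSeries.coeff_map] at h1
  have h2 := eq_C_of_shiftPoly_eq h1
  have h3 := congrArg (MvPowerSeries.coeff e) h0
  rw [MvPowerSeries.coeff_map, map_zero] at h3
  rw [h2, h3, map_zero, map_zero]

/-- Both sides have the same image under Λ - 1, by the formula for ∇G. At v = w = 0 one has x = 0, N
= 1 and Ω = 0, so both sides vanish there, which excludes a constant of integration. -/
theorem tauSeries_eq {Ω : ℕ → ℕ → DiffPoly} {S : ℕ → DiffPoly}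
    (h : IsCanonicalTauStructure Ω S) {a b : σ} (hab : a ≠ b) :
    (MvPowerSeries.X a - MvPowerSeries.X b) ^ 2 * tauSeries Ω a b =
      (MvPowerSeries.X a * MvPowerSeries.X b) ^ 2 *
        (diffN a * diffN b * (1 - diffA a * diffB b) * (1 - diffA b * diffB a) - 1) := by
  rw [← sub_eq_zero]
  apply eq_zero_of_shiftDiff_eq
  · have h1 := shiftDiff_tauSeries h hab
    have h2 := genDer_diffG a b
    simp only [map_sub, map_mul, map_pow, map_one, shiftDiff_X] at h2 ⊢
    linear_combination (MvPowerSeries.X a - MvPowerSeries.X b) ^ 2 * h1 + h2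
  · have hA : ∀ i : σ, MvPowerSeries.map MvPolynomial.constantCoeff (diffA i) =
        MvPowerSeries.X i := fun i => by
      rw [diffA, map_substVar, constantCoeff_ratioA, substVar_X]
    have hB : ∀ i : σ, MvPowerSeries.map MvPolynomial.constantCoeff (diffB i) = 0 := fun i => by
      rw [diffB, map_substVar, constantCoeff_ratioB, map_zero]
    have hN : ∀ i : σ, MvPowerSeries.map MvPolynomial.constantCoeff (diffN i) = 1 := fun i => by
      rw [diffN, map_substVar, constantCoeff_ratioN, map_one]
    have hT : MvPowerSeries.map MvPolynomial.constantCoeff (tauSeries Ω a b) = 0 := by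
      classical
      ext1 e
      rw [MvPowerSeries.coeff_map, coeff_tauSeries]
      split_ifs <;> simp [h.Ω_zero]
    simp only [map_sub, map_mul, map_one, hA, hB, hN, hT]
    simp

end TauSeries

/-! ### The correlators as cyclic sums -/

section Correlators

variable {σ : Type*} {L : Type*} [CommRing L] [Algebra (MvPowerSeries σ DiffPoly) L]

/-- The image of a series in a ring in which the spectral parameters are inverted. -/
def toLoc : MvPowerSeries σ DiffPoly →+* L := algebraMap (MvPowerSeries σ DiffPoly) L

/-- The universal kernel `N_i (1 - y_i x_j) / (λ_i - λ_j)`, where `κ i j` is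
`1 / (λ_i - λ_j)`. -/
def diffKernel (κ : σ → σ → L) (i j : σ) : L :=
  toLoc (diffN i) * (1 - toLoc (diffA i) * toLoc (diffB j)) * κ i j

/-- Division by X_i - X_m in terms of the λ: X_i X_m/(X_i - X_m) = 1/(λ_m - λ_i). -/
theorem eq_of_spectral_mul_eq {R : Type*} [CommRing R] {Xi Xm li lm k d N P Q : R}
    (hi : Xi * li = 1) (hm : Xm * lm = 1) (hk : k * (lm - li) = 1)
    (h : (Xi - Xm) * d = N * (Xi * Xm * P + (Xi - Xm) * Q)) : d = N * (P * k + Q) := by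
  have hX : (Xi - Xm) * li * lm = lm - li := by
    linear_combination lm * hi - li * hm
  linear_combination k * li * lm * h - (d - N * Q) * (k * hX + hk) +
    N * k * P * (Xm * lm * hi + hm)

variable {lam : σ → L} {κ : σ → σ → L}

/-- The symbols λ and 1/(λ_i - λ_j) are constants for ∇(λ_m), so only N_i, y_i and x_j are
differentiated. The term (K_mj - K_mi) K_ij depends on i and j through a difference, and so drops
out of cyclic products. -/
theorem derivation_diffKernel
    (hlam : ∀ i, toLoc (MvPowerSeries.X i) * lam i = 1)
    (hκ : ∀ i j, i ≠ j → κ i j * (lam i - lam j) = 1)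
    {m : σ} {δ : Derivation ℤ L L}
    (hδ : ∀ F, δ (toLoc F) = toLoc (genDer todaD m F)) {i j : σ} (hij : i ≠ j)
    (hmi : m ≠ i) (hmj : m ≠ j) :
    δ (diffKernel κ i j) = -(diffKernel κ i m * diffKernel κ m j) +
      (diffKernel κ m j - diffKernel κ m i) * diffKernel κ i j := by
  have hδlam : ∀ i, δ (lam i) = 0 := fun i => by
    have h := congrArg δ (hlam i)
    rw [Derivation.leibniz, hδ, genDer_todaD_X, map_zero, smul_zero, add_zero,
      Derivation.map_one_eq_zero, smul_eq_mul] at h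
    linear_combination lam i * h - δ (lam i) * hlam i
  have hδκ : ∀ i j, i ≠ j → δ (κ i j) = 0 := fun i j hij => by
    have h := congrArg δ (hκ i j hij)
    rw [Derivation.leibniz, map_sub, hδlam, hδlam, sub_zero, smul_zero, zero_add,
      Derivation.map_one_eq_zero, smul_eq_mul] at h
    linear_combination κ i j * h - δ (κ i j) * hκ i j hij
  have hA := congrArg (toLoc (L := L)) (genDer_diffA m i)
  have hBi := congrArg (toLoc (L := L)) (genDer_diffB m i)
  have hBj := congrArg (toLoc (L := L)) (genDer_diffB m j)
  have hN := congrArg (toLoc (L := L)) (genDer_diffN m i)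
  have hNi := congrArg (toLoc (L := L)) (diffN_mul i)
  simp only [map_mul, map_sub, map_add, map_one, map_pow, ← hδ] at hA hBi hBj hN hNi
  rw [diffKernel, Derivation.leibniz, Derivation.leibniz, map_sub, Derivation.leibniz, hδκ i j hij,
    Derivation.map_one_eq_zero]
  simp only [diffKernel, smul_eq_mul]
  have hli := hlam i
  have hlj := hlam j
  have hlm := hlam m
  have hκij := hκ i j hij
  have hκmi := hκ m i hmi
  have hκmj := hκ m j hmj
  have hκim := hκ i m hmi.symm
  generalize (toLoc (MvPowerSeries.X i) : L) = Xi at *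
  generalize (toLoc (MvPowerSeries.X j) : L) = Xj at *
  generalize (toLoc (MvPowerSeries.X m) : L) = Xm at *
  generalize δ (toLoc (diffA i)) = dy at *
  generalize δ (toLoc (diffB i)) = dxi at *
  generalize δ (toLoc (diffB j)) = dxj at *
  generalize δ (toLoc (diffN i)) = dN at *
  generalize (toLoc (diffA i) : L) = yi at *
  generalize (toLoc (diffB i) : L) = xi at *
  generalize (toLoc (diffB j) : L) = xj at *
  generalize (toLoc (diffN i) : L) = Ni at *
  generalize (toLoc (diffA m) : L) = ym at *
  generalize (toLoc (diffB m) : L) = xm at *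
  generalize (toLoc (diffN m) : L) = Nm at *
  generalize lam i = li at *
  generalize lam j = lj at *
  generalize lam m = lm at *
  have hneg : κ i m = -κ m i := by
    linear_combination -κ m i * hκim - κ i m * hκmi
  rw [hneg]
  generalize κ i j = kij at *
  generalize κ m i = kmi at *
  generalize κ m j = kmj at *
  -- Partial fractions for 1/((λ_m - λ_i)(λ_m - λ_j)); this is what combines the two derivatives
  -- into the product K_im K_mj.
  have hk : kij * (kmi - kmj) = kmi * kmj := by
    linear_combination kij * kmj * hκmi - kij * kmi * hκmj + kmi * kmj * hκij
  have hdy : dy = Nm * ((ym - yi) * (1 - xm * yi) * kmi + ym * yi) := by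
    exact eq_of_spectral_mul_eq hli hlm hκmi (by linear_combination hA)
  have hdxi : dxi = Nm * ((xi - xm) * (1 - xi * ym) * kmi - ym * xi) := by
    rw [sub_eq_add_neg]
    exact eq_of_spectral_mul_eq hli hlm hκmi (by linear_combination hBi)
  have hdxj : dxj = Nm * ((xj - xm) * (1 - xj * ym) * kmj - ym * xj) := by
    rw [sub_eq_add_neg]
    exact eq_of_spectral_mul_eq hlj hlm hκmj (by linear_combination hBj)
  rw [hN, hdy, hdxi, hdxj]
  linear_combination (Ni * Nm * (1 - xj * ym) * (1 - xm * yi)) * hk -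
    kij * Ni * (1 - yi * xj) * (Nm * (1 - ym * xi) * kmi - Nm * (1 - xm * yi) * kmi) * hNi

/-- Since (X_a X_b)²/(X_a - X_b)² = κ_ab² and κ_ba = -κ_ab, the product in `tauSeries_eq` becomes
-K_ba K_ab, and its -1 becomes the correction for k = 2. -/
theorem toLoc_tauSeries {Ω : ℕ → ℕ → DiffPoly} {S : ℕ → DiffPoly}
    (h : IsCanonicalTauStructure Ω S)
    (hlam : ∀ i, toLoc (MvPowerSeries.X i) * lam i = 1)
    (hκ : ∀ i j, i ≠ j → κ i j * (lam i - lam j) = 1) {a b : σ} (hab : a ≠ b) :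
    toLoc (tauSeries Ω a b) = -(diffKernel κ b a * diffKernel κ a b) - κ a b ^ 2 := by
  have hT := congrArg (toLoc (L := L)) (tauSeries_eq h hab)
  simp only [map_mul, map_sub, map_one, map_pow] at hT
  have hneg : κ b a = -κ a b := by
    linear_combination -κ a b * hκ b a hab.symm - κ b a * hκ a b hab
  rw [diffKernel, diffKernel, hneg]
  have ha := hlam a
  have hb := hlam b
  have hk := hκ a b hab
  generalize (toLoc (MvPowerSeries.X a) : L) = Xa at *
  generalize (toLoc (MvPowerSeries.X b) : L) = Xb at *
  generalize (toLoc (tauSeries Ω a b) : L) = T at *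
  generalize lam a = la at *
  generalize lam b = lb at *
  generalize κ a b = k at *
  have hX : k * ((Xb - Xa) * la * lb) = 1 := by
    linear_combination k * la * hb - k * lb * ha + hk
  have hX2 : k ^ 2 * ((Xb - Xa) * la * lb) ^ 2 = 1 := by
    linear_combination (k * ((Xb - Xa) * la * lb) + 1) * hX
  have hXX : (Xa * Xb) ^ 2 * (la * lb) ^ 2 = 1 := by
    have : Xa * Xb * (la * lb) = 1 := by linear_combination Xb * lb * ha + hb
    linear_combination (Xa * Xb * (la * lb) + 1) * this
  generalize (toLoc (diffN a) : L) = Na at *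
  generalize (toLoc (diffN b) : L) = Nb at *
  generalize (toLoc (diffA a) : L) = ya at *
  generalize (toLoc (diffA b) : L) = yb at *
  generalize (toLoc (diffB a) : L) = xa at *
  generalize (toLoc (diffB b) : L) = xb at *
  linear_combination k ^ 2 * (la * lb) ^ 2 * hT - T * hX2 +
    k ^ 2 * (Na * Nb * (1 - ya * xb) * (1 - yb * xa) - 1) * hXX

theorem toLoc_corrSeries (M : Submonoid (MvPowerSeries σ DiffPoly)) [IsLocalization M L]
    {Ω : ℕ → ℕ → DiffPoly} {S : ℕ → DiffPoly} (h : IsCanonicalTauStructure Ω S)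
    (hlam : ∀ i, toLoc (MvPowerSeries.X i) * lam i = 1)
    (hκ : ∀ i j, i ≠ j → κ i j * (lam i - lam j) = 1) (l : List σ) (a b : σ)
    (hl : (l ++ [a, b]).Nodup) :
    toLoc (corrSeries todaD Ω l a b) =
      (-1) ^ (l.length + 1) * cycleSum (diffKernel κ) (l ++ [a]) b -
        if l = [] then κ a b ^ 2 else 0 := by
  induction l with
  | nil =>
    have hab : a ≠ b := by simpa using hl
    change toLoc (tauSeries Ω a b) = _
    rw [toLoc_tauSeries h hlam hκ hab]
    simp [cycleSum, pathProd]
  | cons m l ih =>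
    rw [List.cons_append, List.nodup_cons] at hl
    obtain ⟨δ, hδ⟩ := exists_derivation_localization (L := L) M
      (⟨⟨genDer todaD m, map_zero _⟩, map_add _⟩ :
        MvPowerSeries σ DiffPoly →+ MvPowerSeries σ DiffPoly)
      (fun F G => (genDer todaD m).leibniz F G)
    have hδ' : ∀ F, δ (toLoc F) = toLoc (genDer todaD m F) := hδ
    change toLoc (genDer todaD m (corrSeries todaD Ω l a b)) = _
    rw [← hδ', ih hl.2]
    have hδlam : ∀ i, δ (lam i) = 0 := fun i => by
      have h := congrArg δ (hlam i)
      rw [Derivation.leibniz, hδ', genDer_todaD_X, map_zero, smul_zero, add_zero,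
        Derivation.map_one_eq_zero, smul_eq_mul] at h
      linear_combination lam i * h - δ (lam i) * hlam i
    -- The correction involves spectral parameters only, so the first further derivative removes it;
    -- it survives for k = 2 alone.
    have hδκ : δ (if l = [] then κ a b ^ 2 else 0) = 0 := by
      split_ifs with hnil
      · have hab : a ≠ b := by simpa [hnil] using hl.2
        have h := congrArg δ (hκ a b hab)
        rw [Derivation.leibniz, map_sub, hδlam, hδlam, sub_zero, smul_zero, zero_add,
          Derivation.map_one_eq_zero, smul_eq_mul] at h
        have h0 : δ (κ a b) = 0 := by linear_combination κ a b * h - δ (κ a b) * hκ a b hab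
        rw [Derivation.leibniz_pow, h0]
        simp
      · exact map_zero δ
    have hperm : (l ++ [a, b]).Perm (b :: (l ++ [a])) := by
      rw [show l ++ [a, b] = (l ++ [a]) ++ [b] by simp]
      exact List.perm_append_singleton b (l ++ [a])
    have hcyc := derivation_cycleSum (diffKernel κ) δ m
      (fun i j hij hmi hmj => derivation_diffKernel hlam hκ hδ' hij hmi hmj) b (l ++ [a])
      (hperm.nodup_iff.mp hl.2) (fun hmem => hl.1 (hperm.mem_iff.mpr hmem)) (by simp)
    have hsign : δ ((-1) ^ (l.length + 1)) = 0 := by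
      rw [Derivation.leibniz_pow, map_neg, Derivation.map_one_eq_zero]
      simp
    rw [map_sub, hδκ, Derivation.leibniz, hcyc, hsign, if_neg (by simp), List.length_cons,
      List.cons_append]
    simp only [smul_eq_mul]
    ring

end Correlators

/-! ### Sums over `S_k / C_k` as sums over closed paths -/

section CyclicSums

/-- Extend a permutation of the first `n` indices by fixing the last one. -/
def extendLast {n : ℕ} (ρ : Equiv.Perm (Fin n)) : Equiv.Perm (Fin (n + 1)) :=
  (finSuccEquivLast.trans (Equiv.optionCongr ρ)).trans finSuccEquivLast.symm

@[simp] theorem extendLast_castSucc {n : ℕ} (ρ : Equiv.Perm (Fin n)) (j : Fin n) :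
    extendLast ρ j.castSucc = (ρ j).castSucc := by
  simp [extendLast]

@[simp] theorem extendLast_last {n : ℕ} (ρ : Equiv.Perm (Fin n)) :
    extendLast ρ (Fin.last n) = Fin.last n := by
  simp [extendLast]

theorem extendLast_injective {n : ℕ} :
    Function.Injective (extendLast : Equiv.Perm (Fin n) → _) := by
  intro ρ ρ' h
  ext j
  have := congrArg (fun π : Equiv.Perm (Fin (n + 1)) => π j.castSucc) h
  simpa using congrArg Fin.val this

theorem exists_extendLast_eq {n : ℕ} {π : Equiv.Perm (Fin (n + 1))}
    (h : π (Fin.last n) = Fin.last n) : ∃ ρ, extendLast ρ = π := by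
  have hlt : ∀ j : Fin n, π j.castSucc ≠ Fin.last n := fun j hj =>
    (Fin.castSucc_lt_last j).ne (π.injective (hj.trans h.symm))
  have hinj : Function.Injective fun j : Fin n => (π j.castSucc).castPred (hlt j) := by
    intro i j hij
    exact Fin.castSucc_injective n (π.injective (Fin.castPred_inj.mp hij))
  refine ⟨Equiv.ofBijective _ (Finite.injective_iff_bijective.mp hinj), ?_⟩
  ext j
  induction j using Fin.lastCases with
  | last => simp [h]
  | cast j => simp

theorem exists_finRotate_zpow_apply_eq {n : ℕ} (i j : Fin (n + 1)) :
    ∃ m : ℤ, (finRotate (n + 1) ^ m) i = j := by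
  have h0 : ∀ j : Fin (n + 1), ∃ m : ℤ, (finRotate (n + 1) ^ m) 0 = j := by
    intro j
    induction j using Fin.induction with
    | zero => exact ⟨0, rfl⟩
    | succ j ih =>
      obtain ⟨m, hm⟩ := ih
      refine ⟨1 + m, ?_⟩
      rw [zpow_add, zpow_one, Equiv.Perm.mul_apply, hm, finRotate_apply, Fin.coeSucc_eq_succ]
  obtain ⟨a, rfl⟩ := h0 i
  obtain ⟨b, rfl⟩ := h0 j
  exact ⟨b - a, by rw [← Equiv.Perm.mul_apply, ← zpow_add, sub_add_cancel]⟩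

/-- The rotations commute and act transitively, so one fixed point forces every point to be fixed.
-/
theorem finRotate_zpow_eq_one {n : ℕ} {m : ℤ} {i : Fin (n + 1)}
    (h : (finRotate (n + 1) ^ m) i = i) : finRotate (n + 1) ^ m = 1 := by
  apply Equiv.ext
  intro j
  obtain ⟨a, rfl⟩ := exists_finRotate_zpow_apply_eq i j
  rw [← Equiv.Perm.mul_apply, ← zpow_add, add_comm m a, zpow_add, Equiv.Perm.mul_apply, h]
  rfl

/-- Rotations act simply transitively on the positions, so every coset of C_{n+1} contains exactly
one permutation fixing the last index. Cyclic orders thus become closed paths based at that index.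
-/
theorem extendLast_bijective (n : ℕ) : Function.Bijective
    fun ρ : Equiv.Perm (Fin n) =>
      (QuotientGroup.mk (extendLast ρ) : Equiv.Perm (Fin (n + 1)) ⧸ cyclicGroup (n + 1)) := by
  constructor
  · intro ρ ρ' h
    obtain ⟨m, hm⟩ := Subgroup.mem_zpowers_iff.mp (QuotientGroup.eq.mp h)
    have h1 : (finRotate (n + 1) ^ m) (Fin.last n) = Fin.last n := by
      rw [hm, Equiv.Perm.mul_apply, extendLast_last, Equiv.Perm.inv_eq_iff_eq, extendLast_last]
    rw [finRotate_zpow_eq_one h1] at hm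
    exact extendLast_injective (inv_mul_eq_one.mp hm.symm)
  · intro c
    obtain ⟨π, rfl⟩ := QuotientGroup.mk_surjective c
    obtain ⟨m, hm⟩ := exists_finRotate_zpow_apply_eq (Fin.last n) (π⁻¹ (Fin.last n))
    obtain ⟨ρ, hρ⟩ := exists_extendLast_eq (π := π * finRotate (n + 1) ^ m) (by
      rw [Equiv.Perm.mul_apply, hm, ← Equiv.Perm.mul_apply, mul_inv_cancel]; rfl)
    refine ⟨ρ, ?_⟩
    change QuotientGroup.mk (extendLast ρ) = _
    rw [hρ, QuotientGroup.eq]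
    refine Subgroup.mem_zpowers_iff.mpr ⟨-m, ?_⟩
    rw [zpow_neg]
    group

theorem pathProd_ofFn {α R : Type*} [CommRing R] (F : α → α → R) {n : ℕ} (a : α)
    (q : Fin (n + 1) → α) :
    pathProd F a (List.ofFn fun j : Fin n => q j.castSucc) (q (Fin.last n)) =
      F a (q 0) * ∏ j : Fin n, F (q j.castSucc) (q j.succ) := by
  induction n generalizing a with
  | zero => simp [pathProd]
  | succ n ih =>
    rw [List.ofFn_succ, pathProd, Fin.prod_univ_succ]
    have h := ih (q 0) (fun j => q j.succ)
    simp only [Fin.succ_last, Fin.succ_castSucc] at h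
    rw [Fin.castSucc_zero, h]

theorem cyclicProd_extendLast {R : Type*} [CommRing R] {n : ℕ}
    (F : Fin (n + 1) → Fin (n + 1) → R) (ρ : Equiv.Perm (Fin n)) :
    cyclicProd F (QuotientGroup.mk (extendLast ρ)) =
      pathProd F (Fin.last n) ((List.ofFn ρ).map Fin.castSucc) (Fin.last n) := by
  have h := pathProd_ofFn F (Fin.last n) (extendLast ρ)
  simp only [extendLast_castSucc, extendLast_last] at h
  rw [List.map_ofFn]
  change ∏ j, F (extendLast ρ j) (extendLast ρ (finRotate (n + 1) j)) = _
  refine Eq.trans ?_ h.symm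
  rw [Fin.prod_univ_castSucc, mul_comm]
  simp [Fin.coeSucc_eq_succ]

theorem ofFn_perm_permutations' (n : ℕ) :
    ((Finset.univ : Finset (Equiv.Perm (Fin n))).toList.map
      fun ρ : Equiv.Perm (Fin n) => List.ofFn ρ).Perm
      (List.finRange n).permutations' := by
  have hinj : Function.Injective fun ρ : Equiv.Perm (Fin n) => List.ofFn ρ := fun ρ ρ' h =>
    Equiv.ext fun i => congrFun (List.ofFn_injective h) i
  rw [List.perm_ext_iff_of_nodup ((Finset.nodup_toList _).map hinj)
    ((List.permutations_perm_permutations' _).nodup_iff.mp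
      (List.nodup_permutations _ (List.nodup_finRange n)))]
  intro l
  rw [List.mem_permutations', List.mem_map]
  constructor
  · rintro ⟨ρ, -, rfl⟩
    have := Equiv.Perm.ofFn_comp_perm ρ (id : Fin n → Fin n)
    rwa [List.ofFn_id] at this
  · intro h
    have hlen : l.length = n := by simpa using h.length_eq
    obtain ⟨q, rfl⟩ : ∃ q : Fin n → Fin n, List.ofFn q = l :=
      ⟨fun j => l.get (j.cast hlen.symm), List.ext_getElem (by simp [hlen]) (by simp)⟩
    have hnd : (List.ofFn q).Nodup := h.nodup_iff.mpr (List.nodup_finRange _)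
    exact ⟨Equiv.ofBijective q
      (Finite.injective_iff_bijective.mp (List.nodup_ofFn.mp hnd)), by simp, rfl⟩

theorem cyclicSum_eq_cycleSum {R : Type*} [CommRing R] {n : ℕ}
    (F : Fin (n + 1) → Fin (n + 1) → R) :
    cyclicSum F = cycleSum F ((List.finRange n).map Fin.castSucc) (Fin.last n) := by
  classical
  rw [cyclicSum, cycleSum, ← List.map_permutations', List.map_map]
  rw [← ((ofFn_perm_permutations' n).map _).sum_eq, List.map_map, Finset.sum_map_toList]
  rw [← Function.Bijective.sum_comp (extendLast_bijective n)]
  exact Finset.sum_congr rfl fun ρ _ => cyclicProd_extendLast F ρ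

theorem map_cyclicSum {R S : Type*} [CommRing R] [CommRing S] (φ : R →+* S) {k : ℕ}
    (F : Fin k → Fin k → R) : φ (cyclicSum F) = cyclicSum fun i j => φ (F i j) := by
  rw [cyclicSum, cyclicSum, map_sum]
  refine Finset.sum_congr rfl fun c _ => ?_
  obtain ⟨π, rfl⟩ := QuotientGroup.mk_surjective c
  exact map_prod φ _ _

/-- Every index occurs once as a source and once as a target, so each cyclic product acquires the
same factor ∏ p_j q_j. For k ≥ 2 consecutive indices differ, and agreement off the diagonal
suffices. -/
theorem cyclicSum_congr {R : Type*} [CommRing R] {k : ℕ} (c : R) (p q : Fin k → R)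
    (F G : Fin k → Fin k → R) (h : ∀ i j, i ≠ j → G i j = p i * q j * F i j)
    (hc : c * ∏ j, (p j * q j) = 1) (hk : 2 ≤ k) : c * cyclicSum G = cyclicSum F := by
  rw [cyclicSum, cyclicSum, Finset.mul_sum]
  refine Finset.sum_congr rfl fun x _ => ?_
  obtain ⟨π, rfl⟩ := QuotientGroup.mk_surjective x
  change c * ∏ j, G (π j) (π (finRotate k j)) = ∏ j, F (π j) (π (finRotate k j))
  obtain ⟨n, rfl⟩ := Nat.exists_eq_add_of_le' hk
  have hne : ∀ j, π j ≠ π (finRotate (n + 2) j) := fun j hj => by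
    have := π.injective hj
    rw [finRotate_apply] at this
    simp at this
  rw [Finset.prod_congr rfl fun j _ => h _ _ (hne j), Finset.prod_mul_distrib,
    Finset.prod_mul_distrib, Equiv.prod_comp π p,
    show ∏ j, q (π (finRotate (n + 2) j)) = ∏ j, q j from
      Equiv.prod_comp ((finRotate (n + 2)).trans π) q, ← Finset.prod_mul_distrib, ← mul_assoc, hc,
    one_mul]

end CyclicSums

/-! ### Ratios of the wave functions -/

section Waves

variable {W : Type*} [CommRing W]

theorem mapLaurent_coe (Λ : RingAut W) (m : ℤ) (φ : PowerSeries W) :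
    mapLaurent (Λ ^ m) (φ : W⸨X⸩) = (shiftSeries Λ m φ : W⸨X⸩) := by
  ext n
  change (Λ ^ m) ((φ : W⸨X⸩).coeff n) = _
  rw [PowerSeries.coeff_coe, PowerSeries.coeff_coe]
  split_ifs
  · simp
  · rw [coeff_shiftSeries]

theorem lamPow_mul_lamPow (m n : ℤ) : (lamPow m * lamPow n : W⸨X⸩) = lamPow (m + n) := by
  rw [lamPow, lamPow, lamPow, HahnSeries.single_mul_single, neg_add, one_mul]

theorem lamPow_zero : (lamPow 0 : W⸨X⸩) = 1 := by
  rw [lamPow, neg_zero]; rfl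

theorem lamPow_neg_one : (lamPow (-1) : W⸨X⸩) = ((PowerSeries.X : PowerSeries W) : W⸨X⸩) := by
  rw [lamPow, neg_neg, PowerSeries.coe_X]

theorem shiftWave_C_mul_T (Λ : RingAut W) (m : ℤ) (a : W⸨X⸩) :
    shiftWave Λ m (LaurentPolynomial.C a * LaurentPolynomial.T 1) =
      LaurentPolynomial.C (mapLaurent (Λ ^ m) a * lamPow m) * LaurentPolynomial.T 1 := by
  rw [shiftWave, LaurentPolynomial.eval₂_C_mul_T, zpow_one, map_mul, mul_assoc]
  rfl

theorem shiftWave_C_mul_T_neg (Λ : RingAut W) (m : ℤ) (a : W⸨X⸩) :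
    shiftWave Λ m (LaurentPolynomial.C a * LaurentPolynomial.T (-1)) =
      LaurentPolynomial.C (mapLaurent (Λ ^ m) a * lamPow (-m)) * LaurentPolynomial.T (-1) := by
  rw [shiftWave, LaurentPolynomial.eval₂_C_mul_T, zpow_neg_one, map_mul, mul_assoc]
  rfl

theorem T_mul_cancel {R : Type*} [CommRing R] {a b : R} {m : ℤ}
    (h : LaurentPolynomial.C a * LaurentPolynomial.T m =
      LaurentPolynomial.C b * LaurentPolynomial.T m) : a = b := by
  have h' := congrArg (fun p : R[T;T⁻¹] => p.coeff 0)
    ((LaurentPolynomial.isUnit_T m).mul_right_cancel h)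
  simpa using h'

theorem coe_powerSeries_injective :
    Function.Injective fun φ : PowerSeries W => (φ : W⸨X⸩) :=
  HahnSeries.ofPowerSeries_injective

theorem isUnit_of_constantCoeff_eq_one {φ : PowerSeries W}
    (h : PowerSeries.constantCoeff φ = 1) : IsUnit φ := by
  rw [PowerSeries.isUnit_iff_constantCoeff, h]
  exact isUnit_one

theorem isUnit_shiftSeries (Λ : RingAut W) (m : ℤ) {φ : PowerSeries W} (h : IsUnit φ) :
    IsUnit (shiftSeries Λ m φ) := h.map _

/-- `ψ_A(n-1) = y ψ_A(n)`. -/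
theorem IsWaveA.shift_eq {Λ : RingAut W} {f g : W} {ψ : W⸨X⸩[T;T⁻¹]} (h : IsWaveA Λ f g ψ) :
    shiftWave Λ (-1) ψ = LaurentPolynomial.C ((ratioA Λ f g : PowerSeries W) : W⸨X⸩) * ψ := by
  obtain ⟨⟨φ, hφ, rfl⟩, hL⟩ := h
  obtain ⟨a, hinv⟩ := (isUnit_of_constantCoeff_eq_one hφ).exists_left_inv
  rw [laxApply, shiftWave_C_mul_T, shiftWave_C_mul_T, mapLaurent_coe, mapLaurent_coe, constWave,
    RingHom.comp_apply, RingHom.comp_apply, ← mul_assoc, ← mul_assoc, ← map_mul, ← map_mul,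
    ← add_mul, ← add_mul, ← map_add, ← map_add, lamWave,
    ← mul_assoc (LaurentPolynomial.C (lamPow 1)), ← map_mul] at hL
  have h1 := T_mul_cancel hL
  have hlam : (lamPow 1 : W⸨X⸩) * ((PowerSeries.X : PowerSeries W) : W⸨X⸩) = 1 := by
    rw [← lamPow_neg_one, lamPow_mul_lamPow, add_neg_cancel, lamPow_zero]
  -- The wave equation for the series φ in ψ_A = φ λ^n, after multiplication by λ⁻¹ and removal of
  -- λ^n.
  have h2 : shiftSeries Λ 1 φ + PowerSeries.X * PowerSeries.C f * φ +
      PowerSeries.X ^ 2 * PowerSeries.C g * shiftSeries Λ (-1) φ = φ := by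
    apply coe_powerSeries_injective
    simp only [PowerSeries.coe_add, PowerSeries.coe_mul, PowerSeries.coe_C, pow_two]
    rw [lamPow_neg_one] at h1
    linear_combination ((PowerSeries.X : PowerSeries W) : W⸨X⸩) * h1 +
      ((φ : W⸨X⸩) - (shiftSeries Λ 1 φ : W⸨X⸩)) * hlam
  -- Here `a` is φ⁻¹, and the factor X comes from λ^{n-1}/λ^n. The wave equation divided by φ is the
  -- Riccati equation.
  have hy : PowerSeries.X * shiftSeries Λ (-1) φ * a = ratioA Λ f g := by
    apply ratioA_unique
    have hinv' := congrArg (shiftSeries Λ 1) hinv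
    simp only [map_mul, map_one, shiftSeries_shiftSeries, add_neg_cancel, shiftSeries_zero,
      shiftSeries_X] at hinv' ⊢
    set a' := shiftSeries Λ 1 a
    linear_combination (-PowerSeries.X * a') * h2 + PowerSeries.X * hinv' -
      (PowerSeries.X ^ 3 * PowerSeries.C g * shiftSeries Λ (-1) φ * a') * hinv
  rw [shiftWave_C_mul_T, mapLaurent_coe, ← mul_assoc, ← map_mul, lamPow_neg_one,
    ← PowerSeries.coe_mul, ← PowerSeries.coe_mul, ← hy]
  congr 3
  linear_combination (-PowerSeries.X * shiftSeries Λ (-1) φ) * hinv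

/-- `ψ_B(n) = x ψ_B(n-1)`. -/
theorem IsWaveB.eq_shift {Λ : RingAut W} {f g : W} {E : Wˣ} (hE : IsExpS Λ g E)
    {ψ : W⸨X⸩[T;T⁻¹]} (h : IsWaveB Λ f g E ψ) :
    ψ = LaurentPolynomial.C ((ratioB Λ f g : PowerSeries W) : W⸨X⸩) * shiftWave Λ (-1) ψ := by
  obtain ⟨⟨χ, hχ, rfl⟩, hL⟩ := h
  have hunit := isUnit_of_constantCoeff_eq_one hχ
  have hψ : LaurentPolynomial.C (χ : W⸨X⸩) * constWave ((E⁻¹ : Wˣ) : W) *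
      LaurentPolynomial.T (-1) = LaurentPolynomial.C
        ((χ * PowerSeries.C ((E⁻¹ : Wˣ) : W) : PowerSeries W) : W⸨X⸩) *
        LaurentPolynomial.T (-1) := by
    rw [PowerSeries.coe_mul, PowerSeries.coe_C, map_mul]
    rfl
  rw [hψ] at hL ⊢
  rw [laxApply, shiftWave_C_mul_T_neg, shiftWave_C_mul_T_neg, mapLaurent_coe, mapLaurent_coe,
    constWave, RingHom.comp_apply, RingHom.comp_apply, ← mul_assoc, ← mul_assoc, ← map_mul,
    ← map_mul, ← add_mul, ← add_mul, ← map_add, ← map_add, lamWave,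
    ← mul_assoc (LaurentPolynomial.C (lamPow 1)), ← map_mul] at hL
  have h1 := T_mul_cancel hL
  have hlam : (lamPow 1 : W⸨X⸩) * ((PowerSeries.X : PowerSeries W) : W⸨X⸩) = 1 := by
    rw [← lamPow_neg_one, lamPow_mul_lamPow, add_neg_cancel, lamPow_zero]
  set e : W := ((E⁻¹ : Wˣ) : W) with he
  have heE : (E : W) * e = 1 := E.mul_inv
  -- With e = e^{-s(n)}, this is the defining relation of s, in the form e^{-s(n)}/e^{-s(n-1)} =
  -- g(n).
  have hge : g * (Λ ^ (-1 : ℤ)) e = e := by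
    have h2 := congrArg (Λ ^ (-1 : ℤ)) heE
    rw [map_mul, map_one] at h2
    rw [← hE]
    rw [← he, ← zpow_neg_one]
    linear_combination e * h2
  have hge' : (Λ ^ (1 : ℤ)) g * e = (Λ ^ (1 : ℤ)) e := by
    have h2 := congrArg (Λ ^ (1 : ℤ)) hge
    rw [map_mul, ← RingAut.mul_apply, ← zpow_add, add_neg_cancel, zpow_zero] at h2
    exact h2
  have h2 : PowerSeries.X ^ 2 * PowerSeries.C ((Λ ^ (1 : ℤ)) g) * shiftSeries Λ 1 χ +
      PowerSeries.X * PowerSeries.C f * χ + shiftSeries Λ (-1) χ = χ := by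
    have h3 : PowerSeries.C e * (PowerSeries.X ^ 2 * PowerSeries.C ((Λ ^ (1 : ℤ)) g) *
        shiftSeries Λ 1 χ +
        PowerSeries.X * PowerSeries.C f * χ + shiftSeries Λ (-1) χ) = PowerSeries.C e * χ := by
      have c1 : (PowerSeries.C g * PowerSeries.C ((Λ ^ (-1 : ℤ)) e) : PowerSeries W) =
          PowerSeries.C e := by rw [← map_mul, hge]
      have c2 : (PowerSeries.C ((Λ ^ (1 : ℤ)) g) * PowerSeries.C e : PowerSeries W) =
          PowerSeries.C ((Λ ^ (1 : ℤ)) e) := by rw [← map_mul, hge']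
      apply coe_powerSeries_injective
      have c1' := congrArg (fun φ : PowerSeries W => (φ : W⸨X⸩)) c1
      have c2' := congrArg (fun φ : PowerSeries W => (φ : W⸨X⸩)) c2
      simp only [map_mul, shiftSeries_C] at h1
      simp only [PowerSeries.coe_add, PowerSeries.coe_mul, PowerSeries.coe_C, pow_two] at *
      rw [lamPow_neg_one, neg_neg] at h1
      linear_combination ((PowerSeries.X : PowerSeries W) : W⸨X⸩) * h1 +
        (HahnSeries.C e * (χ : W⸨X⸩) - HahnSeries.C e * (shiftSeries Λ (-1) χ : W⸨X⸩)) * hlam +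
        ((PowerSeries.X : PowerSeries W) : W⸨X⸩) ^ 2 * (shiftSeries Λ 1 χ : W⸨X⸩) * c2' -
        (lamPow 1 : W⸨X⸩) * ((PowerSeries.X : PowerSeries W) : W⸨X⸩) *
          (shiftSeries Λ (-1) χ : W⸨X⸩) * c1'
    have hCe : IsUnit (PowerSeries.C e : PowerSeries W) := (Units.isUnit _).map PowerSeries.C
    exact hCe.mul_left_cancel h3
  obtain ⟨a, hinv⟩ := (isUnit_shiftSeries Λ (-1) hunit).exists_left_inv
  -- Here `a` is the inverse of Λ⁻¹χ; X is λ^{-n}/λ^{-(n-1)} and g is the ratio of the exponential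
  -- factors.
  have hx : PowerSeries.X * PowerSeries.C g * χ * a = ratioB Λ f g := by
    apply ratioB_unique
    have hinv' := congrArg (shiftSeries Λ 1) hinv
    simp only [map_mul, map_one, shiftSeries_shiftSeries, add_neg_cancel, shiftSeries_zero,
      shiftSeries_X, shiftSeries_C] at hinv' ⊢
    set a' := shiftSeries Λ 1 a
    linear_combination (-PowerSeries.X * PowerSeries.C g * a) * h2 +
      PowerSeries.X * PowerSeries.C g * hinv -
      (PowerSeries.X ^ 3 * PowerSeries.C g * PowerSeries.C ((Λ ^ (1 : ℤ)) g) *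
        shiftSeries Λ 1 χ * a) * hinv'
  rw [shiftWave_C_mul_T_neg, mapLaurent_coe, ← mul_assoc, ← map_mul, neg_neg, ← hx]
  congr 2
  rw [map_mul (shiftSeries Λ (-1)), shiftSeries_C]
  simp only [PowerSeries.coe_mul]
  have hinv₂ : (a : W⸨X⸩) *
      (shiftSeries Λ (-1) χ : W⸨X⸩) = 1 := by
    rw [← PowerSeries.coe_mul, hinv, PowerSeries.coe_one]
  have c1 : ((PowerSeries.C g : PowerSeries W) : W⸨X⸩) *
      ((PowerSeries.C ((Λ ^ (-1 : ℤ)) e) : PowerSeries W) : W⸨X⸩) =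
      ((PowerSeries.C e : PowerSeries W) : W⸨X⸩) := by
    rw [← PowerSeries.coe_mul, ← map_mul, hge]
  rw [← c1]
  set G := ((PowerSeries.C g : PowerSeries W) : W⸨X⸩)
  set e' := ((PowerSeries.C ((Λ ^ (-1 : ℤ)) e) : PowerSeries W) : W⸨X⸩)
  linear_combination (-(χ : W⸨X⸩) * G * e') * hlam - ((χ : W⸨X⸩) * G * e' * lamPow 1 *
    ((PowerSeries.X : PowerSeries W) : W⸨X⸩)) * hinv₂

end Waves

/-! ### Evaluation along a solution -/

section Solution

variable {W : Type*} [CommRing W]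

/-- The substitution `v_i ↦ f(n+i)`, `w_i ↦ g(n+i)`. -/
def substInit (Λ : RingAut W) (f g : W) : DiffPoly →+* W :=
  (MvPolynomial.aeval (Sum.elim (fun i => (Λ ^ i) f) (fun i => (Λ ^ i) g)) :
    DiffPoly →ₐ[ℤ] W).toRingHom

theorem substInit_shift (Λ : RingAut W) (f g : W) (P : DiffPoly) :
    substInit Λ f g (shiftAut P) = Λ (substInit Λ f g P) := by
  have h : (substInit Λ f g).comp (shiftAut : DiffPoly →+* DiffPoly) =
      (Λ : W →+* W).comp (substInit Λ f g) := by
    apply MvPolynomial.ringHom_ext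
    · intro c
      simp
    · intro i
      rcases i with i | i
      · have : shiftAut (MvPolynomial.X (Sum.inl i)) = vGen (i + 1) := shiftPoly_vGen 1 i
        simp [substInit, this, vGen, add_comm i, zpow_add, RingAut.mul_apply]
      · have : shiftAut (MvPolynomial.X (Sum.inr i)) = wGen (i + 1) := shiftPoly_wGen 1 i
        simp [substInit, this, wGen, add_comm i, zpow_add, RingAut.mul_apply]
  exact congrArg (fun φ : DiffPoly →+* W => φ P) h

theorem substInit_vGen (Λ : RingAut W) (f g : W) : substInit Λ f g (vGen 0) = f := by
  simp [substInit, vGen]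

theorem substInit_wGen (Λ : RingAut W) (f g : W) : substInit Λ f g (wGen 0) = g := by
  simp [substInit, wGen]

theorem constantCoeff_substSol (Λ : RingAut W) (v w : MvPowerSeries ℕ W) (P : DiffPoly) :
    MvPowerSeries.constantCoeff (substSol Λ v w P) =
      substInit Λ (MvPowerSeries.constantCoeff v) (MvPowerSeries.constantCoeff w) P := by
  have h : (MvPowerSeries.constantCoeff (R := W)).comp (substSol Λ v w).toRingHom =
      substInit Λ (MvPowerSeries.constantCoeff v) (MvPowerSeries.constantCoeff w) := by
    apply MvPolynomial.ringHom_ext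
    · intro c
      simp
    · intro i
      rcases i with i | i <;> simp [substInit, substSol, shiftTime]
  exact congrArg (fun φ : DiffPoly →+* W => φ P) h

theorem pderiv_map {σ A B : Type*} [CommRing A] [CommRing B] (φ : A →+* B) (k : σ)
    (F : MvPowerSeries σ A) :
    pderiv B k (MvPowerSeries.map φ F) = MvPowerSeries.map φ (pderiv A k F) := by
  ext e
  simp [MvPowerSeries.coeff_pderiv]

theorem shiftTime_substSol (Λ : RingAut W) (v w : MvPowerSeries ℕ W) (m : ℤ) (P : DiffPoly) :
    shiftTime Λ m (substSol Λ v w P) = substSol Λ v w (shiftPoly m P) := by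
  have hs : ∀ (m n : ℤ) (F : MvPowerSeries ℕ W),
      shiftTime Λ m (shiftTime Λ n F) = shiftTime Λ (m + n) F := by
    intro m n F
    ext e
    simp [shiftTime, zpow_add, RingAut.mul_apply]
  have h : (shiftTime Λ m).comp (substSol Λ v w).toRingHom =
      (substSol Λ v w).toRingHom.comp (shiftPoly m).toRingHom := by
    apply MvPolynomial.ringHom_ext
    · intro c
      simp
    · intro i
      rcases i with i | i <;> simp [substSol, hs, shiftPoly, add_comm i]
  exact congrArg (fun φ : DiffPoly →+* MvPowerSeries ℕ W => φ P) h

/-- Both sides are derivations along the substitution. They agree on v_0 and w_0 because (v, w) is a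
solution, and on the other generators because everything commutes with the shift. -/
theorem IsTodaSolution.pderiv_substSol {Λ : RingAut W} {v w : MvPowerSeries ℕ W}
    (h : IsTodaSolution Λ v w) (k : ℕ) (P : DiffPoly) :
    pderiv W k (substSol Λ v w P) = substSol Λ v w (todaD k P) := by
  induction P using MvPolynomial.induction_on with
  | C c => simp
  | add a b ha hb => simp [ha, hb]
  | mul_X a i ha =>
    have hX : pderiv W k (substSol Λ v w (MvPolynomial.X i)) =
        substSol Λ v w (todaD k (MvPolynomial.X i)) := by
      rcases i with i | i
      · have e : (MvPolynomial.X (Sum.inl i) : DiffPoly) = shiftPoly i (vGen 0) := by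
          rw [shiftPoly_vGen, zero_add]; rfl
        have e0 : substSol Λ v w (vGen 0) = v := by
          ext e
          simp [substSol, vGen, shiftTime]
        rw [e, todaD_shiftPoly, ← shiftTime_substSol, ← shiftTime_substSol, e0, ← (h k).1]
        exact pderiv_map _ k v
      · have e : (MvPolynomial.X (Sum.inr i) : DiffPoly) = shiftPoly i (wGen 0) := by
          rw [shiftPoly_wGen, zero_add]; rfl
        have e0 : substSol Λ v w (wGen 0) = w := by
          ext e
          simp [substSol, wGen, shiftTime]
        rw [e, todaD_shiftPoly, ← shiftTime_substSol, ← shiftTime_substSol, e0, ← (h k).2]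
        exact pderiv_map _ k w
    rw [map_mul, Derivation.leibniz, Derivation.leibniz, ha, hX]
    simp

theorem logDeriv_append {Λ : RingAut W} {v w : MvPowerSeries ℕ W} (h : IsTodaSolution Λ v w)
    {τ : (MvPowerSeries ℕ W)ˣ} {Ω : ℕ → ℕ → DiffPoly}
    (hΩ : ∀ p q, substSol Λ v w (Ω p q) = logDeriv τ [p, q]) (l : List ℕ) (p q : ℕ) :
    logDeriv τ (l ++ [p, q]) = substSol Λ v w (l.foldr (fun r P => todaD r P) (Ω p q)) := by
  induction l with
  | nil => exact (hΩ p q).symm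
  | cons r l ih =>
    rw [List.foldr_cons, ← h.pderiv_substSol, ← ih]
    cases l <;> rfl

end Solution

/-! ### Specialization of the universal identity -/

section Specialization

variable {W : Type*} [CommRing W]

theorem finRange_add_two (n : ℕ) : List.finRange (n + 2) =
    (List.finRange n).map (fun i => i.castSucc.castSucc) ++
      [(Fin.last n).castSucc, Fin.last (n + 1)] := by
  rw [List.finRange_succ_last, List.finRange_succ_last]
  simp [Function.comp_def]

/-- The last two times produce Ω and the earlier ones act on it by D_k. The factor ∏ X_j² accounts
for the requirement that all exponents be at least 2. -/
theorem genSeries_eq_map {Λ : RingAut W} {v w : MvPowerSeries ℕ W} (h : IsTodaSolution Λ v w)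
    {τ : (MvPowerSeries ℕ W)ˣ} {Ω : ℕ → ℕ → DiffPoly}
    (hΩ : ∀ p q, substSol Λ v w (Ω p q) = logDeriv τ [p, q]) (n : ℕ) :
    genSeries (n + 2) τ = MvPowerSeries.map
      (substInit Λ (MvPowerSeries.constantCoeff v) (MvPowerSeries.constantCoeff w))
      (corrSeries todaD Ω ((List.finRange n).map fun i => i.castSucc.castSucc)
        (Fin.last n).castSucc (Fin.last (n + 1))) := by
  classical
  ext e
  have hnd : ((List.finRange n).map (fun i => i.castSucc.castSucc) ++
      [(Fin.last n).castSucc, Fin.last (n + 1)]).Nodup := by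
    rw [← finRange_add_two]; exact List.nodup_finRange _
  rw [MvPowerSeries.coeff_map]
  have hc := coeff_corrSeries todaD Ω _ _ _ hnd e
  refine Eq.trans ?_ (congrArg _ hc.symm)
  rw [← finRange_add_two]
  have hexp : HasExponents (List.finRange (n + 2)) e ↔ ∀ j, 2 ≤ e j := by
    simp [HasExponents]
  have hX : (∏ j : Fin (n + 2), (MvPowerSeries.X j : MvPowerSeries (Fin (n + 2)) W) ^ 2) =
      MvPowerSeries.monomial (∑ j, Finsupp.single j 2) 1 := by
    simp only [MvPowerSeries.X_pow_eq]
    rw [MvPowerSeries.prod_monomial]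
    simp
  have hle : (∑ j : Fin (n + 2), Finsupp.single j 2) ≤ e ↔ ∀ j, 2 ≤ e j := by
    rw [Finsupp.le_def]
    simp [Finsupp.finsetSum_apply, Finsupp.single_apply]
  obtain ⟨a, ha, hgen⟩ : ∃ a : MvPowerSeries (Fin (n + 2)) W,
      (∀ d, MvPowerSeries.coeff d a =
        MvPowerSeries.constantCoeff (logDeriv τ (List.ofFn fun j => d j))) ∧
      genSeries (n + 2) τ = (∏ j, MvPowerSeries.X j ^ 2) * a := ⟨_, fun _ => rfl, rfl⟩
  rw [hgen, hX, MvPowerSeries.coeff_monomial_mul]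
  simp only [hle, hexp, one_mul, ha]
  split_ifs with h2
  · have hlist : (List.ofFn fun j =>
        (e - ∑ j : Fin (n + 2), Finsupp.single j 2 : Fin (n + 2) →₀ ℕ) j) =
        ((List.finRange n).map fun i => e i.castSucc.castSucc - 2) ++
          [e (Fin.last n).castSucc - 2, e (Fin.last (n + 1)) - 2] := by
      have h1 : (fun j => (e - ∑ j : Fin (n + 2), Finsupp.single j 2 : Fin (n + 2) →₀ ℕ) j) =
          fun j => e j - 2 := by
        funext j
        simp [Finsupp.single_apply]
      rw [h1, List.ofFn_eq_map, finRange_add_two]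
      simp [Function.comp_def]
    rw [hlist, logDeriv_append h hΩ, constantCoeff_substSol, List.foldr_map, List.foldr_map]
    rfl
  · simp

theorem specDenoms_le_comap {A : Type*} [CommRing A] (φ : A →+* W) (k : ℕ) :
    specDenoms A k ≤ (specDenoms W k).comap (MvPowerSeries.map φ) := by
  rw [specDenoms, Submonoid.closure_le]
  rintro a (⟨i, rfl⟩ | ⟨i, j, hij, rfl⟩)
  · exact Submonoid.subset_closure (Or.inl ⟨i, by simp⟩)
  · exact Submonoid.subset_closure (Or.inr ⟨i, j, hij, by simp⟩)

/-- The change of coefficients in `SpecRing`. -/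
def specMap {A : Type*} [CommRing A] (φ : A →+* W) (k : ℕ) : SpecRing A k →+* SpecRing W k :=
  IsLocalization.map (SpecRing W k) (MvPowerSeries.map φ) (specDenoms_le_comap φ k)

theorem specMap_algebraMap {A : Type*} [CommRing A] (φ : A →+* W) {k : ℕ}
    (F : MvPowerSeries (Fin k) A) :
    specMap φ k (algebraMap _ _ F) = algebraMap _ _ (MvPowerSeries.map φ F) :=
  IsLocalization.map_eq _ _

theorem specX_mul_specLam {k : ℕ} (i : Fin k) :
    algebraMap (MvPowerSeries (Fin k) W) (SpecRing W k) (MvPowerSeries.X i) * specLam i = 1 :=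
  (isUnit_specX i).mul_val_inv

theorem specDiffInv_mul {k : ℕ} {i j : Fin k} (hij : i ≠ j) :
    specDiffInv i j * (specLam i - specLam j : SpecRing W k) = 1 :=
  Ring.inverse_mul_cancel _ (isUnit_specLam_sub hij)

theorem specMap_specLam {A : Type*} [CommRing A] (φ : A →+* W) {k : ℕ} (i : Fin k) :
    specMap φ k (specLam i) = specLam i := by
  have h := congrArg (specMap φ k) (specX_mul_specLam i)
  rw [map_mul, specMap_algebraMap, MvPowerSeries.map_X, map_one] at h
  linear_combination specLam i * h - specMap φ k (specLam i) * specX_mul_specLam (W := W) i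

theorem specMap_specDiffInv {A : Type*} [CommRing A] (φ : A →+* W) {k : ℕ} {i j : Fin k}
    (hij : i ≠ j) : specMap φ k (specDiffInv i j) = specDiffInv i j := by
  have h := congrArg (specMap φ k) (specDiffInv_mul hij)
  rw [map_mul, map_sub, specMap_specLam, specMap_specLam, map_one] at h
  linear_combination specDiffInv i j * h -
    specMap φ k (specDiffInv i j) * specDiffInv_mul (W := W) hij

/-- The kernel `N(λ_i) (1 - y(λ_i) x(λ_j)) / (λ_i - λ_j)`. -/
def ratioKernel (Λ : RingAut W) (f g : W) {k : ℕ} (i j : Fin k) : SpecRing W k :=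
  algebraMap _ _ (substVar i (ratioN Λ f g) *
    (1 - substVar i (ratioA Λ f g) * substVar j (ratioB Λ f g))) * specDiffInv i j

theorem specMap_diffKernel (Λ : RingAut W) (f g : W) {k : ℕ} {i j : Fin k} (hij : i ≠ j) :
    specMap (substInit Λ f g) k (diffKernel specDiffInv i j) = ratioKernel Λ f g i j := by
  have hA : MvPowerSeries.map (substInit Λ f g) (diffA i) = substVar i (ratioA Λ f g) := by
    rw [diffA, map_substVar, map_ratioA _ _ _ (substInit_shift Λ f g), substInit_vGen,
      substInit_wGen]
  have hB : MvPowerSeries.map (substInit Λ f g) (diffB j) = substVar j (ratioB Λ f g) := by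
    rw [diffB, map_substVar, map_ratioB _ _ _ (substInit_shift Λ f g), substInit_vGen,
      substInit_wGen]
  have hN : MvPowerSeries.map (substInit Λ f g) (diffN i) = substVar i (ratioN Λ f g) := by
    rw [diffN, map_substVar, map_ratioN _ _ _ (substInit_shift Λ f g), substInit_vGen,
      substInit_wGen]
  rw [diffKernel, ratioKernel, map_mul, specMap_specDiffInv _ hij]
  congr 1
  rw [map_mul, map_sub, map_mul, map_one, toLoc, specMap_algebraMap, specMap_algebraMap,
    specMap_algebraMap, hA, hB, hN]
  simp only [map_mul, map_sub, map_one]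

end Specialization

/-! ### The kernel of the wave functions -/

section Kernel

variable {W : Type*} [CommRing W] {k : ℕ}

theorem evalLaurent_coe (i : Fin k) (φ : PowerSeries W) :
    evalLaurent i (φ : W⸨X⸩) =
      algebraMap (MvPowerSeries (Fin k) W) (SpecRing W k) (substVar i φ) :=
  IsLocalization.lift_eq (M := Submonoid.powers (PowerSeries.X : PowerSeries W)) _ φ

theorem evalWave_C (i : Fin k) (φ : PowerSeries W) :
    evalWave i (LaurentPolynomial.C (φ : W⸨X⸩)) = seriesWave (substVar i φ) := by
  rw [evalWave, LaurentPolynomial.eval₂_C, RingHom.comp_apply, evalLaurent_coe]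
  rfl

theorem evalWave_constWave (i : Fin k) (a : W) :
    evalWave i (constWave a) = seriesWave (MvPowerSeries.C a) := by
  rw [constWave, RingHom.comp_apply, ← PowerSeries.coe_C, evalWave_C, substVar_C]

theorem evalWave_lamWave (i : Fin k) :
    evalWave i (lamWave : W⸨X⸩[T;T⁻¹]) =
      algebraMap (SpecRing W k) (SpecWave W k) (specLam i) := by
  have h : (LaurentPolynomial.C ((PowerSeries.X : PowerSeries W) : W⸨X⸩)) * lamWave = 1 := by
    rw [lamWave, ← map_mul, ← lamPow_neg_one, lamPow_mul_lamPow, neg_add_cancel, lamPow_zero,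
      map_one]
  have h1 := congrArg (evalWave i) h
  rw [map_mul, evalWave_C, substVar_X, map_one] at h1
  have h2 := congrArg (algebraMap (SpecRing W k) (SpecWave W k)) (specX_mul_specLam (W := W) i)
  rw [map_mul, map_one] at h2
  rw [seriesWave, RingHom.comp_apply] at h1
  linear_combination algebraMap (SpecRing W k) (SpecWave W k) (specLam i) * h1 -
    evalWave i (lamWave : W⸨X⸩[T;T⁻¹]) * h2

variable {Λ : RingAut W} {f g : W} {E : Wˣ} {ψA ψB : W⸨X⸩[T;T⁻¹]}

/-- Substituting ψ_A(n-1) = y ψ_A(n) and ψ_B(n) = x ψ_B(n-1) leaves 1 - y_i x_j times ψ_A(λ_i,n)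
ψ_B(λ_j,n-1). The factor 1 - x_i y_i is put into p_i to compensate for N_i in the kernel. -/
theorem kernelD_eq (hE : IsExpS Λ g E) (hA : IsWaveA Λ f g ψA) (hB : IsWaveB Λ f g E ψB)
    (i j : Fin k) :
    kernelD Λ ψA ψB i j =
      (evalWave i ψA *
          seriesWave (substVar i (1 - ratioB Λ f g * ratioA Λ f g))) *
        evalWave j (shiftWave Λ (-1) ψB) *
        algebraMap (SpecRing W k) (SpecWave W k) (ratioKernel Λ f g i j) := by
  have hB' := congrArg (evalWave j) (hB.eq_shift hE)
  have hN := congrArg (fun φ => seriesWave (substVar i φ)) (ratioN_mul Λ f g)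
  rw [map_mul, evalWave_C] at hB'
  simp only [map_mul, map_one] at hN
  have hK : algebraMap (SpecRing W k) (SpecWave W k) (ratioKernel Λ f g i j) =
      seriesWave (substVar i (ratioN Λ f g) *
        (1 - substVar i (ratioA Λ f g) * substVar j (ratioB Λ f g))) *
        algebraMap (SpecRing W k) (SpecWave W k) (specDiffInv i j) := by
    rw [ratioKernel, map_mul]
    rfl
  rw [kernelD, hA.shift_eq, map_mul, evalWave_C, hB', hK]
  simp only [map_mul, map_sub, map_one] at hN ⊢
  linear_combination (-algebraMap (SpecRing W k) (SpecWave W k) (specDiffInv i j) *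
    evalWave i ψA * evalWave j (shiftWave Λ (-1) ψB) *
    (1 - seriesWave (substVar i (ratioA Λ f g)) * seriesWave (substVar j (ratioB Λ f g)))) * hN

/-- With the same substitutions the Casoratian is ψ_A(n) ψ_B(n-1) (1 - x y), which is p_i q_i for
the factors of `kernelD_eq`. -/
theorem IsPair.eval (hE : IsExpS Λ g E) (hA : IsWaveA Λ f g ψA) (hB : IsWaveB Λ f g E ψB)
    (hpair : IsPair Λ E ψA ψB) (i : Fin k) :
    seriesWave (MvPowerSeries.C ((Λ⁻¹ : RingAut W) (E : W))) *
      ((evalWave i ψA * seriesWave (substVar i (1 - ratioB Λ f g * ratioA Λ f g))) *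
        evalWave i (shiftWave Λ (-1) ψB)) =
      algebraMap (SpecRing W k) (SpecWave W k) (specLam i) := by
  have hB' := congrArg (evalWave i) (hB.eq_shift hE)
  rw [map_mul, evalWave_C] at hB'
  have h := congrArg (evalWave i) hpair
  rw [map_mul, map_sub, map_mul, map_mul, evalWave_constWave, evalWave_lamWave, hA.shift_eq,
    map_mul, evalWave_C, hB'] at h
  rw [← h]
  simp only [map_mul, map_sub, map_one]
  ring

theorem pow_mul_mul_prod_eq_one {R : Type*} [CommRing R] {e c : R} {a b : Fin k → R}
    (h : ∀ j, e * a j = b j) (hc : c * ∏ j, b j = 1) : e ^ k * c * ∏ j, a j = 1 := by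
  rw [← hc, ← Finset.prod_congr rfl fun j _ => h j, Finset.prod_mul_distrib, Finset.prod_const,
    Finset.card_univ, Fintype.card_fin]
  ring

theorem mul_cyclicSum_kernelD (hE : IsExpS Λ g E) (hA : IsWaveA Λ f g ψA)
    (hB : IsWaveB Λ f g E ψB) (hpair : IsPair Λ E ψA ψB) (hk : 2 ≤ k) :
    (seriesWave (MvPowerSeries.C ((Λ⁻¹ : RingAut W) (E : W) ^ k)) *
        algebraMap (SpecRing W k) (SpecWave W k) (Ring.inverse (∏ j, specLam j))) *
      cyclicSum (fun i j => kernelD Λ ψA ψB i j) =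
    algebraMap (SpecRing W k) (SpecWave W k)
      (cyclicSum fun i j : Fin k => ratioKernel Λ f g i j) := by
  have hmap : algebraMap (SpecRing W k) (SpecWave W k)
      (cyclicSum fun i j : Fin k => ratioKernel Λ f g i j) = cyclicSum fun i j : Fin k =>
        algebraMap (SpecRing W k) (SpecWave W k) (ratioKernel Λ f g i j) :=
    map_cyclicSum (R := SpecRing W k) (S := SpecWave W k) (algebraMap _ _) _
  rw [hmap]
  refine cyclicSum_congr _ _ _ _ _ (fun i j _ => kernelD_eq hE hA hB i j) ?_ hk
  have hu : IsUnit (∏ j, specLam j : SpecRing W k) := by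
    rw [IsUnit.prod_iff]
    exact fun j _ => Units.isUnit _
  have hinv := congrArg (algebraMap (SpecRing W k) (SpecWave W k)) (Ring.inverse_mul_cancel _ hu)
  rw [map_mul, map_one, map_prod] at hinv
  rw [map_pow, map_pow]
  exact pow_mul_mul_prod_eq_one (fun j => hpair.eval hE hA hB j) hinv

theorem map_signed_cyclicSum {R S : Type*} [CommRing R] [CommRing S] (φ : R →+* S) (m : ℕ)
    (F : Fin k → Fin k → R) (p : Prop) [Decidable p] (x : R) :
    φ ((-1) ^ m * cyclicSum F - if p then x ^ 2 else 0) =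
      (-1) ^ m * cyclicSum (fun i j => φ (F i j)) - if p then φ x ^ 2 else 0 := by
  rw [map_sub, map_mul, map_pow, map_neg, map_one, map_cyclicSum]
  split_ifs <;> simp

theorem algebraMap_genSeries {v w : MvPowerSeries ℕ W} (hsol : IsTodaSolution Λ v w)
    {τ : (MvPowerSeries ℕ W)ˣ} (hτ : IsTauFunction Λ v w τ) (n : ℕ) :
    algebraMap (MvPowerSeries (Fin (n + 2)) W) (SpecRing W (n + 2)) (genSeries (n + 2) τ) =
      (-1) ^ (n + 1) * cyclicSum (fun i j : Fin (n + 2) =>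
        ratioKernel Λ (MvPowerSeries.constantCoeff v) (MvPowerSeries.constantCoeff w) i j) -
      if n = 0 then specDiffInv (Fin.last n).castSucc (Fin.last (n + 1)) ^ 2 else 0 := by
  obtain ⟨Ω, S, hΩS, hΩ, -, -⟩ := hτ
  set φ := substInit Λ (MvPowerSeries.constantCoeff v) (MvPowerSeries.constantCoeff w) with hφ
  have hnd : ((List.finRange n).map (fun i => i.castSucc.castSucc) ++
      [(Fin.last n).castSucc, Fin.last (n + 1)]).Nodup := by
    rw [← finRange_add_two]; exact List.nodup_finRange _
  have huniv := toLoc_corrSeries (L := SpecRing DiffPoly (n + 2)) (lam := specLam)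
    (κ := specDiffInv) (specDenoms DiffPoly (n + 2)) hΩS specX_mul_specLam
    (fun _ _ => specDiffInv_mul) _ _ _ hnd
  have hl : (List.finRange n).map (fun i => i.castSucc.castSucc) ++ [(Fin.last n).castSucc] =
      (List.finRange (n + 1)).map Fin.castSucc := by
    rw [List.finRange_succ_last]
    simp [Function.comp_def]
  rw [hl, ← cyclicSum_eq_cycleSum] at huniv
  have hmap := congrArg (specMap φ (n + 2)) huniv
  rw [toLoc, specMap_algebraMap, ← genSeries_eq_map hsol hΩ, map_signed_cyclicSum,
    List.length_map, List.length_finRange] at hmap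
  have hne : (Fin.last n).castSucc ≠ Fin.last (n + 1) := (Fin.castSucc_lt_last _).ne
  -- The specialised kernel is identified with `ratioKernel` only for i ≠ j; the rescaling lemma
  -- with trivial factors shows that this is enough.
  have hcyc := cyclicSum_congr 1 (fun _ => 1) (fun _ => 1) _ _ (fun i j hij =>
    (specMap_diffKernel Λ (MvPowerSeries.constantCoeff v) (MvPowerSeries.constantCoeff w)
      hij).trans (by rw [one_mul, one_mul])) (by simp) (Nat.le_add_left 2 n)
  rw [hmap, ← hcyc, one_mul, specMap_specDiffInv φ hne]
  simp only [List.map_eq_nil_iff, List.finRange_eq_nil_iff]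
  rfl

end Kernel

end Toda

end

theorem theorem1 {W : Type*} [CommRing W] (Λ : RingAut W)
    (f g : W) (E : Wˣ) (hE : Toda.IsExpS Λ g E)
    (v w : MvPowerSeries ℕ W) (hsol : Toda.IsTodaSolution Λ v w)
    (hv : MvPowerSeries.constantCoeff v = f) (hw : MvPowerSeries.constantCoeff w = g)
    (τ : (MvPowerSeries ℕ W)ˣ) (hτ : Toda.IsTauFunction Λ v w τ)
    (ψA ψB : W⸨X⸩[T;T⁻¹]) (hA : Toda.IsWaveA Λ f g ψA) (hB : Toda.IsWaveB Λ f g E ψB)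
    (hpair : Toda.IsPair Λ E ψA ψB)
    (k : ℕ) (hk : 2 ≤ k) :
    Toda.seriesWave (Toda.genSeries k τ) =
      (-1) ^ (k - 1) *
          (Toda.seriesWave (MvPowerSeries.C ((Λ⁻¹ : RingAut W) (E : W) ^ k)) *
            algebraMap (Toda.SpecRing W k) (Toda.SpecWave W k)
              (Ring.inverse (∏ j, Toda.specLam j))) *
          Toda.cyclicSum (fun i j => Toda.kernelD Λ ψA ψB i j) -
        (if k = 2 then
          algebraMap (Toda.SpecRing W k) (Toda.SpecWave W k)
            (Toda.specDiffInv ⟨0, by omega⟩ ⟨1, by omega⟩ ^ 2)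
        else 0) := by
  obtain ⟨n, rfl⟩ := Nat.exists_eq_add_of_le' hk
  rw [mul_assoc, Toda.mul_cyclicSum_kernelD hE hA hB hpair hk, Toda.seriesWave,
    RingHom.comp_apply, Toda.algebraMap_genSeries hsol hτ, hv, hw, map_sub, map_mul, map_pow,
    map_neg, map_one]
  congr 1
  by_cases hn : n = 0
  -- For n = 0 the two distinguished last indices are precisely 0 and 1.
  · subst hn
    simp only [if_true]
    rfl
  · simp [hn]
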